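/- Let $d\ge 1$, $q\ge 0$, $p\ge 2$ be integers. Let $\Theta=\Theta_\lambda\times\Theta_\alpha\subset\mathbb{R}\times\mathbb{R}^q$ with $\Theta_\lambda\subset(0,\infty)$, and consider stationary kernels $K_\theta(x,y)=\lambda\,C_\alpha(x-y)$ on $\mathbb{R}^d$, $\theta=(\lambda,\alpha)$, where $C_\alpha:\mathbb{R}^d\to\mathbb{R}$ and $C_\alpha(0)=1$. Put $\rho_\theta^{(l)}(x_1,\dots,x_l)=\det\big(K_\theta(x_i,x_j)\big)_{i,j\le l}$. Assumption 1. For every $(\lambda,\alpha)\in\Theta$, $C_\alpha\in L^2(\mathbb{R}^d)$ and $C_\alpha(x)=\int\varphi(\xi)e^{2\pi i\langle x,\xi\rangle}d\xi$ for an integrable $\varphi$ with $0\le\varphi\le 1/\lambda$. Assumption 2. (i) There is $r'>0$ such that, for $\theta_1,\theta_2\in\Theta$, if $K_{\theta_1}(x,y)=K_{\theta_2}(x,y)$ whenever $|x-y|\le r'$, then $\theta_1=\theta_2$. (ii) For every $\theta\in\Theta$, every $l$ and all pairwise distinct $x_1,\dots,x_l$ the matrix $(K_\theta(x_i,x_j))_{i,j}$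 is positive definite. (iii) $K_\theta(x,y)$ is four times continuously differentiable in $\theta\in\Theta$, and its derivatives of order at most $4$ are bounded uniformly in $\theta,x,y$. (iv) $\Theta$ is compact and convex. Let $\theta_0=(\lambda_0,\alpha_0)$ be an interior point of $\Theta$ and let $X$ be a determinantal point process with kernel $K_{\theta_0}$, that is, a random locally finite subset of $\mathbb{R}^d$ whose $l$-th order joint intensity is $\rho_{\theta_0}^{(l)}$ for every $l\ge 1$. Let $N$ be its counting measure and $N^{(p)}$ the counting measure of the $p$-tuples of pairwise distinct points of $X$. Let $D_n\subset\mathbb{R}^d$ be bounded Borel sets with $|D_n|\asymp n^d$ and $\mu_{d-1}(\partial D_n)\asymp n^{d-1}$ as $n\to\infty$, where $\mu_{d-1}$ is the $(d-1)$-dimensional Hausdorff measure. Let $r>0$, and let $w:(\mathbb{R}^d)^p\to[0,\infty)$ be a bounded, measurable, translation invariant function (that is, $w(x_1+c,\dots,x_p+c)=w(x_1,\dots,x_p)$ for every $c\in\mathbb{R}^d$) with support $\{(x_1,\dots,x_p):|x_1-x_j|\le r,\ 1\le j\le p\}$. Put $$\mathbb{H}_{n1}(\lambda)=\int_{D_n}\log\lambda\,N(dx)-\int_{D_n}\lambda\,du,\qquad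 K_{w,p}(\theta)=\int_{D_n^p}\rho^{(p)}_\theta(x)\,w(x)\,dx,$$ $$\mathbb{H}^{(p)}_{n2}(\lambda,\alpha)=\int_{D_n^p}\big\{\log\rho_\theta^{(p)}(x)-\log K_{w,p}(\theta)\big\}\,w(x)\,N^{(p)}(dx),$$ and let $U^{(p)}_n(\theta)=(\partial_\lambda\mathbb{H}_{n1},\partial_{\alpha_1}\mathbb{H}^{(p)}_{n2},\dots,\partial_{\alpha_q}\mathbb{H}^{(p)}_{n2})^\top$. Then under Assumptions 1 and 2 the components of $U_n^{(p)}(\theta_0)$ (normalized by $|D_n|^{-1/2}$, read as $0$ if $|D_n|=0$) are square integrable, and the covariance matrices $\mathrm{Var}_{\theta_0}\big[|D_n|^{-1/2}U_n^{(p)}(\theta_0)\big]$ converge as $n\to\infty$ to a $(q+1)\times(q+1)$ matrix $$\Sigma^{(p)}(\theta_0)=\begin{pmatrix}\Sigma_{11}&\Sigma_{12}\\ \Sigma_{12}^\top&\Sigma_{22}\end{pmatrix}.$$ Here $\Sigma_{11}=\frac1{\lambda_0}-\int_{\mathbb{R}^d}C_{\alpha_0}(u)^2\,du$, while $(\Sigma_{12})_i=\Lambda(1/\lambda_0,f_i)$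 and $(\Sigma_{22})_{ij}=\Lambda(f_i,f_j)$, where $1/\lambda_0$ is regarded as a constant function of one point, $$f_i(x)=\Big(\frac{\partial_{\alpha_i}\rho^{(p)}_{\theta_0}(x)}{\rho^{(p)}_{\theta_0}(x)}-\kappa_i\Big)w(x),\qquad \kappa_i=\frac{\int\partial_{\alpha_i}\rho^{(p)}_{\theta_0}(0,u)\,w(0,u)\,du}{\int\rho^{(p)}_{\theta_0}(0,u)\,w(0,u)\,du}$$ (with $\kappa_i=0$ if the denominator vanishes), and, for a function $f$ of $s$ points and a function $g$ of $t$ points, $$\Lambda(f,g)=\sum_{l=\max(s,t)}^{s+t}\frac1{l!}\sum_{(a,b)}\int_{(\mathbb{R}^d)^{l-1}}f(z_{a})\,g(z_{b})\,\Big\{\rho^{(l)}_{\theta_0}(z)-\mathbf{1}_{\{l=s+t\}}\,\rho^{(s)}_{\theta_0}(z_a)\,\rho^{(t)}_{\theta_0}(z_b)\Big\}\,du_2\cdots du_l .$$ In this formula $z=(0,u_2,\dots,u_l)$; the inner sum is over all pairs of injections $a:\{1,\dots,s\}\to\{1,\dots,l\}$ and $b:\{1,\dots,t\}\to\{1,\dots,l\}$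 whose ranges together cover $\{1,\dots,l\}$; $z_a=(z_{a(1)},\dots,z_{a(s)})$ and similarly for $z_b$. All these integrals converge absolutely. In particular $\Sigma_{22}$ is given by integrals of joint intensities of orders $p$ to $2p$. -/

import Mathlib

open MeasureTheory ProbabilityTheory Filter Topology Asymptotics
open scoped FourierTransform ENNReal

noncomputable section

namespace DPPScore

/-- The state space `ℝ^d` with its Euclidean norm. -/
abbrev Sp (d : ℕ) := EuclideanSpace ℝ (Fin d)

/-- Parameters `θ = (lam, α)` in `ℝ × ℝ^q`. -/
abbrev Param (q : ℕ) := ℝ × EuclideanSpace ℝ (Fin q)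

/-! ### Point processes and determinantal point processes -/

/-- `X` is a (simple) point process: its values are locally finite subsets of `ℝ^d`, and the
number of points in every bounded Borel set is a random variable. -/
structure IsPointProcess {Ω : Type*} [MeasurableSpace Ω] {d : ℕ} (X : Ω → Set (Sp d)) : Prop where
  finite_inter : ∀ ω (B : Set (Sp d)), Bornology.IsBounded B → (X ω ∩ B).Finite
  measurable_count : ∀ B : Set (Sp d), MeasurableSet B → Bornology.IsBounded B →
    Measurable fun ω => (X ω ∩ B).ncard

/-- The counting measure `N` of a configuration `S`. -/
def countMeasure {d : ℕ} (S : Set (Sp d)) : Measure (Sp d) :=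
  Measure.sum fun x : S => Measure.dirac (x : Sp d)

/-- The counting measure `N^{(p)}` of the `p`-tuples of pairwise distinct points of `S`. -/
def factorialMeasure {d : ℕ} (p : ℕ) (S : Set (Sp d)) : Measure (Fin p → Sp d) :=
  Measure.sum fun x : {x : Fin p → Sp d // Function.Injective x ∧ ∀ i, x i ∈ S} =>
    Measure.dirac (x : Fin p → Sp d)

/-- The matrix `[K](x_1, …, x_p) = (K(x_i, x_j))_{i,j}`. -/
def kernelMatrix {d p : ℕ} (K : Sp d → Sp d → ℝ) (x : Fin p → Sp d) : Matrix (Fin p) (Fin p) ℝ :=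
  Matrix.of fun i j => K (x i) (x j)

/-- The determinantal joint intensity `ρ^{(p)}(x_1, …, x_p) = det [K](x_1, …, x_p)`. -/
def jointIntensity {d p : ℕ} (K : Sp d → Sp d → ℝ) (x : Fin p → Sp d) : ℝ :=
  (kernelMatrix K x).det

/-- `X ∼ DPP(K)` under `P`: for every `p ≥ 1` the `p`-th factorial moment measure of `X` has the
density `det [K]` with respect to Lebesgue measure. -/
structure IsDPP {Ω : Type*} [MeasurableSpace Ω] {d : ℕ} (P : Measure Ω) (X : Ω → Set (Sp d))
    (K : Sp d → Sp d → ℝ) : Prop where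
  isPointProcess : IsPointProcess X
  intensity_nonneg : ∀ p : ℕ, 1 ≤ p → ∀ᵐ x : Fin p → Sp d, 0 ≤ jointIntensity K x
  factorialMoment : ∀ p : ℕ, 1 ≤ p → ∀ A : Fin p → Set (Sp d),
    (∀ i, MeasurableSet (A i)) → (∀ i, Bornology.IsBounded (A i)) →
    ∫⁻ ω, factorialMeasure p (X ω) (Set.univ.pi A) ∂P =
      ∫⁻ x in Set.univ.pi A, ENNReal.ofReal (jointIntensity K x)

/-! ### The parametric model -/

/-- The stationary kernel `K_θ(x, y) = lam * C_α(x - y)`, where `θ = (lam, α)`. -/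
def stationaryKernel {d q : ℕ} (C : EuclideanSpace ℝ (Fin q) → Sp d → ℝ) (θ : Param q)
    (x y : Sp d) : ℝ :=
  θ.1 * C θ.2 (x - y)

/-- `φ` is a spectral density of `c`: a nonnegative integrable function with
`c(x) = ∫ φ(ξ) exp(2πi⟨x, ξ⟩) dξ`. -/
def IsSpectralDensity {d : ℕ} (c φ : Sp d → ℝ) : Prop :=
  (∀ ξ, 0 ≤ φ ξ) ∧ Integrable φ ∧ ∀ x, (c x : ℂ) = 𝓕⁻ (fun ξ => (φ ξ : ℂ)) x

/-- The conditions under which `DPP(K_θ)` exists for every `θ`. -/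
structure ExistenceAssumption {d q : ℕ} (C : EuclideanSpace ℝ (Fin q) → Sp d → ℝ)
    (Θl : Set ℝ) (Θa : Set (EuclideanSpace ℝ (Fin q))) : Prop where
  lam_pos : ∀ lam ∈ Θl, 0 < lam
  normalized : ∀ α ∈ Θa, C α 0 = 1
  memLp_two : ∀ α ∈ Θa, MemLp (C α) 2 volume
  spectral : ∀ lam ∈ Θl, ∀ α ∈ Θa, ∃ φ, IsSpectralDensity (C α) φ ∧ ∀ ξ, φ ξ ≤ 1 / lam

/-- The regularity conditions on the parametric model. -/
structure RegularityAssumption {d q : ℕ} (C : EuclideanSpace ℝ (Fin q) → Sp d → ℝ)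
    (Θl : Set ℝ) (Θa : Set (EuclideanSpace ℝ (Fin q))) : Prop where
  identifiable : ∃ r > 0, ∀ θ₁ ∈ Θl ×ˢ Θa, ∀ θ₂ ∈ Θl ×ˢ Θa,
    (∀ x y : Sp d, ‖x - y‖ ≤ r → stationaryKernel C θ₁ x y = stationaryKernel C θ₂ x y) →
      θ₁ = θ₂
  posDef : ∀ θ ∈ Θl ×ˢ Θa, ∀ (p : ℕ) (x : Fin p → Sp d), Function.Injective x →
    (kernelMatrix (stationaryKernel C θ) x).PosDef
  contDiffOn : ∀ x y : Sp d, ContDiffOn ℝ 4 (fun θ => stationaryKernel C θ x y) (Θl ×ˢ Θa)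
  bounded_deriv : ∃ M : ℝ, ∀ k ≤ 4, ∀ θ ∈ Θl ×ˢ Θa, ∀ x y : Sp d,
    ‖iteratedFDerivWithin ℝ k (fun θ => stationaryKernel C θ x y) (Θl ×ˢ Θa) θ‖ ≤ M
  compact : IsCompact (Θl ×ˢ Θa)
  convex : Convex ℝ (Θl ×ˢ Θa)

/-! ### Observation windows, weights and scores -/

/-- Observation windows: bounded Borel sets with `|D_n| ≍ n^d` and `μ_{d-1}(∂D_n) ≍ n^{d-1}`.
(The second condition forces the boundary measure to be finite and nonzero for large `n`.) -/
structure IsWindowSequence {d : ℕ} (D : ℕ → Set (Sp d)) : Prop where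
  measurableSet : ∀ n, MeasurableSet (D n)
  isBounded : ∀ n, Bornology.IsBounded (D n)
  volume_isTheta : (fun n => (volume (D n)).toReal) =Θ[atTop] fun n => (n : ℝ) ^ d
  frontier_isTheta :
    (fun n => (Measure.hausdorffMeasure ((d : ℝ) - 1) (frontier (D n))).toReal)
      =Θ[atTop] fun n => (n : ℝ) ^ (d - 1)

/-- `S_r^p = {(x_1, …, x_p) : |x_1 - x_j| ≤ r for 1 ≤ j ≤ p}`. -/
def nearTuples (d p : ℕ) (r : ℝ) : Set (Fin p → Sp d) :=
  {x | ∀ i j : Fin p, (i : ℕ) = 0 → ‖x i - x j‖ ≤ r}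

/-- Weight functions: bounded, nonnegative, Borel, translation invariant, with support `S_r^p`. -/
structure IsWeight {d p : ℕ} (r : ℝ) (w : (Fin p → Sp d) → ℝ) : Prop where
  measurable : Measurable w
  nonneg : ∀ x, 0 ≤ w x
  bounded : ∃ M : ℝ, ∀ x, w x ≤ M
  support : tsupport w = nearTuples d p r
  translation : ∀ (c : Sp d) (x : Fin p → Sp d), w (fun i => x i + c) = w x

/-- The quasi-likelihood `∫_D log lam N(dx) - ∫_D lam du` of the configuration `S` in `D`. -/
def intensityLogLik {d : ℕ} (D S : Set (Sp d)) (lam : ℝ) : ℝ :=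
  (∫ _x in D, Real.log lam ∂(countMeasure S)) - ∫ _u in D, lam

/-- The modified `K`-function `∫_{D^p} ρ_θ^{(p)} w dx`. -/
def modifiedK {d p : ℕ} (K : Sp d → Sp d → ℝ) (w : (Fin p → Sp d) → ℝ) (D : Set (Sp d)) : ℝ :=
  ∫ x in Set.univ.pi (fun _ : Fin p => D), jointIntensity K x * w x

/-- The `p`-th order composite likelihood
`∫_{D^p} (log ρ^{(p)} - log K_{w,p}) w dN^{(p)}` of the configuration `S`. -/
def compositeLogLik {d p : ℕ} (K : Sp d → Sp d → ℝ) (w : (Fin p → Sp d) → ℝ)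
    (D S : Set (Sp d)) : ℝ :=
  ∫ x in Set.univ.pi (fun _ : Fin p => D),
    (Real.log (jointIntensity K x) - Real.log (modifiedK K w D)) * w x ∂(factorialMeasure p S)

/-- The partial derivative `∂_{α_i} F` at `θ = (lam, α)`. -/
def partialAlpha {q : ℕ} (i : Fin q) (F : Param q → ℝ) (θ : Param q) : ℝ :=
  deriv (fun t : ℝ => F (θ.1, θ.2 + t • EuclideanSpace.single i (1 : ℝ))) 0

/-- The score `U^{(p)}(θ) = (∂_lam H_1, ∂_{α_1} H_2^{(p)}, …, ∂_{α_q} H_2^{(p)})` of the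
configuration `S` observed in `D`. -/
def score {d p q : ℕ} (C : EuclideanSpace ℝ (Fin q) → Sp d → ℝ) (w : (Fin p → Sp d) → ℝ)
    (D S : Set (Sp d)) (θ : Param q) : Fin (q + 1) → ℝ :=
  Fin.cons (deriv (fun lam => intensityLogLik D S lam) θ.1)
    (fun i => partialAlpha i (fun η => compositeLogLik (stationaryKernel C η) w D S) θ)

/-- The normalized score `|D|^{-1/2} U^{(p)}(θ)`. -/
def normalizedScore {d p q : ℕ} (C : EuclideanSpace ℝ (Fin q) → Sp d → ℝ)
    (w : (Fin p → Sp d) → ℝ) (D S : Set (Sp d)) (θ : Param q) (i : Fin (q + 1)) : ℝ :=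
  (Real.sqrt (volume D).toReal)⁻¹ * score C w D S θ i

/-! ### The limit covariance -/

/-- The tuple `(0, u_2, …, u_l)`. -/
def anchored {d l : ℕ} (u : Fin (l - 1) → Sp d) (i : Fin l) : Sp d :=
  if h : (i : ℕ) = 0 then 0 else u ⟨(i : ℕ) - 1, by omega⟩

/-- The limiting score density: for `x = (x_1, …, x_p)`,
`(∂_{α_i} ρ_θ^{(p)}(x) / ρ_θ^{(p)}(x) - κ_i) w(x)`, where
`κ_i = ∫ ∂_{α_i} ρ_θ^{(p)}(0, u) w(0, u) du / ∫ ρ_θ^{(p)}(0, u) w(0, u) du`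
is the limit of `∂_{α_i} K_{w,p} / K_{w,p}` for growing windows. -/
def limitScoreDensity {d p q : ℕ} (C : EuclideanSpace ℝ (Fin q) → Sp d → ℝ)
    (w : (Fin p → Sp d) → ℝ) (θ : Param q) (i : Fin q) (x : Fin p → Sp d) : ℝ :=
  (partialAlpha i (fun η => jointIntensity (stationaryKernel C η) x) θ
        / jointIntensity (stationaryKernel C θ) x
      - (∫ u : Fin (p - 1) → Sp d,
            partialAlpha i (fun η => jointIntensity (stationaryKernel C η) (anchored u)) θ
              * w (anchored u))
          / ∫ u : Fin (p - 1) → Sp d,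
              jointIntensity (stationaryKernel C θ) (anchored u) * w (anchored u))
    * w x

/-- The ways `(a, b)` of choosing a `p`-tuple and an `s`-tuple of pairwise distinct members among
`l` points that together use all the `l` points. -/
def overlaps (p s l : ℕ) : Set ((Fin p ↪ Fin l) × (Fin s ↪ Fin l)) :=
  {ab | ∀ k, k ∈ Set.range ab.1 ∨ k ∈ Set.range ab.2}

/-- The integrand for the overlap `(a, b)` of a `p`-tuple and an `s`-tuple: with
`z = (0, u_2, …, u_l)`, it is `f(z_a) g(z_b) ρ^{(l)}(z)`, where `ρ^{(l)}(z)` is replaced by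
`ρ^{(l)}(z) - ρ^{(p)}(z_a) ρ^{(s)}(z_b)` when the two tuples are disjoint (`l = p + s`). -/
def overlapIntegrand {d p s l : ℕ} (K : Sp d → Sp d → ℝ) (f : (Fin p → Sp d) → ℝ)
    (g : (Fin s → Sp d) → ℝ) (ab : (Fin p ↪ Fin l) × (Fin s ↪ Fin l))
    (u : Fin (l - 1) → Sp d) : ℝ :=
  f (anchored u ∘ ab.1) * g (anchored u ∘ ab.2) *
    (jointIntensity K (anchored u) -
      if l = p + s then
        jointIntensity K (anchored u ∘ ab.1) * jointIntensity K (anchored u ∘ ab.2)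
      else 0)

open Classical in
/-- `σ` is the sum over `l = max p s, …, p + s` of
`(1 / l!) ∑_{(a, b)} ∫ f(z_a) g(z_b) ρ^{(l)}(z) du_2 ⋯ du_l` (with `ρ^{(l)}` truncated for
`l = p + s`), all the integrals being absolutely convergent. -/
def HasLimitCov {d p s : ℕ} (K : Sp d → Sp d → ℝ) (f : (Fin p → Sp d) → ℝ)
    (g : (Fin s → Sp d) → ℝ) (σ : ℝ) : Prop :=
  (∀ l ∈ Finset.Icc (max p s) (p + s), ∀ ab ∈ overlaps p s l,
      Integrable (overlapIntegrand K f g ab) volume) ∧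
    σ = ∑ l ∈ Finset.Icc (max p s) (p + s), ((l.factorial : ℝ))⁻¹ *
      ∑ ab ∈ Finset.univ.filter (fun ab => ab ∈ overlaps p s l),
        ∫ u : Fin (l - 1) → Sp d, overlapIntegrand K f g ab u

end DPPScore

end

/-! Given the configuration, every component of the score is a deterministic constant plus a sum of
a translation invariant, finite range statistic over tuples of distinct points. A product of two
such sums splits according to how the tuples overlap (`sum_tuples_mul_sum_tuples`), and Campbell's
formula turns each overlap pattern into an integral over `D ^ l`. Subtracting the product of the
means truncates exactly the patterns with disjoint tuples, so the covariance is a finite sum of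
window integrals of the functions `overlapFun` (`IsDPP.cov_statSum`).

For a translation invariant `H`, the integral over `D ^ l` divided by `|D|` converges to the
integral of `H` over the displacements, once the latter converges absolutely
(`tendsto_setIntegral_div`). A fixed translation moves out of the window only a volume controlled by
the boundary measure, of order `n ^ (d - 1)` against `n ^ d`.

Absolute integrability is the main difficulty, because `∂ρ / ρ` may be unbounded near coincident
points. Since `ρ` is nonnegative along the parameter segment and has a uniformly quadratic Taylor
remainder, Landau's inequality gives `|∂ρ| ≤ c √ρ`. Hence each statistic satisfies `|f| √ρ ≤ c`, the
condition in `IsLocalStat`. When the tuples share a point, Fischer's inequality bounds `ρ(z)` by a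
constant times `ρ(z_a)` and also times `ρ(z_b)`. The geometric mean of the two bounds cancels both
singularities, and finite range confines the displacements to a bounded set. When the tuples are
disjoint, a Schur complement writes the defect `ρ(x) ρ(y) - ρ(x, y)` as `ρ(x)` times a difference of
determinants, bounded by the trace of the covariance of `y` explained by `x`. Plancherel and `0 ≤
lam φ ≤ 1` express that `K` is a contraction on `L²`, which bounds the integral of this trace over
the relative displacement independently of the shapes. Exchanging the groups and taking a geometric
mean gives `c √ρ(x) √ρ(y)` (`IsContractionKernel.lintegral_defect_le_sqrt`), again enough to absorb
both singularities.

Finally, the centering `∂K_{w,p} / K_{w,p}` depends on the window but converges to `κ`. Replacing it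
by its limit changes the score by a vanishing multiple of the local sum of `w`, which does not
affect the limit (`IsDPP.tendsto_cov_perturbed`). -/

noncomputable section

namespace DPPScore

/-! ### Windows are asymptotically invariant under translations -/

/-- The volume of the part of `D` which the translation by `u` moves out of `D`. -/
def shiftLoss {d : ℕ} (D : Set (Sp d)) (u : Sp d) : ℝ≥0∞ :=
  volume (D \ (fun x => x + u) ⁻¹' D)

lemma shiftLoss_zero {d : ℕ} (D : Set (Sp d)) : shiftLoss D 0 = 0 := by
  simp [shiftLoss]

/-- A point lost under the combined translation is lost either at the first step or, from its new
position, at the second. This reduces general translations to coordinate directions. -/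
lemma shiftLoss_add_le {d : ℕ} (D : Set (Sp d)) (u v : Sp d) :
    shiftLoss D (u + v) ≤ shiftLoss D u + shiftLoss D v := by
  have hsub : D \ (fun x => x + (u + v)) ⁻¹' D ⊆
      (D \ (fun x => x + u) ⁻¹' D) ∪ (fun x => x + u) ⁻¹' (D \ (fun x => x + v) ⁻¹' D) := by
    rintro x ⟨hx, hx'⟩
    by_cases h : x + u ∈ D
    · right
      exact ⟨h, by simpa [add_assoc] using hx'⟩
    · exact Or.inl ⟨hx, h⟩
  calc shiftLoss D (u + v) ≤ _ := measure_mono hsub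
    _ ≤ _ := measure_union_le _ _
    _ = _ := by rw [measure_preimage_add_right]; rfl

lemma shiftLoss_sum_le {d : ℕ} (D : Set (Sp d)) {ι : Type*} (s : Finset ι) (u : ι → Sp d) :
    shiftLoss D (∑ k ∈ s, u k) ≤ ∑ k ∈ s, shiftLoss D (u k) := by
  classical
  induction s using Finset.induction_on with
  | empty => simp [shiftLoss_zero]
  | insert a s ha ih =>
    rw [Finset.sum_insert ha, Finset.sum_insert ha]
    exact (shiftLoss_add_le _ _ _).trans (by gcongr)

/-- A segment is connected, so it cannot pass from the interior to the exterior without meeting the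
frontier. -/
lemma exists_mem_frontier_of_segment {d : ℕ} {D : Set (Sp d)} {x v : Sp d} (hx : x ∈ D)
    (hxv : x + v ∉ D) : ∃ τ ∈ Set.Icc (0 : ℝ) 1, x + τ • v ∈ frontier D := by
  by_contra! h
  have hpre : IsPreconnected ((fun τ : ℝ => x + τ • v) '' Set.Icc 0 1) :=
    isPreconnected_Icc.image _ (by fun_prop)
  have hcover : (fun τ : ℝ => x + τ • v) '' Set.Icc 0 1 ⊆ interior D ∪ interior Dᶜ := by
    rw [← compl_frontier_eq_union_interior]
    rintro _ ⟨τ, hτ, rfl⟩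
    exact h τ hτ
  have h0 : x ∈ (fun τ : ℝ => x + τ • v) '' Set.Icc 0 1 := ⟨0, by simp, by simp⟩
  have h1 : x + v ∈ (fun τ : ℝ => x + τ • v) '' Set.Icc 0 1 := ⟨1, by simp, by simp⟩
  rcases hpre.subset_or_subset isOpen_interior isOpen_interior
    (disjoint_compl_right.mono interior_subset interior_subset) hcover with h' | h'
  · exact hxv (interior_subset (h' h1))
  · exact interior_subset (h' h0) hx

/-- The volume swept by a small set moved along a coordinate axis. -/
lemma volume_sweep_le {d : ℕ} (k : Fin d) (s : ℝ) (t : Set (Sp d))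
    (ht : Metric.ediam t ≤ 1) :
    volume {x : Sp d | ∃ τ ∈ Set.Icc (0 : ℝ) 1, x + τ • (EuclideanSpace.single k s) ∈ t} ≤
      ENNReal.ofReal (2 ^ (d - 1) * (2 + 2 * |s|)) *
        ⨆ _ : t.Nonempty, Metric.ediam t ^ ((d : ℝ) - 1) := by
  -- The guard `t.Nonempty` matters for `d = 1`, where the exponent is zero and an empty set would
  -- otherwise contribute `0 ^ 0 = 1`.
  rcases t.eq_empty_or_nonempty with rfl | hne
  · simp
  rw [ciSup_pos hne]
  obtain ⟨y, hy⟩ := hne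
  have hd : 1 ≤ d := Nat.one_le_of_lt k.2
  have hfin : Metric.ediam t ≠ ⊤ := (ht.trans_lt ENNReal.one_lt_top).ne
  set δ : ℝ := Metric.diam t with hδ
  have hδ0 : 0 ≤ δ := Metric.diam_nonneg
  have hδ1 : δ ≤ 1 := by
    rw [hδ, Metric.diam]
    exact ENNReal.toReal_le_of_le_ofReal zero_le_one (by simpa using ht)
  have hδe : Metric.ediam t = ENNReal.ofReal δ := by
    rw [hδ, Metric.diam, ENNReal.ofReal_toReal hfin]
  -- The swept set lies in a box around `y` with half-width `δ`, enlarged by the length of the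
  -- motion in direction `k` only. The other `d - 1` sides supply the power `δ ^ (d - 1)`.
  set b : Fin d → ℝ := fun j => if j = k then δ + |s| else δ with hb
  have hsub : {x : Sp d | ∃ τ ∈ Set.Icc (0 : ℝ) 1, x + τ • (EuclideanSpace.single k s) ∈ t} ⊆
      (WithLp.ofLp : Sp d → Fin d → ℝ) ⁻¹' (Set.Icc (fun j => y j - b j) (fun j => y j + b j)) := by
    rintro x ⟨τ, hτ, hx⟩
    have hcoord : ∀ j, |x j - y j| ≤ b j := by
      intro j
      have h1 : |(x + τ • (EuclideanSpace.single k s : Sp d)) j - y j| ≤ δ := by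
        have h2 := PiLp.norm_apply_le (x + τ • (EuclideanSpace.single k s : Sp d) - y) j
        have h3 : ‖x + τ • (EuclideanSpace.single k s : Sp d) - y‖ ≤ δ := by
          rw [← dist_eq_norm]
          exact Metric.dist_le_diam_of_mem (Metric.isBounded_iff_ediam_ne_top.2 hfin) hx hy
        simpa using h2.trans h3
      by_cases hj : j = k
      · subst hj
        have h4 : |τ * s| ≤ |s| := by
          rw [abs_mul, abs_of_nonneg hτ.1]
          exact mul_le_of_le_one_left (abs_nonneg _) hτ.2
        have h5 : |x j + τ * s - y j| ≤ δ := by simpa using h1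
        simp only [hb, if_true]
        rw [abs_le] at *
        constructor <;> linarith [h4.1, h4.2, h5.1, h5.2]
      · simpa [hb, hj] using h1
    refine ⟨fun j => ?_, fun j => ?_⟩
    · have := (abs_le.1 (hcoord j)).1
      simp only; linarith
    · have := (abs_le.1 (hcoord j)).2
      simp only; linarith
  refine (measure_mono hsub).trans ?_
  rw [(PiLp.volume_preserving_ofLp (Fin d)).measure_preimage measurableSet_Icc.nullMeasurableSet,
    Real.volume_Icc_pi]
  have hbj : ∀ j, y j + b j - (y j - b j) = 2 * b j := fun j => by ring
  simp only [hbj]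
  rw [← Finset.mul_prod_erase _ _ (Finset.mem_univ k)]
  have hprod : ∏ j ∈ Finset.univ.erase k, ENNReal.ofReal (2 * b j)
      = ENNReal.ofReal (2 * δ) ^ (d - 1) := by
    rw [Finset.prod_congr rfl (g := fun _ => ENNReal.ofReal (2 * δ))]
    · simp
    · intro j hj
      simp [hb, Finset.ne_of_mem_erase hj]
  rw [hprod, hδe]
  have hcast : (d : ℝ) - 1 = ((d - 1 : ℕ) : ℝ) := by push_cast [hd]; ring
  rw [hcast, ENNReal.rpow_natCast, ← ENNReal.ofReal_pow (by positivity),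
    ← ENNReal.ofReal_pow hδ0, ← ENNReal.ofReal_mul (by simp only [hb, if_true]; positivity),
    ← ENNReal.ofReal_mul (by positivity)]
  apply ENNReal.ofReal_le_ofReal
  simp only [hb, if_true, mul_pow]
  have h6 : 2 * (δ + |s|) ≤ 2 + 2 * |s| := by linarith
  calc 2 * (δ + |s|) * (2 ^ (d - 1) * δ ^ (d - 1))
      ≤ (2 + 2 * |s|) * (2 ^ (d - 1) * δ ^ (d - 1)) := by gcongr
    _ = _ := by ring

/-- Every lost point crosses the frontier on its way, so a cover of the frontier yields a cover of
the lost points by sweeps. `volume_sweep_le` compares each sweep with one term of the Hausdorff sum.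
-/
lemma shiftLoss_single_le {d : ℕ} (D : Set (Sp d)) (k : Fin d) (s : ℝ) :
    shiftLoss D (EuclideanSpace.single k s) ≤
      ENNReal.ofReal (2 ^ (d - 1) * (2 + 2 * |s|)) *
        Measure.hausdorffMeasure ((d : ℝ) - 1) (frontier D) := by
  have hc0 : ENNReal.ofReal (2 ^ (d - 1) * (2 + 2 * |s|)) ≠ 0 := by
    simp only [ne_eq, ENNReal.ofReal_eq_zero, not_le]; positivity
  rw [mul_comm, ← ENNReal.div_le_iff hc0 ENNReal.ofReal_ne_top, Measure.hausdorffMeasure_apply]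
  -- Hausdorff measure is a supremum over mesh sizes, so covers by sets of diameter at most `1`
  -- already suffice for an upper bound by it.
  refine le_trans ?_ (le_iSup₂_of_le (1 : ℝ≥0∞) one_pos le_rfl)
  refine le_iInf fun t => le_iInf fun ht => le_iInf fun hd => ?_
  rw [ENNReal.div_le_iff hc0 ENNReal.ofReal_ne_top, mul_comm, ← ENNReal.tsum_mul_left]
  calc shiftLoss D (EuclideanSpace.single k s)
      ≤ volume (⋃ n, {x : Sp d | ∃ τ ∈ Set.Icc (0 : ℝ) 1,
          x + τ • (EuclideanSpace.single k s) ∈ t n}) := by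
        refine measure_mono fun x hx => ?_
        obtain ⟨τ, hτ, h⟩ := exists_mem_frontier_of_segment hx.1 hx.2
        obtain ⟨n, hn⟩ := Set.mem_iUnion.1 (ht h)
        exact Set.mem_iUnion.2 ⟨n, τ, hτ, hn⟩
    _ ≤ _ := measure_iUnion_le _
    _ ≤ _ := ENNReal.tsum_le_tsum fun n => volume_sweep_le k s (t n) (hd n)

lemma shiftLoss_le {d : ℕ} (D : Set (Sp d)) (u : Sp d) :
    shiftLoss D u ≤ ENNReal.ofReal (∑ k, 2 ^ (d - 1) * (2 + 2 * |u k|)) *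
        Measure.hausdorffMeasure ((d : ℝ) - 1) (frontier D) := by
  have hu : u = ∑ k, EuclideanSpace.single k (u k) := by
    ext j
    simp [Finset.sum_apply, Pi.single_apply]
  calc shiftLoss D u = shiftLoss D (∑ k, EuclideanSpace.single k (u k)) := by rw [← hu]
    _ ≤ ∑ k, shiftLoss D (EuclideanSpace.single k (u k)) := shiftLoss_sum_le _ _ _
    _ ≤ ∑ k, ENNReal.ofReal (2 ^ (d - 1) * (2 + 2 * |u k|)) *
        Measure.hausdorffMeasure ((d : ℝ) - 1) (frontier D) :=
      Finset.sum_le_sum fun k _ => shiftLoss_single_le D k (u k)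
    _ = _ := by
      rw [← Finset.sum_mul, ENNReal.ofReal_sum_of_nonneg]
      intro k _; positivity

namespace IsWindowSequence
variable {d : ℕ} {D : ℕ → Set (Sp d)}

lemma eventually_volume_pos (hD : IsWindowSequence D) :
    ∀ᶠ n in atTop, 0 < (volume (D n)).toReal := by
  filter_upwards [hD.volume_isTheta.2.eq_zero_imp, eventually_gt_atTop 0] with n h0 hn
  refine ENNReal.toReal_nonneg.lt_of_ne fun h => ?_
  have := h0 h.symm
  have hn' : (0 : ℝ) < n := by exact_mod_cast hn
  exact (pow_pos hn' d).ne' this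

/-- `toReal` sends `⊤` to `0`, so the lower half of the `Θ` relation rules out an infinite boundary
measure. Otherwise the upper half would give no information about the true boundary. -/
lemma eventually_frontier_ne_top (hD : IsWindowSequence D) :
    ∀ᶠ n in atTop, Measure.hausdorffMeasure ((d : ℝ) - 1) (frontier (D n)) ≠ ⊤ := by
  filter_upwards [hD.frontier_isTheta.2.eq_zero_imp, eventually_gt_atTop 0] with n h0 hn htop
  have := h0 (by simp [htop])
  have hn' : (0 : ℝ) < n := by exact_mod_cast hn
  exact (pow_pos hn' (d - 1)).ne' this

lemma tendsto_shiftLoss_div (hd : 1 ≤ d) (hD : IsWindowSequence D) (u : Sp d) :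
    Tendsto (fun n => (shiftLoss (D n) u).toReal / (volume (D n)).toReal) atTop (𝓝 0) := by
  have h1 : (fun n => (shiftLoss (D n) u).toReal) =O[atTop] fun n => (n : ℝ) ^ (d - 1) := by
    refine IsBigO.trans ?_ hD.frontier_isTheta.1
    refine IsBigO.of_bound (∑ k, 2 ^ (d - 1) * (2 + 2 * |u k|)) ?_
    filter_upwards [hD.eventually_frontier_ne_top] with n hn
    rw [Real.norm_of_nonneg ENNReal.toReal_nonneg, Real.norm_of_nonneg ENNReal.toReal_nonneg]
    refine (ENNReal.toReal_mono (ENNReal.mul_ne_top ENNReal.ofReal_ne_top hn)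
      (shiftLoss_le (D n) u)).trans ?_
    rw [ENNReal.toReal_mul, ENNReal.toReal_ofReal]
    exact Finset.sum_nonneg fun k _ => by positivity
  have h2 : (fun n => (shiftLoss (D n) u).toReal / (volume (D n)).toReal) =O[atTop]
      fun n : ℕ => ((n : ℝ))⁻¹ := by
    refine (h1.mul hD.volume_isTheta.inv.1).congr' (Eventually.of_forall fun n => rfl) ?_
    filter_upwards [eventually_gt_atTop 0] with n hn
    have hn' : (n : ℝ) ≠ 0 := by positivity
    obtain ⟨m, rfl⟩ : ∃ m, d = m + 1 := ⟨d - 1, by omega⟩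
    simp only [Nat.add_sub_cancel, pow_succ]
    field_simp
  exact h2.trans_tendsto tendsto_inv_atTop_nhds_zero_nat

end IsWindowSequence

/-! ### Translation invariant functions of several points -/

/-- `H` is invariant under simultaneous translations of its arguments. -/
def TransInv {d l : ℕ} {β : Type*} (H : (Fin l → Sp d) → β) : Prop :=
  ∀ (c : Sp d) (z : Fin l → Sp d), H (fun i => z i + c) = H z

lemma anchored_zero {d l : ℕ} (hl : 1 ≤ l) (u : Fin (l - 1) → Sp d) :
    anchored u (⟨0, hl⟩ : Fin l) = 0 := by simp [anchored]

lemma measurable_anchored {d l : ℕ} :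
    Measurable fun u : Fin (l - 1) → Sp d => (anchored u : Fin l → Sp d) := by
  refine measurable_pi_lambda _ fun i => ?_
  unfold anchored
  split_ifs
  · exact measurable_const
  · exact measurable_pi_apply _

/-- A tuple of points is described by its first point and the displacements of the others. -/
lemma measurePreserving_anchored_add {d l : ℕ} (hl : 1 ≤ l) :
    MeasurePreserving (fun q : Sp d × (Fin (l - 1) → Sp d) =>
      (fun i => anchored q.2 i + q.1 : Fin l → Sp d)) := by
  obtain ⟨m, rfl⟩ : ∃ m, l = m + 1 := ⟨l - 1, by omega⟩
  have h1 : MeasurePreserving (fun q : Sp d × (Fin m → Sp d) => (q.1, q.2 + fun _ => q.1)) :=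
    (MeasurePreserving.id volume).skew_product (g := fun R u => u + fun _ => R)
      (by fun_prop) (Eventually.of_forall fun R => map_add_right_eq_self _ _)
  have h2 := (volume_preserving_piFinSuccAbove (fun _ : Fin (m + 1) => Sp d) 0).symm
  have heq : (fun q : Sp d × (Fin (m + 1 - 1) → Sp d) =>
      (fun i => anchored q.2 i + q.1 : Fin (m + 1) → Sp d)) =
      (MeasurableEquiv.piFinSuccAbove (fun _ : Fin (m + 1) => Sp d) 0).symm ∘
        fun q : Sp d × (Fin m → Sp d) => (q.1, q.2 + fun _ => q.1) := by
    funext q i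
    refine Fin.cases ?_ (fun j => ?_) i
    · simp [anchored, MeasurableEquiv.piFinSuccAbove, Fin.insertNthEquiv]
    · simp [anchored, MeasurableEquiv.piFinSuccAbove, Fin.insertNthEquiv]
  rw [heq]
  exact h2.comp h1

lemma lintegral_eq_anchored {d l : ℕ} (hl : 1 ≤ l) {F : (Fin l → Sp d) → ℝ≥0∞}
    (hF : Measurable F) :
    ∫⁻ z, F z = ∫⁻ R, ∫⁻ u : Fin (l - 1) → Sp d, F (fun i => anchored u i + R) := by
  have h := measurePreserving_anchored_add (d := d) hl
  rw [← h.lintegral_comp hF, Measure.volume_eq_prod, lintegral_prod]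
  exact (hF.comp h.measurable).aemeasurable

/-- The pinned point `z k` need not be the anchor. For fixed displacements it differs from the
anchor by a constant, which translation invariance of Lebesgue measure removes. -/
lemma lintegral_indicator_mul_of_transInv {d l : ℕ} (k : Fin l) {H : (Fin l → Sp d) → ℝ≥0∞}
    (hH : Measurable H) (hinv : TransInv H) {B : Set (Sp d)} (hB : MeasurableSet B) :
    ∫⁻ z, B.indicator 1 (z k) * H z =
      volume B * ∫⁻ u : Fin (l - 1) → Sp d, H (anchored u) := by
  have hl : 1 ≤ l := Nat.one_le_of_lt k.2
  have hm : Measurable fun z : Fin l → Sp d => B.indicator (1 : Sp d → ℝ≥0∞) (z k) * H z :=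
    ((measurable_one.indicator hB).comp (measurable_pi_apply k)).mul hH
  rw [lintegral_eq_anchored hl hm, lintegral_lintegral_swap]
  · rw [← lintegral_const_mul (volume B) (f := fun u : Fin (l - 1) → Sp d => H (anchored u))
      (hH.comp measurable_anchored)]
    refine lintegral_congr fun u => ?_
    have : ∀ R, H (fun i => anchored u i + R) = H (anchored u) := fun R => hinv R _
    simp only [this]
    rw [lintegral_mul_const _ (by
      exact (measurable_one.indicator hB).comp (measurable_const_add _))]
    congr 1
    rw [lintegral_add_left_eq_self (fun R => B.indicator (1 : Sp d → ℝ≥0∞) R),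
      lintegral_indicator_one hB]
  · exact (hm.comp (measurePreserving_anchored_add hl).measurable).aemeasurable

/-- A translation invariant function is integrable in the displacements as soon as it is
integrable over the tuples with one point in a fixed ball. -/
lemma integrable_comp_anchored {d l : ℕ} (k : Fin l) {H : (Fin l → Sp d) → ℝ}
    (hH : Measurable H) (hinv : TransInv H)
    (hfin : ∫⁻ z, (Metric.ball (0 : Sp d) 1).indicator 1 (z k) * ‖H z‖ₑ ≠ ∞) :
    Integrable fun u : Fin (l - 1) → Sp d => H (anchored u) := by
  refine ⟨(hH.comp measurable_anchored).aestronglyMeasurable, ?_⟩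
  rw [lintegral_indicator_mul_of_transInv k hH.enorm
    (fun c z => by rw [hinv c z]) Metric.isOpen_ball.measurableSet] at hfin
  rw [HasFiniteIntegral]
  by_contra h
  rw [not_lt, top_le_iff] at h
  rw [h, ENNReal.mul_top (Metric.measure_ball_pos _ _ one_pos).ne'] at hfin
  exact hfin rfl

/-- The base points `R` for which the tuple `(R, R + u_2, …, R + u_l)` lies in `D`. -/
def baseSet {d l : ℕ} (D : Set (Sp d)) (u : Fin (l - 1) → Sp d) : Set (Sp d) :=
  {R | ∀ i : Fin l, anchored u i + R ∈ D}

lemma baseSet_subset {d l : ℕ} (hl : 1 ≤ l) (D : Set (Sp d)) (u : Fin (l - 1) → Sp d) :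
    baseSet (l := l) D u ⊆ D := fun R hR => by
  simpa [anchored_zero hl u] using hR ⟨0, hl⟩

lemma volume_sub_baseSet_le {d l : ℕ} (D : Set (Sp d)) (u : Fin (l - 1) → Sp d) :
    volume D ≤ volume (baseSet (l := l) D u) + ∑ i : Fin l, shiftLoss D (anchored u i) := by
  have hsub : D ⊆ baseSet (l := l) D u ∪
      ⋃ i ∈ (Finset.univ : Finset (Fin l)), (D \ (fun x => x + anchored u i) ⁻¹' D) := by
    intro x hx
    by_cases h : x ∈ baseSet (l := l) D u
    · exact Or.inl h
    · right
      simp only [baseSet, Set.mem_ofPred_eq, not_forall] at h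
      obtain ⟨i, hi⟩ := h
      simp only [Finset.mem_univ, Set.iUnion_true, Set.mem_iUnion]
      exact ⟨i, hx, by simpa [add_comm] using hi⟩
  refine (measure_mono hsub).trans ((measure_union_le _ _).trans ?_)
  gcongr
  exact measure_biUnion_finset_le _ _

/-- In the coordinates (base point, displacements) the integrand is constant in the base point over
`baseSet D u`, so Fubini leaves the volume of that set as a weight. Integrability follows from
domination by `1_D(R) |H(u)|`. -/
lemma setIntegral_eq_anchored {d l : ℕ} (hl : 1 ≤ l) {D : Set (Sp d)} (hD : MeasurableSet D)
    (hDb : volume D ≠ ∞) {H : (Fin l → Sp d) → ℝ} (hH : Measurable H) (hinv : TransInv H)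
    (hint : Integrable fun u : Fin (l - 1) → Sp d => H (anchored u)) :
    IntegrableOn H (Set.univ.pi fun _ => D) ∧
    ∫ z in Set.univ.pi (fun _ => D), H z =
      ∫ u : Fin (l - 1) → Sp d, (volume (baseSet (l := l) D u)).toReal * H (anchored u) := by
  have hS : MeasurableSet (Set.univ.pi fun _ : Fin l => D) :=
    MeasurableSet.univ_pi fun _ => hD
  have hmp := measurePreserving_anchored_add (d := d) hl
  set G : (Fin l → Sp d) → ℝ := (Set.univ.pi fun _ => D).indicator H with hG
  have hGm : Measurable G := hH.indicator hS
  have hcomp : ∀ q : Sp d × (Fin (l - 1) → Sp d), G (fun i => anchored q.2 i + q.1) =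
      (baseSet (l := l) D q.2).indicator (fun _ => H (anchored q.2)) q.1 := by
    intro q
    by_cases h : q.1 ∈ baseSet (l := l) D q.2
    · rw [Set.indicator_of_mem h, hG, Set.indicator_of_mem (by
        simp only [Set.mem_pi, Set.mem_univ, true_implies]; exact h), hinv]
    · rw [Set.indicator_of_notMem h, hG, Set.indicator_of_notMem (by
        simp only [Set.mem_pi, Set.mem_univ, true_implies]; exact h)]
  have hbase : ∀ u : Fin (l - 1) → Sp d, MeasurableSet (baseSet (l := l) D u) := by
    intro u
    simp only [baseSet, Set.ofPred_forall]
    exact MeasurableSet.iInter fun i => (measurable_const_add (anchored u i)) hD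
  have hint2 : Integrable (fun q : Sp d × (Fin (l - 1) → Sp d) =>
      G (fun i => anchored q.2 i + q.1)) (volume.prod volume) := by
    have hD1 : Integrable (D.indicator fun _ => (1 : ℝ)) volume :=
      (integrable_indicator_iff hD).2 (integrableOn_const hDb)
    refine (hD1.mul_prod hint).mono (hGm.comp hmp.measurable).aestronglyMeasurable
      (Eventually.of_forall fun q => ?_)
    rw [hcomp]
    by_cases h : q.1 ∈ baseSet (l := l) D q.2
    · rw [Set.indicator_of_mem h, Set.indicator_of_mem (baseSet_subset hl D q.2 h), one_mul]
    · rw [Set.indicator_of_notMem h]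
      simpa using mul_nonneg (abs_nonneg _) (abs_nonneg _)
  have hGint : Integrable G := by
    rw [← hmp.map_eq, integrable_map_measure hGm.aestronglyMeasurable hmp.aemeasurable]
    exact hint2
  refine ⟨(integrable_indicator_iff hS).1 hGint, ?_⟩
  rw [← integral_indicator hS, ← hmp.map_eq,
    integral_map hmp.aemeasurable hGm.aestronglyMeasurable, Measure.volume_eq_prod,
    integral_prod_symm _ hint2]
  refine integral_congr_ae (Eventually.of_forall fun u => ?_)
  have : ∀ R, G (fun i => anchored u i + R) =
      (baseSet (l := l) D u).indicator (fun _ => H (anchored u)) R := fun R => hcomp (R, u)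
  simp only [this]
  rw [integral_indicator (hbase u), setIntegral_const, smul_eq_mul, Measure.real]

/-- The weight `|baseSet D u| / |D|` lies in `[0, 1]` and tends to `1` for each fixed `u`, since its
deficit is a finite sum of relative shift losses. Dominated convergence then needs no uniformity in
`u`. -/
theorem tendsto_setIntegral_div {d l : ℕ} (hd : 1 ≤ d) (hl : 1 ≤ l) {D : ℕ → Set (Sp d)}
    (hD : IsWindowSequence D) {H : (Fin l → Sp d) → ℝ} (hH : Measurable H) (hinv : TransInv H)
    (hint : Integrable fun u : Fin (l - 1) → Sp d => H (anchored u)) :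
    Tendsto (fun n => (volume (D n)).toReal⁻¹ * ∫ z in Set.univ.pi (fun _ => D n), H z) atTop
      (𝓝 (∫ u : Fin (l - 1) → Sp d, H (anchored u))) := by
  have hfin : ∀ n, volume (D n) ≠ ∞ := fun n => (hD.isBounded n).measure_lt_top.ne
  have heq : ∀ n, (volume (D n)).toReal⁻¹ * ∫ z in Set.univ.pi (fun _ => D n), H z =
      ∫ u : Fin (l - 1) → Sp d,
        ((volume (D n)).toReal⁻¹ * (volume (baseSet (l := l) (D n) u)).toReal)
          * H (anchored u) := by
    intro n
    rw [(setIntegral_eq_anchored hl (hD.measurableSet n) (hfin n) hH hinv hint).2,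
      ← integral_const_mul]
    simp only [mul_assoc]
  simp only [heq]
  have hmono : ∀ n u, (volume (baseSet (l := l) (D n) u)).toReal ≤ (volume (D n)).toReal :=
    fun n u => ENNReal.toReal_mono (hfin n) (measure_mono (baseSet_subset hl _ u))
  have hle1 : ∀ n u, (volume (D n)).toReal⁻¹ * (volume (baseSet (l := l) (D n) u)).toReal ≤ 1 := by
    intro n u
    rw [inv_mul_eq_div]
    exact div_le_one_of_le₀ (hmono n u) ENNReal.toReal_nonneg
  refine tendsto_integral_of_dominated_convergence (fun u => ‖H (anchored u)‖) ?_ hint.norm ?_ ?_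
  · intro n
    refine AEStronglyMeasurable.mul ?_ hint.1
    refine (Measurable.const_mul (Measurable.ennreal_toReal ?_) _).aestronglyMeasurable
    have hset : MeasurableSet {q : (Fin (l - 1) → Sp d) × Sp d |
        q.2 ∈ baseSet (l := l) (D n) q.1} := by
      have : {q : (Fin (l - 1) → Sp d) × Sp d | q.2 ∈ baseSet (l := l) (D n) q.1} =
          (fun q => (fun i => anchored q.1 i + q.2 : Fin l → Sp d)) ⁻¹'
            (Set.univ.pi fun _ => D n) := by
        ext q
        simp [baseSet]
      rw [this]
      refine ((measurePreserving_anchored_add (d := d) hl).measurable.comp measurable_swap) ?_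
      exact MeasurableSet.univ_pi fun _ => hD.measurableSet n
    exact measurable_measure_prodMk_left hset
  · intro n
    refine Eventually.of_forall fun u => ?_
    rw [norm_mul]
    refine mul_le_of_le_one_left (norm_nonneg _) ?_
    rw [Real.norm_of_nonneg (by positivity)]
    exact hle1 n u
  · refine Eventually.of_forall fun u => ?_
    suffices h : Tendsto (fun n => (volume (D n)).toReal⁻¹ *
        (volume (baseSet (l := l) (D n) u)).toReal) atTop (𝓝 1) by
      simpa using h.mul_const (H (anchored u))
    have hlow : Tendsto (fun n => 1 - ∑ i : Fin l,
        (shiftLoss (D n) (anchored u i)).toReal / (volume (D n)).toReal) atTop (𝓝 1) := by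
      have := tendsto_finsetSum (Finset.univ : Finset (Fin l))
        fun i _ => hD.tendsto_shiftLoss_div hd (anchored u i)
      simpa using this.const_sub 1
    refine tendsto_of_tendsto_of_tendsto_of_le_of_le' hlow tendsto_const_nhds ?_
      (Eventually.of_forall fun n => hle1 n u)
    filter_upwards [hD.eventually_volume_pos] with n hn
    have hloss : ∀ i, shiftLoss (D n) (anchored (l := l) u i) ≠ ∞ := fun i =>
      ((measure_mono Set.sdiff_subset).trans_lt (hfin n).lt_top).ne
    have hb : volume (baseSet (l := l) (D n) u) ≠ ∞ :=
      ((measure_mono (baseSet_subset hl _ u)).trans_lt (hfin n).lt_top).ne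
    have h := ENNReal.toReal_mono
      (ENNReal.add_ne_top.2 ⟨hb, ENNReal.sum_ne_top.2 fun i _ => hloss i⟩)
      (volume_sub_baseSet_le (l := l) (D n) u)
    rw [ENNReal.toReal_add hb (ENNReal.sum_ne_top.2 fun i _ => hloss i),
      ENNReal.toReal_sum fun i _ => hloss i] at h
    rw [inv_mul_eq_div, ← Finset.sum_div, le_div_iff₀ hn, sub_mul, div_mul_cancel₀ _ hn.ne']
    linarith

/-! ### Sums over tuples of distinct points and their moments -/

open Classical in
/-- The `l`-tuples of pairwise distinct members of `T`. -/
def tuples {d : ℕ} (l : ℕ) (T : Finset (Sp d)) : Finset (Fin l → Sp d) :=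
  (Fintype.piFinset fun _ => T).filter Function.Injective

lemma mem_tuples {d l : ℕ} {T : Finset (Sp d)} {x : Fin l → Sp d} :
    x ∈ tuples l T ↔ (∀ i, x i ∈ T) ∧ Function.Injective x := by
  simp [tuples]

lemma factorialMeasure_restrict {d l : ℕ} {S D : Set (Sp d)} (hfin : (S ∩ D).Finite)
    (hD : MeasurableSet D) :
    (factorialMeasure l S).restrict (Set.univ.pi fun _ => D) =
      ∑ x ∈ tuples l hfin.toFinset, Measure.dirac x := by
  classical
  ext A hA
  have hS : MeasurableSet (Set.univ.pi fun _ : Fin l => D) := MeasurableSet.univ_pi fun _ => hD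
  rw [Measure.restrict_apply hA, factorialMeasure, Measure.sum_apply _ (hA.inter hS),
    Measure.finsetSum_apply]
  refine (tsum_subtype {x : Fin l → Sp d | Function.Injective x ∧ ∀ i, x i ∈ S}
    (fun x => Measure.dirac x (A ∩ Set.univ.pi fun _ => D))).trans ?_
  rw [tsum_eq_sum (s := tuples l hfin.toFinset)]
  · refine Finset.sum_congr rfl fun x hx => ?_
    rw [mem_tuples] at hx
    simp only [Set.Finite.mem_toFinset, Set.mem_inter_iff] at hx
    rw [Set.indicator_of_mem (by exact ⟨hx.2, fun i => (hx.1 i).1⟩),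
      Measure.dirac_apply' _ (hA.inter hS), Measure.dirac_apply' _ hA]
    by_cases hxA : x ∈ A
    · rw [Set.indicator_of_mem hxA, Set.indicator_of_mem]
      exact ⟨hxA, fun i _ => (hx.1 i).2⟩
    · rw [Set.indicator_of_notMem hxA, Set.indicator_of_notMem fun h => hxA h.1]
  · intro x hx
    rw [Set.indicator_apply_eq_zero]
    rintro ⟨h1, h2⟩
    rw [Measure.dirac_apply' _ (hA.inter hS), Set.indicator_of_notMem]
    rintro ⟨-, h3⟩
    refine hx (mem_tuples.2 ⟨fun i => ?_, h1⟩)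
    simp only [Set.Finite.mem_toFinset, Set.mem_inter_iff]
    exact ⟨h2 i, h3 i trivial⟩

lemma integral_sum_dirac {α : Type*} [MeasurableSpace α] [MeasurableSingletonClass α]
    (T : Finset α) (F : α → ℝ) : ∫ x, F x ∂(∑ x ∈ T, Measure.dirac x) = ∑ x ∈ T, F x := by
  rw [integral_finsetSum_measure fun i _ => integrable_dirac (by simp)]
  simp

lemma setIntegral_factorialMeasure {d l : ℕ} {S D : Set (Sp d)} (hfin : (S ∩ D).Finite)
    (hD : MeasurableSet D) (F : (Fin l → Sp d) → ℝ) :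
    ∫ x in Set.univ.pi (fun _ => D), F x ∂(factorialMeasure l S) =
      ∑ x ∈ tuples l hfin.toFinset, F x := by
  rw [factorialMeasure_restrict hfin hD, integral_sum_dirac]

lemma countMeasure_restrict {d : ℕ} {S D : Set (Sp d)} (hfin : (S ∩ D).Finite)
    (hD : MeasurableSet D) :
    (countMeasure S).restrict D = ∑ x ∈ hfin.toFinset, Measure.dirac x := by
  classical
  ext A hA
  rw [Measure.restrict_apply hA, countMeasure, Measure.sum_apply _ (hA.inter hD),
    Measure.finsetSum_apply]
  rw [tsum_subtype S (fun x => Measure.dirac x (A ∩ D)), tsum_eq_sum (s := hfin.toFinset)]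
  · refine Finset.sum_congr rfl fun x hx => ?_
    simp only [Set.Finite.mem_toFinset, Set.mem_inter_iff] at hx
    rw [Set.indicator_of_mem hx.1, Measure.dirac_apply' _ (hA.inter hD),
      Measure.dirac_apply' _ hA]
    by_cases hxA : x ∈ A
    · rw [Set.indicator_of_mem hxA, Set.indicator_of_mem]
      exact ⟨hxA, hx.2⟩
    · rw [Set.indicator_of_notMem hxA, Set.indicator_of_notMem fun h => hxA h.1]
  · intro x hx
    rw [Set.indicator_apply_eq_zero]
    intro h1
    rw [Measure.dirac_apply' _ (hA.inter hD), Set.indicator_of_notMem]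
    rintro ⟨-, h3⟩
    exact hx (by simpa using ⟨h1, h3⟩)

lemma measurableSet_injective {d l : ℕ} :
    MeasurableSet {x : Fin l → Sp d | Function.Injective x} := by
  have : {x : Fin l → Sp d | Function.Injective x} =
      ⋂ i, ⋂ j, {x | x i = x j → i = j} := by
    ext x
    simp [Function.Injective]
  rw [this]
  refine MeasurableSet.iInter fun i => MeasurableSet.iInter fun j => ?_
  by_cases h : i = j
  · simp [h]
  · simp only [h, imp_false]
    exact (measurableSet_eq_fun (measurable_pi_apply i) (measurable_pi_apply j)).compl

lemma pi_sum_dirac {d l : ℕ} (T : Finset (Sp d)) :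
    Measure.pi (fun _ : Fin l => ∑ x ∈ T, Measure.dirac x) =
      ∑ x ∈ Fintype.piFinset (fun _ : Fin l => T), Measure.dirac x := by
  classical
  refine Measure.pi_eq fun A hA => ?_
  simp only [Measure.finsetSum_apply]
  rw [Finset.prod_univ_sum]
  refine Finset.sum_congr rfl fun x _ => ?_
  rw [Measure.dirac_apply' _ (MeasurableSet.univ_pi hA)]
  by_cases h : x ∈ Set.univ.pi A
  · rw [Set.indicator_of_mem h]
    symm
    refine Finset.prod_eq_one fun i _ => ?_
    rw [Measure.dirac_apply' _ (hA i), Set.indicator_of_mem (h i trivial)]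
    rfl
  · rw [Set.indicator_of_notMem h]
    simp only [Set.mem_pi, Set.mem_univ, true_implies, not_forall] at h
    obtain ⟨i, hi⟩ := h
    symm
    refine Finset.prod_eq_zero (Finset.mem_univ i) ?_
    rw [Measure.dirac_apply' _ (hA i), Set.indicator_of_notMem hi]

/-- The factorial measure is the product power of the counting measure with the diagonals removed.
In this form its measurability reduces to that of counts. -/
lemma pi_sum_dirac_restrict {d l : ℕ} (T : Finset (Sp d)) :
    (Measure.pi (fun _ : Fin l => ∑ x ∈ T, Measure.dirac x)).restrict
      {x | Function.Injective x} = ∑ x ∈ tuples l T, Measure.dirac x := by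
  classical
  rw [pi_sum_dirac]
  ext A hA
  rw [Measure.restrict_apply hA, Measure.finsetSum_apply, Measure.finsetSum_apply, tuples,
    Finset.sum_filter]
  refine Finset.sum_congr rfl fun x _ => ?_
  rw [Measure.dirac_apply' _ (hA.inter measurableSet_injective)]
  split_ifs with h
  · rw [Measure.dirac_apply' _ hA]
    by_cases hxA : x ∈ A
    · rw [Set.indicator_of_mem hxA, Set.indicator_of_mem]
      exact ⟨hxA, h⟩
    · rw [Set.indicator_of_notMem hxA, Set.indicator_of_notMem fun h => hxA h.1]
  · rw [Set.indicator_of_notMem fun h' => h h'.2]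

/-! ### Measurability of tuple sums and Campbell's formula -/

section Moments
variable {Ω : Type*} [MeasurableSpace Ω] {d : ℕ} {X : Ω → Set (Sp d)}

/-- The points of `X` in the bounded window `D`. -/
def IsPointProcess.pts (hX : IsPointProcess X) {D : Set (Sp d)} (hDb : Bornology.IsBounded D)
    (ω : Ω) : Finset (Sp d) :=
  (hX.finite_inter ω D hDb).toFinset

/-- Only counts of bounded Borel sets are known to be measurable. On boxes the product measure is a
product of such counts, and boxes form a generating π-system. -/
lemma IsPointProcess.measurable_tuples (hX : IsPointProcess X) {D : Set (Sp d)}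
    (hDb : Bornology.IsBounded D) (hD : MeasurableSet D) (l : ℕ) :
    Measurable fun ω => ∑ x ∈ tuples l (hX.pts hDb ω), Measure.dirac x := by
  classical
  have hpi : Measurable fun ω =>
      Measure.pi (fun _ : Fin l => ∑ x ∈ hX.pts hDb ω, Measure.dirac x) := by
    have hν : ∀ A : Set (Sp d), MeasurableSet A →
        Measurable fun ω => (∑ x ∈ hX.pts hDb ω, Measure.dirac x) A := by
      intro A hA
      have h := hX.measurable_count (D ∩ A) (hD.inter hA) (hDb.subset Set.inter_subset_left)
      have heq : ∀ ω, (∑ x ∈ hX.pts hDb ω, Measure.dirac x) A =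
          ((X ω ∩ (D ∩ A)).ncard : ℝ≥0∞) := by
        intro ω
        rw [Measure.finsetSum_apply]
        simp only [Measure.dirac_apply' _ hA, Set.indicator_apply, Pi.one_apply]
        rw [Finset.sum_boole]
        congr 1
        rw [← Set.ncard_coe_finset]
        congr 1
        ext x
        simp only [IsPointProcess.pts, Finset.coe_filter, Set.Finite.mem_toFinset,
          Set.mem_inter_iff, Set.mem_ofPred_eq]
        tauto
      simp only [heq]
      exact (measurable_of_countable (fun n : ℕ => (n : ℝ≥0∞))).comp h
    refine Measurable.measure_of_isPiSystem generateFrom_pi.symm isPiSystem_pi ?_ ?_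
    · rintro _ ⟨A, hA, rfl⟩
      simp only [Measure.pi_pi]
      exact Finset.measurable_prod _ fun i _ => hν _ (hA i trivial)
    · simp only [Measure.pi_univ]
      exact Finset.measurable_prod _ fun i _ => hν _ MeasurableSet.univ
  simp only [← pi_sum_dirac_restrict]
  refine Measure.measurable_of_measurable_coe _ fun A hA => ?_
  simp only [Measure.restrict_apply hA]
  exact (Measure.measurable_coe (hA.inter measurableSet_injective)).comp hpi

variable {P : Measure Ω} {K : Sp d → Sp d → ℝ}

/-- The moment identity is given on boxes only. Both sides are integrals of `F` against measures
that agree on this π-system, and boundedness of the intensity on the bounded window makes them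
finite, hence equal. -/
theorem IsDPP.lintegral_tuples (hX : IsDPP P X K) {D : Set (Sp d)}
    (hDb : Bornology.IsBounded D) (hD : MeasurableSet D) {l : ℕ} (hl : 1 ≤ l)
    (hρm : Measurable fun x : Fin l → Sp d => jointIntensity K x)
    (hρb : ∃ c, ∀ x : Fin l → Sp d, |jointIntensity K x| ≤ c)
    {F : (Fin l → Sp d) → ℝ≥0∞} (hF : Measurable F) :
    ∫⁻ ω, ∑ x ∈ tuples l (hX.isPointProcess.pts hDb ω), F x ∂P =
      ∫⁻ x in Set.univ.pi (fun _ => D), ENNReal.ofReal (jointIntensity K x) * F x := by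
  have hm := hX.isPointProcess.measurable_tuples hDb hD l
  have hDl : Bornology.IsBounded (Set.univ.pi fun _ : Fin l => D) :=
    Bornology.IsBounded.pi fun _ => hDb
  obtain ⟨c, hc⟩ := hρb
  set μ₂ : Measure (Fin l → Sp d) := (volume.restrict (Set.univ.pi fun _ => D)).withDensity
    (fun x => ENNReal.ofReal (jointIntensity K x)) with hμ₂
  have hfin : IsFiniteMeasure μ₂ := by
    refine isFiniteMeasure_withDensity_ofReal ?_
    have : IsFiniteMeasure (volume.restrict (Set.univ.pi fun _ : Fin l => D)) :=
      ⟨by simpa using hDl.measure_lt_top⟩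
    exact (Integrable.of_bound hρm.aestronglyMeasurable c
      (Eventually.of_forall fun x => hc x)).2
  set μ₁ : Measure (Fin l → Sp d) := Measure.bind P fun ω =>
    ∑ x ∈ tuples l (hX.isPointProcess.pts hDb ω), Measure.dirac x with hμ₁
  have hbox : ∀ A : Fin l → Set (Sp d), (∀ i, MeasurableSet (A i)) →
      μ₂ (Set.univ.pi A) = μ₁ (Set.univ.pi A) := by
    intro A hA
    have hAm : MeasurableSet (Set.univ.pi A) := MeasurableSet.univ_pi hA
    rw [hμ₁, Measure.bind_apply hAm hm.aemeasurable, hμ₂, withDensity_apply _ hAm,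
      Measure.restrict_restrict hAm, ← Set.pi_inter_distrib,
      ← hX.factorialMoment l hl _ (fun i => (hA i).inter hD)
        (fun i => hDb.subset Set.inter_subset_right)]
    refine lintegral_congr fun ω => ?_
    rw [IsPointProcess.pts, ← factorialMeasure_restrict _ hD, Measure.restrict_apply hAm,
      ← Set.pi_inter_distrib]
  have heq : μ₂ = μ₁ := by
    refine ext_of_generate_finite _ generateFrom_pi.symm isPiSystem_pi ?_ ?_
    · rintro _ ⟨A, hA, rfl⟩
      exact hbox A fun i => hA i trivial
    · simpa using hbox (fun _ => Set.univ) fun _ => MeasurableSet.univ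
  have h1 : ∫⁻ x, F x ∂μ₁ = ∫⁻ ω, ∑ x ∈ tuples l (hX.isPointProcess.pts hDb ω), F x ∂P := by
    rw [hμ₁, Measure.lintegral_bind hm.aemeasurable hF.aemeasurable]
    refine lintegral_congr fun ω => ?_
    rw [lintegral_finsetSum_measure]
    simp
  rw [← h1, ← heq, hμ₂, lintegral_withDensity_eq_lintegral_mul _ hρm.ennreal_ofReal hF]
  rfl

lemma IsPointProcess.measurable_sum_tuples (hX : IsPointProcess X) {D : Set (Sp d)}
    (hDb : Bornology.IsBounded D) (hD : MeasurableSet D) {l : ℕ} {F : (Fin l → Sp d) → ℝ≥0∞}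
    (hF : Measurable F) : Measurable fun ω => ∑ x ∈ tuples l (hX.pts hDb ω), F x := by
  have h := (Measure.measurable_lintegral hF).comp (hX.measurable_tuples hDb hD l)
  convert h using 1
  funext ω
  simp [lintegral_finsetSum_measure]

/-- Campbell's formula for tuples of distinct points in a bounded window. -/
theorem IsDPP.integral_tuples (hX : IsDPP P X K) {D : Set (Sp d)}
    (hDb : Bornology.IsBounded D) (hD : MeasurableSet D) {l : ℕ} (hl : 1 ≤ l)
    (hρm : Measurable fun x : Fin l → Sp d => jointIntensity K x)
    (hρb : ∃ c, ∀ x : Fin l → Sp d, |jointIntensity K x| ≤ c)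
    {F : (Fin l → Sp d) → ℝ} (hF : Measurable F)
    (hint : IntegrableOn (fun x => F x * jointIntensity K x) (Set.univ.pi fun _ => D)) :
    Integrable (fun ω => ∑ x ∈ tuples l (hX.isPointProcess.pts hDb ω), F x) P ∧
    ∫ ω, ∑ x ∈ tuples l (hX.isPointProcess.pts hDb ω), F x ∂P =
      ∫ x in Set.univ.pi (fun _ => D), F x * jointIntensity K x := by
  -- Nonnegative statistics follow directly from the `lintegral` formula; the signed case splits `F`
  -- into positive and negative parts.
  have key : ∀ G : (Fin l → Sp d) → ℝ, Measurable G →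
      IntegrableOn (fun x => G x * jointIntensity K x) (Set.univ.pi fun _ => D) →
      (∀ x, 0 ≤ G x) →
      Integrable (fun ω => ∑ x ∈ tuples l (hX.isPointProcess.pts hDb ω), G x) P ∧
      ∫ ω, ∑ x ∈ tuples l (hX.isPointProcess.pts hDb ω), G x ∂P =
        ∫ x in Set.univ.pi (fun _ => D), G x * jointIntensity K x := by
    intro G hG hGi hG0
    have h1 := hX.lintegral_tuples hDb hD hl hρm hρb hG.ennreal_ofReal
    have h2 : ∀ ω, ∑ x ∈ tuples l (hX.isPointProcess.pts hDb ω), G x =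
        (∑ x ∈ tuples l (hX.isPointProcess.pts hDb ω), ENNReal.ofReal (G x)).toReal := by
      intro ω
      rw [← ENNReal.ofReal_sum_of_nonneg fun x _ => hG0 x, ENNReal.toReal_ofReal]
      exact Finset.sum_nonneg fun x _ => hG0 x
    have hnn : 0 ≤ᵐ[volume.restrict (Set.univ.pi fun _ => D)]
        fun x => G x * jointIntensity K x := by
      filter_upwards [ae_restrict_of_ae (hX.intensity_nonneg l hl)] with x hx
      exact mul_nonneg (hG0 x) hx
    have h3 : ∫⁻ x in Set.univ.pi (fun _ => D),
        ENNReal.ofReal (jointIntensity K x) * ENNReal.ofReal (G x) =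
        ENNReal.ofReal (∫ x in Set.univ.pi (fun _ => D), G x * jointIntensity K x) := by
      rw [ofReal_integral_eq_lintegral_ofReal hGi hnn]
      refine lintegral_congr fun x => ?_
      rw [ENNReal.ofReal_mul (hG0 x), mul_comm]
    have hmeas := hX.isPointProcess.measurable_sum_tuples hDb hD hG.ennreal_ofReal
    have hne : ∫⁻ ω, ∑ x ∈ tuples l (hX.isPointProcess.pts hDb ω), ENNReal.ofReal (G x) ∂P ≠ ∞ := by
      rw [h1, h3]
      exact ENNReal.ofReal_ne_top
    simp only [h2]
    refine ⟨integrable_toReal_of_lintegral_ne_top hmeas.aemeasurable hne, ?_⟩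
    rw [integral_toReal hmeas.aemeasurable (ae_lt_top hmeas hne), h1, h3, ENNReal.toReal_ofReal]
    exact integral_nonneg_of_ae hnn
  have hparts : ∀ x, F x * jointIntensity K x =
      max (F x) 0 * jointIntensity K x - max (-F x) 0 * jointIntensity K x := by
    intro x
    rw [← sub_mul]
    congr 1
    rcases le_total 0 (F x) with h | h
    · rw [max_eq_left h, max_eq_right (by linarith)]; ring
    · rw [max_eq_right h, max_eq_left (by linarith)]; ring
  have hdom : ∀ G : (Fin l → Sp d) → ℝ, Measurable G → (∀ x, |G x| ≤ |F x|) →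
      IntegrableOn (fun x => G x * jointIntensity K x) (Set.univ.pi fun _ => D) := by
    intro G hG h
    refine Integrable.mono hint (hG.mul hρm).aestronglyMeasurable
      (Eventually.of_forall fun x => ?_)
    rw [norm_mul, norm_mul]
    exact mul_le_mul_of_nonneg_right (h x) (norm_nonneg _)
  have hi1 := hdom _ (hF.max measurable_const) (fun x => by
    rcases le_total 0 (F x) with h | h
    · rw [max_eq_left h]
    · rw [max_eq_right h]; simp)
  have hi2 := hdom _ (hF.fun_neg.max measurable_const) (fun x => by
    rcases le_total 0 (-F x) with h | h
    · rw [max_eq_left h, abs_neg]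
    · rw [max_eq_right h]; simp)
  obtain ⟨a1, b1⟩ := key _ (hF.max measurable_const) hi1 fun x => le_max_right _ _
  obtain ⟨a2, b2⟩ := key _ (hF.fun_neg.max measurable_const) hi2 fun x => le_max_right _ _
  have hsum : ∀ T : Finset (Fin l → Sp d), ∑ x ∈ T, F x =
      ∑ x ∈ T, max (F x) 0 - ∑ x ∈ T, max (-F x) 0 := by
    intro T
    rw [← Finset.sum_sub_distrib]
    refine Finset.sum_congr rfl fun x _ => ?_
    rcases le_total 0 (F x) with h | h
    · rw [max_eq_left h, max_eq_right (by linarith)]; ring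
    · rw [max_eq_right h, max_eq_left (by linarith)]; ring
  simp only [hsum, hparts]
  exact ⟨a1.sub a2, by rw [integral_sub a1 a2, b1, b2]; exact (integral_sub hi1 hi2).symm⟩

end Moments

/-! ### Products of sums over tuples of distinct points -/

section Combinatorics
variable {d s t l : ℕ} {T : Finset (Sp d)}

open Classical in
/-- The ways of obtaining two given tuples as subtuples of an `l`-tuple covered by them. -/
def overlapFiber (T : Finset (Sp d)) (l : ℕ) (x : Fin s → Sp d) (y : Fin t → Sp d) :
    Finset (((Fin s ↪ Fin l) × (Fin t ↪ Fin l)) × (Fin l → Sp d)) :=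
  ((Finset.univ.filter fun ab => ab ∈ overlaps s t l) ×ˢ tuples l T).filter
    fun q => q.2 ∘ q.1.1 = x ∧ q.2 ∘ q.1.2 = y

open Classical in
-- Since `a` and `b` cover all indices, the range of `z` is exactly the union of the points of `x`
-- and `y`. Injectivity makes `z` an enumeration of that union, and the enumeration determines `a`
-- and `b`.
lemma card_overlapFiber_eq_card_equiv {x : Fin s → Sp d} {y : Fin t → Sp d}
    (hx : x ∈ tuples s T) (hy : y ∈ tuples t T) :
    (overlapFiber T l x y).card =
      Fintype.card (Fin l ≃ ((Finset.univ.image x ∪ Finset.univ.image y : Finset (Sp d)))) := by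
  rw [mem_tuples] at hx hy
  set U : Finset (Sp d) := Finset.univ.image x ∪ Finset.univ.image y with hU
  have hxU : ∀ i, x i ∈ U := fun i => by simp [hU]
  have hyU : ∀ i, y i ∈ U := fun i => by simp [hU]
  have hUT : ∀ u ∈ U, u ∈ T := by
    intro u hu
    simp only [hU, Finset.mem_union, Finset.mem_image, Finset.mem_univ, true_and] at hu
    rcases hu with ⟨i, rfl⟩ | ⟨i, rfl⟩
    exacts [hx.1 i, hy.1 i]
  have hxi := hx.2
  have hyi := hy.2
  set ex : Fin s ↪ U := ⟨fun i => ⟨x i, hxU i⟩, fun i j h => hxi (congrArg Subtype.val h)⟩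
    with hex
  set ey : Fin t ↪ U := ⟨fun i => ⟨y i, hyU i⟩, fun i j h => hyi (congrArg Subtype.val h)⟩
    with hey
  have hexv : ∀ i, ((ex i : U) : Sp d) = x i := fun i => rfl
  have heyv : ∀ i, ((ey i : U) : Sp d) = y i := fun i => rfl
  rw [← Finset.card_univ]
  symm
  refine Finset.card_bij (fun e _ => ((ex.trans e.symm.toEmbedding, ey.trans e.symm.toEmbedding),
    fun k => (e k : Sp d))) ?_ ?_ ?_
  · intro e _
    simp only [overlapFiber, Finset.mem_filter, Finset.mem_product, Finset.mem_univ, true_and,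
      mem_tuples]
    refine ⟨⟨?_, fun i => hUT _ (e i).2, fun i j h => e.injective (Subtype.ext h)⟩, ?_, ?_⟩
    · intro k
      have hk := (e k).2
      simp only [hU, Finset.mem_union, Finset.mem_image, Finset.mem_univ, true_and] at hk
      rcases hk with ⟨i, hi⟩ | ⟨i, hi⟩
      · left
        refine ⟨i, ?_⟩
        simp only [Function.Embedding.trans_apply, Equiv.coe_toEmbedding]
        rw [Equiv.symm_apply_eq]
        exact Subtype.ext hi
      · right
        refine ⟨i, ?_⟩
        simp only [Function.Embedding.trans_apply, Equiv.coe_toEmbedding]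
        rw [Equiv.symm_apply_eq]
        exact Subtype.ext hi
    · funext i
      simp [hexv]
    · funext i
      simp [heyv]
  · intro e _ e' _ h
    have h2 := congrArg Prod.snd h
    ext k
    exact congrArg (fun z : Sp d => z.ofLp _) (congrFun h2 k)
  · rintro ⟨⟨a, b⟩, z⟩ hq
    simp only [overlapFiber, Finset.mem_filter, Finset.mem_product, Finset.mem_univ, true_and,
      mem_tuples] at hq
    obtain ⟨⟨hov, hzT, hzi⟩, hax, hby⟩ := hq
    have hza : ∀ i, z (a i) = x i := fun i => congrFun hax i
    have hzb : ∀ i, z (b i) = y i := fun i => congrFun hby i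
    have hzU : ∀ k, z k ∈ U := by
      intro k
      rcases hov k with ⟨i, rfl⟩ | ⟨i, rfl⟩
      · simpa [hza] using hxU i
      · simpa [hzb] using hyU i
    have hbij : Function.Bijective (fun k => (⟨z k, hzU k⟩ : U)) := by
      refine ⟨fun i j h => hzi (congrArg Subtype.val h), ?_⟩
      rintro ⟨u, hu⟩
      simp only [hU, Finset.mem_union, Finset.mem_image, Finset.mem_univ, true_and] at hu
      rcases hu with ⟨i, hi⟩ | ⟨i, hi⟩
      · exact ⟨a i, Subtype.ext ((hza i).trans hi)⟩
      · exact ⟨b i, Subtype.ext ((hzb i).trans hi)⟩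
    refine ⟨Equiv.ofBijective _ hbij, Finset.mem_univ _, ?_⟩
    refine Prod.ext (Prod.ext ?_ ?_) rfl
    · ext i : 1
      simp only [Function.Embedding.trans_apply, Equiv.coe_toEmbedding]
      rw [Equiv.symm_apply_eq]
      exact Subtype.ext (hza i).symm
    · ext i : 1
      simp only [Function.Embedding.trans_apply, Equiv.coe_toEmbedding]
      rw [Equiv.symm_apply_eq]
      exact Subtype.ext (hzb i).symm

open Classical in
lemma card_overlapFiber {x : Fin s → Sp d} {y : Fin t → Sp d}
    (hx : x ∈ tuples s T) (hy : y ∈ tuples t T) :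
    (overlapFiber T l x y).card =
      if l = (Finset.univ.image x ∪ Finset.univ.image y).card then l.factorial else 0 := by
  rw [card_overlapFiber_eq_card_equiv hx hy]
  split_ifs with h
  · rw [Fintype.card_equiv (Fintype.equivOfCardEq (by simpa using h)), Fintype.card_fin]
  · rw [Fintype.card_eq_zero_iff]
    exact ⟨fun e => h (by simpa using Fintype.card_congr e)⟩

open Classical in
-- A pair `(x, y)` occurs only for the single `l` that counts its distinct points, and there once
-- for each of the `l!` enumerations of them. This is the origin of the factor `1 / l!`.
theorem sum_tuples_mul_sum_tuples (T : Finset (Sp d)) (f : (Fin s → Sp d) → ℝ)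
    (g : (Fin t → Sp d) → ℝ) :
    (∑ x ∈ tuples s T, f x) * ∑ y ∈ tuples t T, g y =
      ∑ l ∈ Finset.Icc (max s t) (s + t), ((l.factorial : ℝ))⁻¹ *
        ∑ ab ∈ Finset.univ.filter (fun ab => ab ∈ overlaps s t l),
          ∑ z ∈ tuples l T, f (z ∘ ab.1) * g (z ∘ ab.2) := by
  have hinner : ∀ l, ∑ ab ∈ Finset.univ.filter (fun ab => ab ∈ overlaps s t l),
      ∑ z ∈ tuples l T, f (z ∘ ab.1) * g (z ∘ ab.2) =
      ∑ x ∈ tuples s T, ∑ y ∈ tuples t T, ((overlapFiber T l x y).card : ℝ) * (f x * g y) := by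
    intro l
    rw [← Finset.sum_product', ← Finset.sum_product']
    rw [← Finset.sum_fiberwise_of_maps_to (t := tuples s T ×ˢ tuples t T)
      (g := fun q : ((Fin s ↪ Fin l) × (Fin t ↪ Fin l)) × (Fin l → Sp d) =>
        (q.2 ∘ q.1.1, q.2 ∘ q.1.2))]
    · refine Finset.sum_congr rfl fun xy _ => ?_
      rw [overlapFiber, ← nsmul_eq_mul, ← Finset.sum_const]
      refine Finset.sum_congr ?_ ?_
      · ext q
        simp [Prod.ext_iff]
      · intro q hq
        simp only [Finset.mem_filter] at hq
        rw [hq.2.1, hq.2.2]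
    · rintro ⟨⟨a, b⟩, z⟩ hq
      simp only [Finset.mem_product, mem_tuples] at hq ⊢
      exact ⟨⟨fun i => hq.2.1 _, hq.2.2.comp a.injective⟩,
        ⟨fun i => hq.2.1 _, hq.2.2.comp b.injective⟩⟩
  simp only [hinner]
  rw [Finset.sum_mul_sum]
  simp only [Finset.mul_sum]
  symm
  rw [Finset.sum_comm]
  refine Finset.sum_congr rfl fun x hx => ?_
  rw [Finset.sum_comm]
  refine Finset.sum_congr rfl fun y hy => ?_
  simp only [card_overlapFiber hx hy]
  set m := (Finset.univ.image x ∪ Finset.univ.image y).card with hm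
  have hx' := (mem_tuples.1 hx).2
  have hy' := (mem_tuples.1 hy).2
  have hmem : m ∈ Finset.Icc (max s t) (s + t) := by
    have h1 : (Finset.univ.image x).card = s := by
      rw [Finset.card_image_of_injective _ hx', Finset.card_univ, Fintype.card_fin]
    have h2 : (Finset.univ.image y).card = t := by
      rw [Finset.card_image_of_injective _ hy', Finset.card_univ, Fintype.card_fin]
    rw [Finset.mem_Icc, max_le_iff]
    refine ⟨⟨?_, ?_⟩, ?_⟩
    · exact h1.symm.le.trans (Finset.card_le_card Finset.subset_union_left)
    · exact h2.symm.le.trans (Finset.card_le_card Finset.subset_union_right)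
    · exact (Finset.card_union_le _ _).trans (by rw [h1, h2])
  rw [Finset.sum_eq_single m]
  · simp only [if_true]
    rw [inv_mul_cancel_left₀]
    exact_mod_cast m.factorial_ne_zero
  · intro l _ hlm
    simp [hlm]
  · exact fun h => absurd hmem h

end Combinatorics

/-! ### Plancherel's identity -/

open scoped ContDiff SchwartzMap in
/-- Plancherel's theorem for the Fourier integral of a function in `L¹ ∩ L²`. -/
lemma lintegral_fourier_enorm_sq {d : ℕ} {h : Sp d → ℂ} (h1 : Integrable h) (h2 : MemLp h 2) :
    ∫⁻ y, ‖𝓕 h y‖ₑ ^ 2 = ∫⁻ x, ‖h x‖ₑ ^ 2 := by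
  set f : Lp ℂ 2 (volume : Measure (Sp d)) := h2.toLp h with hf
  have hfae : f =ᵐ[volume] h := h2.coeFn_toLp
  have hcont : Continuous (𝓕 h) :=
    VectorFourier.fourierIntegral_continuous Real.continuous_fourierChar
      (by exact continuous_inner) h1
  -- The pointwise transform of `h` and its `L²` transform are identified as distributions: the
  -- latter is defined by duality, and the former satisfies the same duality by Fubini.
  have hae : ∀ᵐ y, 𝓕 h y = (𝓕 f : Lp ℂ 2 (volume : Measure (Sp d))) y := by
    refine ae_eq_of_integral_contDiff_smul_eq hcont.locallyIntegrable
      ((Lp.memLp (𝓕 f)).locallyIntegrable (by norm_num)) fun ψ hψ hψc => ?_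
    have hψ' : ContDiff ℝ ∞ (fun x => (ψ x : ℂ)) := Complex.ofRealCLM.contDiff.comp hψ
    have hψc' : HasCompactSupport (fun x => (ψ x : ℂ)) :=
      hψc.comp_left (g := fun r : ℝ => (r : ℂ)) (by simp)
    set Ψ : 𝓢(Sp d, ℂ) := hψc'.toSchwartzMap hψ' with hΨ
    have hΨv : ∀ x, Ψ x = (ψ x : ℂ) := fun x => rfl
    have e1 := congrArg (fun T => T Ψ) (Lp.fourier_toTemperedDistribution_eq f)
    simp only [TemperedDistribution.fourier_apply, Lp.toTemperedDistribution_apply] at e1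
    have e2 : ∫ x, (𝓕 Ψ) x • f x = ∫ x, (𝓕 Ψ) x • h x := by
      refine integral_congr_ae ?_
      filter_upwards [hfae] with x hx
      rw [hx]
    have e3 : ∫ x, (𝓕 (Ψ : Sp d → ℂ)) x • h x = ∫ x, Ψ x • 𝓕 h x := by
      have := VectorFourier.integral_fourierIntegral_smul_eq_flip (L := innerₗ (Sp d))
        (μ := volume) (ν := volume) Real.continuous_fourierChar (by exact continuous_inner)
        Ψ.integrable h1
      rw [flip_innerₗ] at this
      exact this
    rw [e2, SchwartzMap.fourier_coe, e3] at e1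
    simpa [hΨv] using e1
  have hL : eLpNorm (𝓕 f : Lp ℂ 2 (volume : Measure (Sp d))) 2 volume = eLpNorm f 2 volume := by
    have := Lp.norm_fourier_eq f
    rw [Lp.norm_def, Lp.norm_def, ENNReal.toReal_eq_toReal_iff' (Lp.eLpNorm_ne_top _)
      (Lp.eLpNorm_ne_top _)] at this
    exact this
  rw [eLpNorm_congr_ae hfae, ← eLpNorm_congr_ae hae] at hL
  have hsq := congrArg (fun r : ℝ≥0∞ => r ^ (2 : ℝ)) hL
  simp only [eLpNorm_eq_lintegral_rpow_enorm_toReal two_ne_zero ENNReal.ofNat_ne_top,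
    ENNReal.toReal_ofNat, ← ENNReal.rpow_mul] at hsq
  norm_num at hsq
  exact hsq

/-! ### Kernels of stationary determinantal processes -/

/-- The Gram matrix of a kernel at a finite family of points. -/
def gram {d : ℕ} {ι : Type*} (K : Sp d → Sp d → ℝ) (x : ι → Sp d) : Matrix ι ι ℝ :=
  Matrix.of fun i j => K (x i) (x j)

/-- A continuous stationary kernel with `0 ≤ K ≤ 1` as an operator on `L²`, positive definite at
distinct points. -/
structure IsContractionKernel {d : ℕ} (K : Sp d → Sp d → ℝ) : Prop where
  continuous : Continuous fun z : Sp d × Sp d => K z.1 z.2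
  add_right : ∀ c x y, K (x + c) (y + c) = K x y
  posSemidef : ∀ {ι : Type} [Fintype ι] (x : ι → Sp d), (gram K x).PosSemidef
  posDef : ∀ {l : ℕ} (x : Fin l → Sp d), Function.Injective x → (gram K x).PosDef
  contraction : ∀ {ι : Type} [Fintype ι] (x : ι → Sp d) (v : ι → ℝ),
    ∫⁻ y, ENNReal.ofReal ((∑ i, v i * K (x i) y) ^ 2) ≤
      ENNReal.ofReal (∑ i, ∑ j, v i * v j * K (x i) (x j))

/-! ### Consequences of the spectral representation -/

section Spectral
variable {d : ℕ} {c φ : Sp d → ℝ}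

/-- The trigonometric sum `∑ v_i exp(2πi⟨ξ, x_i⟩)`. -/
def trigSum {ι : Type} [Fintype ι] (x : ι → Sp d) (v : ι → ℝ) (ξ : Sp d) : ℂ :=
  ∑ i, (v i : ℂ) * (Real.fourierChar (inner ℝ ξ (x i)) : ℂ)

lemma continuous_trigSum {ι : Type} [Fintype ι] (x : ι → Sp d) (v : ι → ℝ) :
    Continuous (trigSum x v) := by
  unfold trigSum
  refine continuous_finsetSum _ fun i _ => continuous_const.mul ?_
  exact continuous_subtype_val.comp (Real.continuous_fourierChar.comp (by fun_prop))

lemma norm_trigSum_le {ι : Type} [Fintype ι] (x : ι → Sp d) (v : ι → ℝ) (ξ : Sp d) :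
    ‖trigSum x v ξ‖ ≤ ∑ i, |v i| := by
  refine (norm_sum_le _ _).trans (Finset.sum_le_sum fun i _ => ?_)
  rw [norm_mul, Circle.norm_coe, mul_one, Complex.norm_real, Real.norm_eq_abs]

lemma IsSpectralDensity.continuous (h : IsSpectralDensity c φ) : Continuous c := by
  have h1 : Continuous (𝓕⁻ fun ξ => (φ ξ : ℂ)) := by
    rw [show (𝓕⁻ fun ξ => (φ ξ : ℂ)) = fun x => 𝓕 (fun ξ => (φ ξ : ℂ)) (-x) from
      funext fun x => Real.fourierInv_eq_fourier_neg _ x]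
    have : Continuous (𝓕 fun ξ => (φ ξ : ℂ)) :=
      VectorFourier.fourierIntegral_continuous Real.continuous_fourierChar
        (by exact continuous_inner) h.2.1.ofReal
    exact this.comp continuous_neg
  have h2 : c = fun x => (𝓕⁻ (fun ξ => (φ ξ : ℂ)) x).re := by
    funext x
    rw [← h.2.2 x, Complex.ofReal_re]
  rw [h2]
  exact Complex.continuous_re.comp h1

lemma IsSpectralDensity.integrable_mul_normSq (h : IsSpectralDensity c φ) {ι : Type} [Fintype ι]
    (x : ι → Sp d) (v : ι → ℝ) : Integrable fun ξ => φ ξ * ‖trigSum x v ξ‖ ^ 2 := by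
  refine h.2.1.mul_bdd ((continuous_trigSum x v).norm.pow 2).aestronglyMeasurable
    (c := (∑ i, |v i|) ^ 2) (Eventually.of_forall fun ξ => ?_)
  rw [norm_pow, norm_norm]
  exact pow_le_pow_left₀ (norm_nonneg _) (norm_trigSum_le x v ξ) 2

/-- This is the easy half of Bochner's theorem: the phases `exp(2πi⟨ξ, x_i - x_j⟩)` factor, and the
double sum becomes a squared modulus. -/
lemma IsSpectralDensity.sum_sum_eq (h : IsSpectralDensity c φ) {ι : Type} [Fintype ι]
    (x : ι → Sp d) (v : ι → ℝ) :
    ∑ i, ∑ j, v i * v j * c (x i - x j) = ∫ ξ, φ ξ * ‖trigSum x v ξ‖ ^ 2 := by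
  have hint : ∀ y : Sp d, Integrable fun ξ => Real.fourierChar (inner ℝ ξ y) • (φ ξ : ℂ) := by
    intro y
    have := (Real.fourierIntegral_convergent_iff (f := fun ξ => (φ ξ : ℂ)) (μ := volume) (-y)).2
      h.2.1.ofReal
    simpa using this
  apply Complex.ofReal_injective
  push_cast
  simp only [h.2.2, Real.fourierInv_eq]
  rw [← integral_complex_ofReal]
  simp only [← integral_const_mul]
  rw [Finset.sum_congr rfl fun i _ => (integral_finsetSum _ fun j _ =>
    (hint (x i - x j)).const_mul _).symm, ← integral_finsetSum _ fun i _ =>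
      integrable_finsetSum _ fun j _ => (hint (x i - x j)).const_mul _]
  refine integral_congr_ae (Eventually.of_forall fun ξ => ?_)
  simp only
  have hsq : ((‖trigSum x v ξ‖ ^ 2 : ℝ) : ℂ) =
      trigSum x v ξ * (starRingEnd ℂ) (trigSum x v ξ) := by
    rw [Complex.mul_conj, Complex.normSq_eq_norm_sq]
  push_cast at hsq ⊢
  rw [hsq, trigSum, map_sum, Finset.sum_mul_sum, Finset.mul_sum]
  refine Finset.sum_congr rfl fun i _ => ?_
  rw [Finset.mul_sum]
  refine Finset.sum_congr rfl fun j _ => ?_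
  rw [inner_sub_right, sub_eq_add_neg, AddChar.map_add_eq_mul, Circle.smul_def, smul_eq_mul,
    Circle.coe_mul, AddChar.map_neg_eq_inv, Circle.coe_inv_eq_conj, map_mul, Complex.conj_ofReal]
  ring

/-- This is the operator inequality `K² ≤ K` tested on point masses. The sum is the Fourier
transform of `lam φ` times a trigonometric sum, so Plancherel gives the weight `(lam φ)²`, and `0 ≤
lam φ ≤ 1` bounds it by `lam φ`. -/
lemma IsSpectralDensity.contraction (h : IsSpectralDensity c φ) {lam : ℝ} (hlam : 0 < lam)
    (hφ : ∀ ξ, φ ξ ≤ 1 / lam) {ι : Type} [Fintype ι] (x : ι → Sp d) (v : ι → ℝ) :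
    ∫⁻ y, ENNReal.ofReal ((∑ i, v i * (lam * c (x i - y))) ^ 2) ≤
      ENNReal.ofReal (∑ i, ∑ j, v i * v j * (lam * c (x i - x j))) := by
  have hlφ : ∀ ξ, lam * φ ξ ≤ 1 := fun ξ => by
    have := mul_le_mul_of_nonneg_left (hφ ξ) hlam.le
    rwa [mul_one_div_cancel hlam.ne'] at this
  set g : Sp d → ℂ := fun ξ => ((lam * φ ξ : ℝ) : ℂ) * trigSum x v ξ with hg
  have hg1 : Integrable g :=
    (h.2.1.const_mul lam).ofReal.mul_bdd (continuous_trigSum x v).aestronglyMeasurable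
      (c := ∑ i, |v i|) (Eventually.of_forall fun ξ => norm_trigSum_le x v ξ)
  have hnorm : ∀ ξ, ‖g ξ‖ ^ 2 ≤ lam * (φ ξ * ‖trigSum x v ξ‖ ^ 2) := by
    intro ξ
    have h0 : 0 ≤ lam * φ ξ := mul_nonneg hlam.le (h.1 ξ)
    rw [hg, norm_mul, Complex.norm_real, Real.norm_of_nonneg h0, mul_pow, ← mul_assoc]
    refine mul_le_mul_of_nonneg_right ?_ (by positivity)
    rw [sq]
    exact mul_le_of_le_one_left h0 (hlφ ξ)
  have hint := (h.integrable_mul_normSq x v).const_mul lam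
  have hg2 : MemLp g 2 := by
    rw [memLp_two_iff_integrable_sq_norm hg1.1]
    refine hint.mono' (hg1.1.norm.pow 2) (Eventually.of_forall fun ξ => ?_)
    rw [Real.norm_of_nonneg (by positivity)]
    exact hnorm ξ
  have hfour : ∀ y, ((∑ i, v i * (lam * c (x i - y)) : ℝ) : ℂ) = 𝓕 g y := by
    intro y
    have hi : ∀ z : Sp d, Integrable fun ξ => Real.fourierChar (inner ℝ ξ z) • (φ ξ : ℂ) := by
      intro z
      have := (Real.fourierIntegral_convergent_iff (f := fun ξ => (φ ξ : ℂ)) (μ := volume) (-z)).2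
        h.2.1.ofReal
      simpa using this
    push_cast
    simp only [h.2.2, Real.fourierInv_eq, Real.fourier_eq]
    simp only [← integral_const_mul]
    rw [← integral_finsetSum _ fun i _ => ((hi (x i - y)).const_mul _).const_mul _]
    refine integral_congr_ae (Eventually.of_forall fun ξ => ?_)
    simp only [hg, trigSum]
    rw [Finset.mul_sum, Circle.smul_def, smul_eq_mul, Finset.mul_sum]
    refine Finset.sum_congr rfl fun i _ => ?_
    rw [inner_sub_right, sub_eq_add_neg, AddChar.map_add_eq_mul, Circle.smul_def, smul_eq_mul,
      Circle.coe_mul]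
    push_cast
    ring
  calc ∫⁻ y, ENNReal.ofReal ((∑ i, v i * (lam * c (x i - y))) ^ 2)
      = ∫⁻ y, ‖𝓕 g y‖ₑ ^ 2 := by
        refine lintegral_congr fun y => ?_
        rw [← hfour y, ← ofReal_norm, ← ENNReal.ofReal_pow (norm_nonneg _),
          Complex.norm_real, Real.norm_eq_abs, sq_abs]
    _ = ∫⁻ ξ, ‖g ξ‖ₑ ^ 2 := lintegral_fourier_enorm_sq hg1 hg2
    _ ≤ ∫⁻ ξ, ENNReal.ofReal (lam * (φ ξ * ‖trigSum x v ξ‖ ^ 2)) := by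
        refine lintegral_mono fun ξ => ?_
        rw [← ofReal_norm, ← ENNReal.ofReal_pow (norm_nonneg _)]
        exact ENNReal.ofReal_le_ofReal (hnorm ξ)
    _ = ENNReal.ofReal (∫ ξ, lam * (φ ξ * ‖trigSum x v ξ‖ ^ 2)) := by
        rw [ofReal_integral_eq_lintegral_ofReal hint (Eventually.of_forall fun ξ =>
          mul_nonneg hlam.le (mul_nonneg (h.1 ξ) (by positivity)))]
    _ = _ := by
        rw [integral_const_mul, ← h.sum_sum_eq, Finset.mul_sum]
        simp only [Finset.mul_sum]
        congr 1
        refine Finset.sum_congr rfl fun i _ => Finset.sum_congr rfl fun j _ => ?_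
        ring

end Spectral

lemma isContractionKernel_stationaryKernel {d q : ℕ} {C : EuclideanSpace ℝ (Fin q) → Sp d → ℝ}
    {Θl : Set ℝ} {Θa : Set (EuclideanSpace ℝ (Fin q))}
    (hexist : ExistenceAssumption C Θl Θa) (hreg : RegularityAssumption C Θl Θa)
    {θ : Param q} (hθ : θ ∈ Θl ×ˢ Θa) : IsContractionKernel (stationaryKernel C θ) := by
  obtain ⟨φ, hφ, hφ1⟩ := hexist.spectral θ.1 hθ.1 θ.2 hθ.2
  have hlam := hexist.lam_pos θ.1 hθ.1
  -- Evenness of `C` is not assumed explicitly; it is read off the Hermitian part of positive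
  -- definiteness at two distinct points.
  have hsymm : ∀ x y, stationaryKernel C θ x y = stationaryKernel C θ y x := by
    intro x y
    rcases eq_or_ne x y with rfl | hxy
    · rfl
    · have h := (hreg.posDef θ hθ 2 ![x, y] (by
        intro i j hij
        fin_cases i <;> fin_cases j <;> simp_all)).1
      simpa [kernelMatrix] using (h.apply 1 0)
  refine ⟨?_, ?_, ?_, ?_, ?_⟩
  · unfold stationaryKernel
    exact continuous_const.mul (hφ.continuous.comp (continuous_fst.sub continuous_snd))
  · intro c x y
    simp [stationaryKernel]
  -- Points may coincide here, so positivity has to come from the spectral density instead of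
  -- `posDef`.
  · intro ι _ x
    refine Matrix.PosSemidef.of_dotProduct_mulVec_nonneg ?_ fun v => ?_
    · ext i j
      simpa [gram] using hsymm (x j) (x i)
    · have h1 := hφ.sum_sum_eq x v
      have h2 : star v ⬝ᵥ (gram (stationaryKernel C θ) x).mulVec v =
          θ.1 * ∑ i, ∑ j, v i * v j * C θ.2 (x i - x j) := by
        simp only [dotProduct, Matrix.mulVec, gram, Matrix.of_apply, stationaryKernel,
          Finset.mul_sum, Pi.star_apply, star_trivial]
        refine Finset.sum_congr rfl fun i _ => Finset.sum_congr rfl fun j _ => ?_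
        ring
      rw [h2, h1]
      exact mul_nonneg hlam.le (integral_nonneg fun ξ => mul_nonneg (hφ.1 ξ) (by positivity))
  · intro l x hx
    exact hreg.posDef θ hθ l x hx
  · intro ι _ x v
    exact hφ.contraction hlam hφ1 x v

/-! ### Determinant estimates -/

lemma abs_prod_sub_prod_le {ι : Type*} (s : Finset ι) (a b : ι → ℝ) {M δ : ℝ} (hM : 1 ≤ M)
    (hδ : 0 ≤ δ) (ha : ∀ i, |a i| ≤ M) (hb : ∀ i, |b i| ≤ M) (hab : ∀ i, |a i - b i| ≤ δ) :
    |∏ i ∈ s, a i - ∏ i ∈ s, b i| ≤ s.card * M ^ s.card * δ := by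
  classical
  induction s using Finset.induction_on with
  | empty => simp
  | insert k s hk ih =>
    rw [Finset.prod_insert hk, Finset.prod_insert hk, Finset.card_insert_of_notMem hk]
    have hM0 : 0 ≤ M := zero_le_one.trans hM
    have h1 : |∏ i ∈ s, a i| ≤ M ^ s.card := by
      rw [Finset.abs_prod]
      calc _ ≤ ∏ _i ∈ s, M := Finset.prod_le_prod (fun i _ => abs_nonneg _) fun i _ => ha i
        _ = _ := by simp
    have h2 : a k * ∏ i ∈ s, a i - b k * ∏ i ∈ s, b i =
        (a k - b k) * ∏ i ∈ s, a i + b k * (∏ i ∈ s, a i - ∏ i ∈ s, b i) := by ring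
    rw [h2]
    calc _ ≤ |a k - b k| * |∏ i ∈ s, a i| + |b k| * |∏ i ∈ s, a i - ∏ i ∈ s, b i| := by
          rw [← abs_mul, ← abs_mul]; exact abs_add_le _ _
      _ ≤ δ * M ^ s.card + M * (s.card * M ^ s.card * δ) := by
          gcongr
          · exact hab k
          · exact hb k
      _ ≤ δ * M ^ (s.card + 1) + M * (s.card * M ^ s.card * δ) := by
          gcongr
          · omega
      _ = _ := by push_cast; ring

lemma abs_det_sub_det_le {ι : Type*} [Fintype ι] [DecidableEq ι] (A B : Matrix ι ι ℝ) {M δ : ℝ}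
    (hM : 1 ≤ M) (hδ : 0 ≤ δ) (hA : ∀ i j, |A i j| ≤ M) (hB : ∀ i j, |B i j| ≤ M)
    (hAB : ∀ i j, |A i j - B i j| ≤ δ) :
    |A.det - B.det| ≤ (Fintype.card ι).factorial *
      (Fintype.card ι * M ^ Fintype.card ι * δ) := by
  rw [Matrix.det_apply', Matrix.det_apply', ← Finset.sum_sub_distrib]
  refine (Finset.abs_sum_le_sum_abs _ _).trans ?_
  calc _ ≤ ∑ _σ : Equiv.Perm ι, (Fintype.card ι * M ^ Fintype.card ι * δ) := by
        refine Finset.sum_le_sum fun σ _ => ?_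
        rw [← mul_sub, abs_mul]
        have h1 : |((Equiv.Perm.sign σ : ℤ) : ℝ)| = 1 := by
          rcases Int.units_eq_one_or (Equiv.Perm.sign σ) with h | h <;> simp [h]
        rw [h1, one_mul]
        exact abs_prod_sub_prod_le _ _ _ hM hδ (fun i => hA _ _) (fun i => hB _ _) fun i => hAB _ _
    _ = _ := by
        rw [Finset.sum_const, Finset.card_univ, Fintype.card_perm, nsmul_eq_mul]

lemma abs_det_le {ι : Type*} [Fintype ι] [DecidableEq ι] (A : Matrix ι ι ℝ) {M : ℝ}
    (hA : ∀ i j, |A i j| ≤ M) :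
    |A.det| ≤ (Fintype.card ι).factorial * M ^ Fintype.card ι := by
  have := Matrix.det_le (abv := AbsoluteValue.abs) (A := A) (x := M) hA
  simpa using this

/-- Test the quadratic form on `e_i + e_j` and `e_i - e_j`. -/
lemma PosSemidef.abs_apply_le {ι : Type*} [Fintype ι] {S : Matrix ι ι ℝ} (hS : S.PosSemidef)
    (i j : ι) : |S i j| ≤ (S i i + S j j) / 2 := by
  classical
  have hsym : S j i = S i j := by simpa using hS.1.apply i j
  have h1 := hS.dotProduct_mulVec_nonneg (Pi.single i 1 + Pi.single j 1)
  have h2 := hS.dotProduct_mulVec_nonneg (Pi.single i 1 - Pi.single j 1)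
  simp only [star_trivial, Matrix.mulVec_add, Matrix.mulVec_sub, add_dotProduct, sub_dotProduct,
    dotProduct_add, dotProduct_sub, Matrix.mulVec_single_one, single_one_dotProduct,
    Matrix.col_apply, hsym] at h1 h2
  rw [abs_le]
  constructor <;> linarith

lemma PosSemidef.abs_apply_le_trace {ι : Type*} [Fintype ι] {S : Matrix ι ι ℝ}
    (hS : S.PosSemidef) (i j : ι) : |S i j| ≤ S.trace := by
  have hle : ∀ k, S k k ≤ S.trace := fun k =>
    Finset.single_le_sum (f := fun k => S k k) (fun k _ => hS.diag_nonneg) (Finset.mem_univ k)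
  linarith [PosSemidef.abs_apply_le hS i j, hle i, hle j]

open scoped MatrixOrder in
lemma PosSemidef.exists_eq_conjTranspose_mul_self {ι : Type*} [Fintype ι] {S : Matrix ι ι ℝ}
    (hS : S.PosSemidef) : ∃ B : Matrix ι ι ℝ, S = B.conjTranspose * B := by
  classical
  exact CStarAlgebra.nonneg_iff_eq_star_mul_self.mp hS.nonneg

namespace IsContractionKernel
variable {d : ℕ} {K : Sp d → Sp d → ℝ}

lemma symm (hK : IsContractionKernel K) (x y : Sp d) : K x y = K y x := by
  simpa [gram] using (hK.posSemidef ![x, y]).1.apply 1 0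

lemma self_eq (hK : IsContractionKernel K) (x : Sp d) : K x x = K 0 0 := by
  simpa using hK.add_right x 0 0

lemma abs_le (hK : IsContractionKernel K) (x y : Sp d) : |K x y| ≤ K 0 0 := by
  have := PosSemidef.abs_apply_le (hK.posSemidef ![x, y]) 0 1
  simpa [gram, hK.self_eq] using this

lemma zero_zero_nonneg (hK : IsContractionKernel K) : 0 ≤ K 0 0 :=
  (abs_nonneg _).trans (hK.abs_le 0 0)

/-- The conditional covariance `Bᵀ A⁻¹ B` of the points `y` given the points `x`. -/
def explained {ι κ : Type*} [Fintype ι] [DecidableEq ι] (K : Sp d → Sp d → ℝ) (x : ι → Sp d)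
    (y : κ → Sp d) : Matrix κ κ ℝ :=
  (Matrix.of fun i j => K (x i) (y j) : Matrix ι κ ℝ).conjTranspose * (gram K x)⁻¹ *
    (Matrix.of fun i j => K (x i) (y j) : Matrix ι κ ℝ)

/-! ### Schur complements and decorrelation of two groups of points -/

section Schur
variable {ι κ : Type} {x : ι → Sp d} {y : κ → Sp d}

lemma gram_sumElim (hK : IsContractionKernel K) :
    gram K (Sum.elim x y) = Matrix.fromBlocks (gram K x)
      (Matrix.of fun i j => K (x i) (y j)) (Matrix.of fun i j => K (x i) (y j)).conjTranspose
      (gram K y) := by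
  ext i j
  rcases i with i | i <;> rcases j with j | j <;> simp [gram, hK.symm (y _) (x _)]

lemma gram_add (hK : IsContractionKernel K) (x : ι → Sp d) (c : Sp d) :
    gram K (fun i => x i + c) = gram K x := by
  ext i j
  simp [gram, hK.add_right]

variable [Fintype ι] [Fintype κ] [DecidableEq ι]

lemma posSemidef_explained (hx : (gram K x).PosDef) : (explained K x y).PosSemidef :=
  hx.inv.posSemidef.conjTranspose_mul_mul_same _

/-- Factor `A⁻¹ = Bᵀ B` for the Gram matrix `A`. The integrand is then a sum of squares, one for
each row of `B`, and the contraction property bounds the total by `tr (A⁻¹ A)`, the number of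
points. The bound does not deteriorate when the points of `x` approach each other. -/
lemma lintegral_quadratic_le (hK : IsContractionKernel K) (hx : (gram K x).PosDef) :
    ∫⁻ y, ENNReal.ofReal (∑ i, ∑ k, K (x i) y * (gram K x)⁻¹ i k * K (x k) y) ≤
      Fintype.card ι := by
  obtain ⟨B, hB⟩ := PosSemidef.exists_eq_conjTranspose_mul_self hx.inv.posSemidef
  have hentry : ∀ i k, (gram K x)⁻¹ i k = ∑ m, B m i * B m k := by
    intro i k
    rw [hB, Matrix.mul_apply]
    simp
  have hsq : ∀ y, ∑ i, ∑ k, K (x i) y * (gram K x)⁻¹ i k * K (x k) y =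
      ∑ m, (∑ i, B m i * K (x i) y) ^ 2 := by
    intro y
    simp only [hentry, sq, Finset.mul_sum, Finset.sum_mul]
    rw [Finset.sum_congr rfl fun i _ => Finset.sum_comm, Finset.sum_comm]
    refine Finset.sum_congr rfl fun m _ => Finset.sum_congr rfl fun i _ =>
      Finset.sum_congr rfl fun k _ => ?_
    ring
  have hmeas : ∀ m, Measurable fun y => ENNReal.ofReal ((∑ i, B m i * K (x i) y) ^ 2) := by
    intro m
    refine ENNReal.measurable_ofReal.comp (Continuous.measurable ?_)
    refine (continuous_finsetSum _ fun i _ => continuous_const.mul ?_).pow 2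
    exact hK.continuous.comp (continuous_const.prodMk continuous_id)
  have hnn : ∀ m, 0 ≤ ∑ i, ∑ j, B m i * B m j * K (x i) (x j) := by
    intro m
    have h := (hK.posSemidef x).dotProduct_mulVec_nonneg (B m)
    simp only [dotProduct, Matrix.mulVec, gram, Matrix.of_apply, star_trivial,
      Finset.mul_sum] at h
    refine h.trans_eq (Finset.sum_congr rfl fun i _ => Finset.sum_congr rfl fun j _ => ?_)
    ring
  calc ∫⁻ y, ENNReal.ofReal (∑ i, ∑ k, K (x i) y * (gram K x)⁻¹ i k * K (x k) y)
      = ∫⁻ y, ∑ m, ENNReal.ofReal ((∑ i, B m i * K (x i) y) ^ 2) := by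
        refine lintegral_congr fun y => ?_
        rw [hsq, ENNReal.ofReal_sum_of_nonneg fun m _ => sq_nonneg _]
    _ = ∑ m, ∫⁻ y, ENNReal.ofReal ((∑ i, B m i * K (x i) y) ^ 2) :=
        lintegral_finsetSum _ fun m _ => hmeas m
    _ ≤ ∑ m, ENNReal.ofReal (∑ i, ∑ j, B m i * B m j * K (x i) (x j)) :=
        Finset.sum_le_sum fun m _ => hK.contraction x (B m)
    _ = ENNReal.ofReal (∑ m, ∑ i, ∑ j, B m i * B m j * K (x i) (x j)) := by
        rw [ENNReal.ofReal_sum_of_nonneg fun m _ => hnn m]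
    _ = ENNReal.ofReal ((gram K x)⁻¹ * gram K x).trace := by
        congr 1
        simp only [Matrix.trace, Matrix.diag, Matrix.mul_apply, hentry, Finset.sum_mul]
        rw [Finset.sum_comm]
        refine Finset.sum_congr rfl fun i _ => ?_
        rw [Finset.sum_comm]
        refine Finset.sum_congr rfl fun j _ => Finset.sum_congr rfl fun m _ => ?_
        rw [gram, Matrix.of_apply, hK.symm (x j)]
    _ = _ := by
        rw [Matrix.nonsing_inv_mul _ hx.det_pos.ne'.isUnit, Matrix.trace_one]
        simp

lemma lintegral_trace_explained_le (hK : IsContractionKernel K) (hx : (gram K x).PosDef) :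
    ∫⁻ R, ENNReal.ofReal (explained K x fun j => y j + R).trace ≤
      Fintype.card κ * Fintype.card ι := by
  have htr : ∀ R, (explained K x fun j => y j + R).trace =
      ∑ j, ∑ i, ∑ k, K (x i) (y j + R) * (gram K x)⁻¹ i k * K (x k) (y j + R) := by
    intro R
    simp only [Matrix.trace, Matrix.diag, explained, Matrix.mul_apply, Finset.sum_mul,
      Matrix.conjTranspose_apply, Matrix.of_apply, star_trivial]
    exact Finset.sum_congr rfl fun j _ => Finset.sum_comm
  have hnn : ∀ z : Sp d, 0 ≤ ∑ i, ∑ k, K (x i) z * (gram K x)⁻¹ i k * K (x k) z := by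
    intro z
    have h := hx.inv.posSemidef.dotProduct_mulVec_nonneg fun i => K (x i) z
    simp only [dotProduct, Matrix.mulVec, Pi.star_apply, star_trivial, Finset.mul_sum] at h
    refine h.trans_eq (Finset.sum_congr rfl fun i _ => Finset.sum_congr rfl fun j _ => ?_)
    ring
  have hcont : ∀ i, Continuous fun z => K (x i) z := fun i =>
    hK.continuous.comp (continuous_const.prodMk continuous_id)
  calc ∫⁻ R, ENNReal.ofReal (explained K x fun j => y j + R).trace
      = ∫⁻ R, ∑ j, ENNReal.ofReal
          (∑ i, ∑ k, K (x i) (y j + R) * (gram K x)⁻¹ i k * K (x k) (y j + R)) := by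
        refine lintegral_congr fun R => ?_
        rw [htr, ENNReal.ofReal_sum_of_nonneg fun j _ => hnn _]
    _ = ∑ j, ∫⁻ R, ENNReal.ofReal
          (∑ i, ∑ k, K (x i) (y j + R) * (gram K x)⁻¹ i k * K (x k) (y j + R)) := by
        refine lintegral_finsetSum _ fun j _ => ENNReal.measurable_ofReal.comp
          (Continuous.measurable ?_)
        refine continuous_finsetSum _ fun i _ => continuous_finsetSum _ fun k _ => ?_
        exact (((hcont i).comp (continuous_const_add _)).mul continuous_const).mul
          ((hcont k).comp (continuous_const_add _))
    _ ≤ ∑ _j : κ, (Fintype.card ι : ℝ≥0∞) := by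
        refine Finset.sum_le_sum fun j _ => ?_
        rw [lintegral_add_left_eq_self (fun z => ENNReal.ofReal
          (∑ i, ∑ k, K (x i) z * (gram K x)⁻¹ i k * K (x k) z))]
        exact hK.lintegral_quadratic_le hx
    _ = _ := by simp

lemma posSemidef_sub_explained (hK : IsContractionKernel K) (hx : (gram K x).PosDef) :
    (gram K y - explained K x y).PosSemidef := by
  have : Invertible (gram K x) := Matrix.invertibleOfIsUnitDet _ (hx.det_pos.ne'.isUnit)
  have h := hK.posSemidef (Sum.elim x y)
  rw [hK.gram_sumElim, Matrix.PosDef.fromBlocks₁₁ _ _ hx] at h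
  exact h

/-- The Schur complement is positive semidefinite and its diagonal is at most that of `gram K y`, so
its entries have a bound uniform in all configurations. -/
lemma abs_sub_explained_le (hK : IsContractionKernel K) (hx : (gram K x).PosDef) (i j : κ) :
    |(gram K y - explained K x y) i j| ≤ K 0 0 := by
  have h1 := PosSemidef.abs_apply_le (hK.posSemidef_sub_explained (y := y) hx) i j
  have h2 : ∀ k, (gram K y - explained K x y) k k ≤ K 0 0 := by
    intro k
    have := (posSemidef_explained (y := y) hx).diag_nonneg (i := k)
    rw [Matrix.sub_apply, gram, Matrix.of_apply, hK.self_eq]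
    linarith
  linarith [h2 i, h2 j]

variable [DecidableEq κ]

lemma det_gram_sumElim (hK : IsContractionKernel K) (hx : (gram K x).PosDef) :
    (gram K (Sum.elim x y)).det = (gram K x).det * (gram K y - explained K x y).det := by
  have : Invertible (gram K x) := Matrix.invertibleOfIsUnitDet _ (hx.det_pos.ne'.isUnit)
  rw [hK.gram_sumElim, Matrix.det_fromBlocks₁₁, Matrix.invOf_eq_nonsing_inv]
  rfl

/-- Fischer's inequality, up to a constant. -/
lemma abs_det_gram_sumElim_le (hK : IsContractionKernel K) (hx : (gram K x).PosDef) :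
    |(gram K (Sum.elim x y)).det| ≤
      ((Fintype.card κ).factorial * K 0 0 ^ Fintype.card κ) * (gram K x).det := by
  rw [hK.det_gram_sumElim hx, abs_mul, abs_of_pos hx.det_pos, mul_comm]
  exact mul_le_mul_of_nonneg_right (abs_det_le _ (hK.abs_sub_explained_le hx)) hx.det_pos.le

/-- By the Schur formula the defect is `det A * (det G - det (G - E))` with `E` the explained
covariance. The determinant is Lipschitz on bounded matrices, and the entries of a semidefinite
matrix are at most its trace. Keeping the factor `det A` is what later compensates the singularity
of the statistics. -/
lemma abs_det_mul_det_sub_le (hK : IsContractionKernel K) (hx : (gram K x).PosDef) :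
    |(gram K x).det * (gram K y).det - (gram K (Sum.elim x y)).det| ≤
      ((Fintype.card κ).factorial * (Fintype.card κ * (K 0 0 + 1) ^ Fintype.card κ)) *
        (gram K x).det * (explained K x y).trace := by
  have hE := posSemidef_explained (y := y) hx
  rw [hK.det_gram_sumElim hx, ← mul_sub, abs_mul, abs_of_pos hx.det_pos]
  have h := abs_det_sub_det_le (gram K y) (gram K y - explained K x y) (M := K 0 0 + 1)
    (δ := (explained K x y).trace) (by linarith [hK.zero_zero_nonneg]) hE.trace_nonneg
    (fun i j => (hK.abs_le _ _).trans (by linarith))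
    (fun i j => (hK.abs_sub_explained_le hx i j).trans (by linarith))
    (fun i j => by simpa using PosSemidef.abs_apply_le_trace hE i j)
  calc _ ≤ (gram K x).det * _ := mul_le_mul_of_nonneg_left h hx.det_pos.le
    _ = _ := by ring

lemma det_gram_nonneg (hK : IsContractionKernel K) (x : ι → Sp d) : 0 ≤ (gram K x).det :=
  (hK.posSemidef x).det_nonneg

/-- The defect of independence of two groups of points is integrable in their displacement. -/
lemma lintegral_defect_le (hK : IsContractionKernel K) (hx : (gram K x).PosDef) :
    ∫⁻ R, ‖(gram K x).det * (gram K y).det - (gram K (Sum.elim x fun j => y j + R)).det‖ₑ ≤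
      ENNReal.ofReal (((Fintype.card κ).factorial *
        (Fintype.card κ * (K 0 0 + 1) ^ Fintype.card κ)) *
        (Fintype.card κ * Fintype.card ι) * (gram K x).det) := by
  have hc : 0 ≤ ((Fintype.card κ).factorial *
      (Fintype.card κ * (K 0 0 + 1) ^ Fintype.card κ) : ℝ) * (gram K x).det := by
    have := hK.zero_zero_nonneg
    have := hx.det_pos
    positivity
  calc _ ≤ ∫⁻ R, ENNReal.ofReal (((Fintype.card κ).factorial *
        (Fintype.card κ * (K 0 0 + 1) ^ Fintype.card κ)) * (gram K x).det) *
          ENNReal.ofReal (explained K x fun j => y j + R).trace := by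
        refine lintegral_mono fun R => ?_
        rw [← ENNReal.ofReal_mul hc, ← ofReal_norm, Real.norm_eq_abs]
        refine ENNReal.ofReal_le_ofReal ?_
        have := hK.abs_det_mul_det_sub_le (y := fun j => y j + R) hx
        rwa [hK.gram_add y R] at this
    _ = ENNReal.ofReal _ * ∫⁻ R, ENNReal.ofReal (explained K x fun j => y j + R).trace :=
        lintegral_const_mul' _ _ ENNReal.ofReal_ne_top
    _ ≤ ENNReal.ofReal _ * (Fintype.card κ * Fintype.card ι) := by
        gcongr
        exact hK.lintegral_trace_explained_le hx
    _ = _ := by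
        rw [show ((Fintype.card κ : ℝ≥0∞) * Fintype.card ι) =
          ENNReal.ofReal (Fintype.card κ * Fintype.card ι) by
            rw [ENNReal.ofReal_mul (by positivity)]; simp, ← ENNReal.ofReal_mul hc]
        congr 1
        ring

end Schur
end IsContractionKernel

/-! ### Local statistics and their overlaps -/

lemma ae_injective {d : ℕ} (hd : 1 ≤ d) (l : ℕ) :
    ∀ᵐ z : Fin l → Sp d, Function.Injective z := by
  have hne : Nontrivial (Sp d) := by
    have : Nonempty (Fin d) := ⟨⟨0, hd⟩⟩
    infer_instance
  have h : ∀ i j : Fin l, i ≠ j → ∀ᵐ z : Fin l → Sp d, z i ≠ z j := by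
    intro i j hij
    set L : (Fin l → Sp d) →ₗ[ℝ] Sp d :=
      (LinearMap.proj i : (Fin l → Sp d) →ₗ[ℝ] Sp d) - LinearMap.proj j with hL
    have hker : LinearMap.ker L ≠ ⊤ := by
      obtain ⟨v, hv⟩ := exists_ne (0 : Sp d)
      intro htop
      have : L (Pi.single i v) = 0 := by
        rw [← LinearMap.mem_ker, htop]; trivial
      simp [hL, hij.symm] at this
      exact hv this
    have h0 := Measure.addHaar_submodule volume (LinearMap.ker L) hker
    rw [ae_iff]
    convert h0 using 2
    ext z
    simp [hL, sub_eq_zero]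
  have h2 : ∀ᵐ z : Fin l → Sp d, ∀ i j : Fin l, i ≠ j → z i ≠ z j := by
    rw [ae_all_iff]; intro i
    rw [ae_all_iff]; intro j
    by_cases hij : i = j
    · simp [hij]
    · filter_upwards [h i j hij] with z hz _ using hz
  filter_upwards [h2] with z hz i j hij
  by_contra hne'
  exact hz i j hne' hij

/-- The set of bad displacements multiplied by the volume of a ball gives the measure of the bad
tuples with first point in that ball, which is zero. -/
lemma ae_of_ae_of_transInv {d l : ℕ} (hl : 1 ≤ l) {p : (Fin l → Sp d) → Prop}
    (hpm : MeasurableSet {z | p z}) (hinv : TransInv p) (h : ∀ᵐ z, p z) :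
    ∀ᵐ u : Fin (l - 1) → Sp d, p (anchored u) := by
  have h1 := lintegral_indicator_mul_of_transInv (⟨0, hl⟩ : Fin l)
    (H := {z | p z}ᶜ.indicator 1) (measurable_one.indicator hpm.compl) (fun c z => by
      have : (fun i => z i + c) ∈ {z | p z}ᶜ ↔ z ∈ {z | p z}ᶜ := by
        simp only [Set.mem_compl_iff, Set.mem_ofPred_eq, hinv c z]
      by_cases hz : z ∈ {z | p z}ᶜ
      · rw [Set.indicator_of_mem hz, Set.indicator_of_mem (this.2 hz)]; rfl
      · rw [Set.indicator_of_notMem hz, Set.indicator_of_notMem fun h' => hz (this.1 h')])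
    (Metric.isOpen_ball (x := (0 : Sp d)) (ε := 1)).measurableSet
  have h2 : ∫⁻ z : Fin l → Sp d, (Metric.ball (0 : Sp d) 1).indicator 1 (z ⟨0, hl⟩) *
      {z | p z}ᶜ.indicator (1 : (Fin l → Sp d) → ℝ≥0∞) z = 0 := by
    rw [lintegral_eq_zero_iff']
    · filter_upwards [h] with z hz
      simp [hz]
    · exact ((((measurable_one.indicator Metric.isOpen_ball.measurableSet).comp
        (measurable_pi_apply _))).mul (measurable_one.indicator hpm.compl)).aemeasurable
  have hm : Measurable fun u : Fin (l - 1) → Sp d =>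
      {z | p z}ᶜ.indicator (1 : (Fin l → Sp d) → ℝ≥0∞) (anchored u) :=
    (measurable_one.indicator hpm.compl).comp measurable_anchored
  rw [h2, eq_comm, mul_eq_zero, or_iff_right (Metric.measure_ball_pos _ _ one_pos).ne',
    lintegral_eq_zero_iff hm] at h1
  filter_upwards [h1] with u hu
  by_contra hp
  simp [hp] at hu

lemma transInv_injective {d l : ℕ} :
    TransInv fun z : Fin l → Sp d => Function.Injective z := by
  intro c z
  refine propext ⟨fun h i j hij => h (by simp [hij]), fun h i j hij => h (by simpa using hij)⟩

/-- A statistic of `s`-tuples of nearby points, of size `O(ρ^{-1/2})`. -/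
structure IsLocalStat {d s : ℕ} (K : Sp d → Sp d → ℝ) (r : ℝ) (f : (Fin s → Sp d) → ℝ) :
    Prop where
  measurable : Measurable f
  transInv : TransInv f
  eq_zero : ∀ x, x ∉ nearTuples d s r → f x = 0
  bound : ∃ c, 0 ≤ c ∧ ∀ x, Function.Injective x → |f x| * √(jointIntensity K x) ≤ c

/-- The translation invariant function of `l` points behind `overlapIntegrand`. -/
def overlapFun {d s t l : ℕ} (K : Sp d → Sp d → ℝ) (f : (Fin s → Sp d) → ℝ)
    (g : (Fin t → Sp d) → ℝ) (ab : (Fin s ↪ Fin l) × (Fin t ↪ Fin l)) (z : Fin l → Sp d) : ℝ :=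
  f (z ∘ ab.1) * g (z ∘ ab.2) *
    (jointIntensity K z -
      if l = s + t then jointIntensity K (z ∘ ab.1) * jointIntensity K (z ∘ ab.2) else 0)

lemma norm_sub_le_of_mem_nearTuples {d s : ℕ} {r : ℝ} {x : Fin s → Sp d}
    (hx : x ∈ nearTuples d s r) (i j : Fin s) : ‖x i - x j‖ ≤ 2 * r := by
  have hs : 0 < s := Nat.zero_lt_of_lt i.2
  have hi := hx ⟨0, hs⟩ i rfl
  have hj := hx ⟨0, hs⟩ j rfl
  calc ‖x i - x j‖ = ‖(x ⟨0, hs⟩ - x j) - (x ⟨0, hs⟩ - x i)‖ := by congr 1; abel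
    _ ≤ _ := norm_sub_le _ _
    _ ≤ 2 * r := by linarith

lemma volume_closeTuples_lt_top {d l : ℕ} (k : Fin l) (ρ : ℝ) :
    volume {z : Fin l → Sp d | z k ∈ Metric.ball 0 1 ∧ ∀ j, ‖z k - z j‖ ≤ ρ} < ∞ := by
  refine (measure_mono (t := Set.univ.pi fun _ => Metric.closedBall (0 : Sp d) (1 + ρ)) ?_).trans_lt
    (Bornology.IsBounded.pi fun _ => Metric.isBounded_closedBall).measure_lt_top
  rintro z ⟨hk, hz⟩ j -
  rw [mem_closedBall_zero_iff]
  rw [mem_ball_zero_iff] at hk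
  calc ‖z j‖ = ‖z k - (z k - z j)‖ := by congr 1; abel
    _ ≤ _ := norm_sub_le _ _
    _ ≤ 1 + ρ := add_le_add hk.le (hz j)

lemma volume_anchored_nearTuples_lt_top {d l : ℕ} (hl : 1 ≤ l) (r : ℝ) :
    volume {u : Fin (l - 1) → Sp d | anchored u ∈ nearTuples d l r} < ∞ := by
  refine (measure_mono (t := Set.univ.pi fun _ => Metric.closedBall (0 : Sp d) r) ?_).trans_lt
    (Bornology.IsBounded.pi fun _ => Metric.isBounded_closedBall).measure_lt_top
  intro u hu j _
  have := hu ⟨0, hl⟩ ⟨j + 1, by omega⟩ rfl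
  simpa [anchored] using this

namespace IsContractionKernel
variable {d : ℕ} {K : Sp d → Sp d → ℝ}

lemma jointIntensity_nonneg (hK : IsContractionKernel K) {l : ℕ} (z : Fin l → Sp d) :
    0 ≤ jointIntensity K z := hK.det_gram_nonneg z

lemma jointIntensity_pos (hK : IsContractionKernel K) {l : ℕ} {z : Fin l → Sp d}
    (hz : Function.Injective z) : 0 < jointIntensity K z := (hK.posDef z hz).det_pos

lemma continuous_jointIntensity (hK : IsContractionKernel K) {l : ℕ} :
    Continuous fun z : Fin l → Sp d => jointIntensity K z := by
  unfold jointIntensity kernelMatrix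
  refine Continuous.matrix_det (continuous_matrix fun i j => ?_)
  exact hK.continuous.comp (f := fun z : Fin l → Sp d => (z i, z j)) (by fun_prop)

lemma measurable_jointIntensity (hK : IsContractionKernel K) {l : ℕ} :
    Measurable fun z : Fin l → Sp d => jointIntensity K z :=
  hK.continuous_jointIntensity.measurable

lemma jointIntensity_bounded (hK : IsContractionKernel K) (l : ℕ) :
    ∃ c, ∀ z : Fin l → Sp d, |jointIntensity K z| ≤ c :=
  ⟨_, fun z => abs_det_le (kernelMatrix K z) fun i j => hK.abs_le (z i) (z j)⟩

lemma transInv_jointIntensity (hK : IsContractionKernel K) {l : ℕ} :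
    TransInv fun z : Fin l → Sp d => jointIntensity K z := by
  intro c z
  exact congrArg Matrix.det (hK.gram_add z c)

/-- List the points selected by `a` before the remaining ones and apply Fischer's inequality to the
two blocks; reordering does not change the determinant. -/
lemma jointIntensity_le_comp (hK : IsContractionKernel K) {s l : ℕ} (a : Fin s ↪ Fin l) :
    ∃ c, 0 ≤ c ∧ ∀ z : Fin l → Sp d, Function.Injective z →
      jointIntensity K z ≤ c * jointIntensity K (z ∘ a) := by
  classical
  set κ := {k : Fin l // ¬ k ∈ Set.range a}
  have h0 := hK.zero_zero_nonneg
  refine ⟨(Fintype.card κ).factorial * K 0 0 ^ Fintype.card κ, by positivity, fun z hz => ?_⟩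
  set e : Fin s ⊕ κ ≃ Fin l :=
    ((Equiv.ofInjective a a.injective).sumCongr (Equiv.refl _)).trans
      (Equiv.sumCompl fun k => k ∈ Set.range a) with he
  have hel : ∀ i, e (Sum.inl i) = a i := fun i => rfl
  have her : ∀ k, e (Sum.inr k) = k := fun k => rfl
  have h1 : gram K (Sum.elim (z ∘ a) fun k : κ => z k) = (gram K z).submatrix e e := by
    ext i j
    rcases i with i | i <;> rcases j with j | j <;> simp [gram, hel, her]
  have h2 := hK.abs_det_gram_sumElim_le (x := z ∘ a) (y := fun k : κ => z k)
    (hK.posDef _ (hz.comp a.injective))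
  rw [h1, Matrix.det_submatrix_equiv_self] at h2
  exact (le_abs_self _).trans h2

end IsContractionKernel

section Overlap
variable {d s t l : ℕ} {K : Sp d → Sp d → ℝ} {r : ℝ} {f : (Fin s → Sp d) → ℝ}
  {g : (Fin t → Sp d) → ℝ} {ab : (Fin s ↪ Fin l) × (Fin t ↪ Fin l)}

lemma measurable_comp_index {d s l : ℕ} (a : Fin s → Fin l) :
    Measurable fun z : Fin l → Sp d => z ∘ a :=
  measurable_pi_lambda _ fun i => measurable_pi_apply (a i)

lemma measurable_overlapFun (hK : IsContractionKernel K) (hf : Measurable f) (hg : Measurable g) :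
    Measurable (overlapFun K f g ab) := by
  unfold overlapFun
  refine ((hf.comp (measurable_comp_index _)).mul (hg.comp (measurable_comp_index _))).mul
    (hK.measurable_jointIntensity.sub ?_)
  split_ifs
  · exact (hK.measurable_jointIntensity.comp (measurable_comp_index _)).mul
      (hK.measurable_jointIntensity.comp (measurable_comp_index _))
  · exact measurable_const

lemma transInv_overlapFun (hK : IsContractionKernel K) (hf : TransInv f) (hg : TransInv g) :
    TransInv (overlapFun K f g ab) := by
  intro c z
  have h1 : ∀ {m : ℕ} (a : Fin m ↪ Fin l), (fun i => z i + c) ∘ a = fun i => (z ∘ a) i + c :=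
    fun a => rfl
  have h2 : ∀ {m : ℕ} (x : Fin m → Sp d),
      jointIntensity K (fun i => x i + c) = jointIntensity K x :=
    fun x => hK.transInv_jointIntensity c x
  unfold overlapFun
  rw [h1, h1, hf, hg, h2, h2, h2]

/-- Split `ρ(z) = √ρ(z) √ρ(z)` and give one root to each statistic. Each root is at most a constant
times the root for the corresponding subtuple, which `IsLocalStat.bound` absorbs. -/
lemma IsLocalStat.abs_mul_jointIntensity_le (hK : IsContractionKernel K)
    (hf : IsLocalStat K r f) (hg : IsLocalStat K r g)
    (ab : (Fin s ↪ Fin l) × (Fin t ↪ Fin l)) :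
    ∃ c, 0 ≤ c ∧ ∀ z : Fin l → Sp d, Function.Injective z →
      |f (z ∘ ab.1) * g (z ∘ ab.2) * jointIntensity K z| ≤ c := by
  obtain ⟨cf, hcf0, hcf⟩ := hf.bound
  obtain ⟨cg, hcg0, hcg⟩ := hg.bound
  obtain ⟨c1, hc10, hc1⟩ := hK.jointIntensity_le_comp ab.1
  obtain ⟨c2, hc20, hc2⟩ := hK.jointIntensity_le_comp ab.2
  refine ⟨√c1 * cf * (√c2 * cg), by positivity, fun z hz => ?_⟩
  have hρ := hK.jointIntensity_nonneg z
  have h1 : √(jointIntensity K z) ≤ √c1 * √(jointIntensity K (z ∘ ab.1)) := by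
    rw [← Real.sqrt_mul hc10]; exact Real.sqrt_le_sqrt (hc1 z hz)
  have h2 : √(jointIntensity K z) ≤ √c2 * √(jointIntensity K (z ∘ ab.2)) := by
    rw [← Real.sqrt_mul hc20]; exact Real.sqrt_le_sqrt (hc2 z hz)
  calc |f (z ∘ ab.1) * g (z ∘ ab.2) * jointIntensity K z|
      = (|f (z ∘ ab.1)| * √(jointIntensity K z)) * (|g (z ∘ ab.2)| * √(jointIntensity K z)) := by
        rw [abs_mul, abs_mul, abs_of_nonneg hρ]
        nth_rewrite 1 [← Real.mul_self_sqrt hρ]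
        ring
    _ ≤ (|f (z ∘ ab.1)| * (√c1 * √(jointIntensity K (z ∘ ab.1)))) *
        (|g (z ∘ ab.2)| * (√c2 * √(jointIntensity K (z ∘ ab.2)))) := by gcongr
    _ = √c1 * (|f (z ∘ ab.1)| * √(jointIntensity K (z ∘ ab.1))) *
        (√c2 * (|g (z ∘ ab.2)| * √(jointIntensity K (z ∘ ab.2)))) := by ring
    _ ≤ √c1 * cf * (√c2 * cg) := by
        gcongr
        · exact hcf _ (hz.comp ab.1.injective)
        · exact hcg _ (hz.comp ab.2.injective)

/-- With fewer than `s + t` points the tuples share some `z k`. Both have finite range, so all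
points stay within `2 * r` of `z k`, and a bounded integrand lives on a set of finite volume. -/
lemma integrable_overlap_of_lt (hd : 1 ≤ d) (hK : IsContractionKernel K)
    (hf : IsLocalStat K r f) (hg : IsLocalStat K r g) (hab : ab ∈ overlaps s t l)
    (hlt : l < s + t) :
    Integrable fun u : Fin (l - 1) → Sp d => overlapFun K f g ab (anchored u) := by
  obtain ⟨c, hc0, hc⟩ := hf.abs_mul_jointIntensity_le hK hg ab
  obtain ⟨k, ⟨i0, hi0⟩, ⟨j0, hj0⟩⟩ : ∃ k, k ∈ Set.range ab.1 ∧ k ∈ Set.range ab.2 := by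
    by_contra! h
    have hinj : Function.Injective (Sum.elim ab.1 ab.2) :=
      ab.1.injective.sumElim ab.2.injective fun i j hij => h _ ⟨i, rfl⟩ ⟨j, hij.symm⟩
    have := Fintype.card_le_of_injective _ hinj
    simp at this
    omega
  refine integrable_comp_anchored k (measurable_overlapFun hK hf.measurable hg.measurable)
    (transInv_overlapFun hK hf.transInv hg.transInv) (ne_of_lt ?_)
  set S : Set (Fin l → Sp d) := {z | z k ∈ Metric.ball 0 1 ∧ ∀ j, ‖z k - z j‖ ≤ 2 * r} with hS
  calc ∫⁻ z, (Metric.ball (0 : Sp d) 1).indicator 1 (z k) * ‖overlapFun K f g ab z‖ₑ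
      ≤ ∫⁻ z, S.indicator (fun _ => ENNReal.ofReal c) z := by
        refine lintegral_mono_ae ?_
        filter_upwards [ae_injective hd l] with z hz
        by_cases hzk : z k ∈ Metric.ball (0 : Sp d) 1
        swap
        · simp [Set.indicator_of_notMem hzk]
        by_cases h1 : z ∘ ab.1 ∈ nearTuples d s r
        swap
        · simp [overlapFun, hf.eq_zero _ h1]
        by_cases h2 : z ∘ ab.2 ∈ nearTuples d t r
        swap
        · simp [overlapFun, hg.eq_zero _ h2]
        have hmem : z ∈ S := by
          refine ⟨hzk, fun j => ?_⟩
          rcases hab j with ⟨i, rfl⟩ | ⟨i, rfl⟩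
          · rw [← hi0]; exact norm_sub_le_of_mem_nearTuples h1 i0 i
          · rw [← hj0]; exact norm_sub_le_of_mem_nearTuples h2 j0 i
        rw [Set.indicator_of_mem hzk, Set.indicator_of_mem hmem, Pi.one_apply, one_mul,
          ← ofReal_norm]
        refine ENNReal.ofReal_le_ofReal ?_
        rw [overlapFun, if_neg hlt.ne, sub_zero, Real.norm_eq_abs]
        exact hc z hz
    _ ≤ ENNReal.ofReal c * volume S := lintegral_indicator_const_le _ _
    _ < ∞ := ENNReal.mul_lt_top ENNReal.ofReal_lt_top (volume_closeTuples_lt_top k _)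

/-- Two disjoint groups of points which together make up an `l`-tuple. -/
lemma measurePreserving_sumElim_comp (e : Fin s ⊕ Fin t ≃ Fin l) :
    MeasurePreserving (fun q : (Fin s → Sp d) × (Fin t → Sp d) => Sum.elim q.1 q.2 ∘ e.symm) := by
  have h1 := volume_measurePreserving_sumPiEquivProdPi_symm (fun _ : Fin s ⊕ Fin t => Sp d)
  have h2 := volume_measurePreserving_piCongrLeft (fun _ : Fin l => Sp d) e
  have heq : (fun q : (Fin s → Sp d) × (Fin t → Sp d) => Sum.elim q.1 q.2 ∘ e.symm) =
      MeasurableEquiv.piCongrLeft (fun _ : Fin l => Sp d) e ∘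
        (MeasurableEquiv.sumPiEquivProdPi (fun _ : Fin s ⊕ Fin t => Sp d)).symm := by
    funext q k
    obtain ⟨i, rfl⟩ := e.surjective k
    simp only [Function.comp_apply, Equiv.symm_apply_apply]
    rw [MeasurableEquiv.coe_piCongrLeft, Equiv.piCongrLeft_apply_apply]
    rcases i with i | i <;> rfl
  rw [heq]
  exact h2.comp h1

/-- A pair of tuples which covers `s + t` points without overlap is a bijection. -/
lemma exists_equiv_of_mem_overlaps {ab : (Fin s ↪ Fin l) × (Fin t ↪ Fin l)}
    (hab : ab ∈ overlaps s t l) (hl : l = s + t) :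
    ∃ e : Fin s ⊕ Fin t ≃ Fin l, (∀ i, e (Sum.inl i) = ab.1 i) ∧ ∀ j, e (Sum.inr j) = ab.2 j := by
  have hsurj : Function.Surjective (Sum.elim ab.1 ab.2) := by
    intro k
    rcases hab k with ⟨i, hi⟩ | ⟨i, hi⟩
    · exact ⟨Sum.inl i, hi⟩
    · exact ⟨Sum.inr i, hi⟩
  have hbij : Function.Bijective (Sum.elim ab.1 ab.2) :=
    (Fintype.bijective_iff_surjective_and_card _).2 ⟨hsurj, by simp [hl]⟩
  exact ⟨Equiv.ofBijective _ hbij, fun i => rfl, fun j => rfl⟩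

/-- Conditioning on `x` gives a bound proportional to `ρ(x)`, conditioning on `y` one proportional
to `ρ(y)`. The smaller is at most their geometric mean, which provides exactly one square root for
each statistic. -/
lemma IsContractionKernel.lintegral_defect_le_sqrt (hK : IsContractionKernel K) (s t : ℕ) :
    ∃ c, 0 ≤ c ∧ ∀ (x : Fin s → Sp d) (y : Fin t → Sp d), Function.Injective x →
      Function.Injective y →
      ∫⁻ R, ‖(gram K x).det * (gram K y).det - (gram K (Sum.elim x fun j => y j + R)).det‖ₑ ≤
        ENNReal.ofReal (c * (√(jointIntensity K x) * √(jointIntensity K y))) := by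
  have h0 := hK.zero_zero_nonneg
  set c1 : ℝ := ((Fintype.card (Fin t)).factorial *
    (Fintype.card (Fin t) * (K 0 0 + 1) ^ Fintype.card (Fin t))) *
    (Fintype.card (Fin t) * Fintype.card (Fin s)) with hc1
  set c2 : ℝ := ((Fintype.card (Fin s)).factorial *
    (Fintype.card (Fin s) * (K 0 0 + 1) ^ Fintype.card (Fin s))) *
    (Fintype.card (Fin s) * Fintype.card (Fin t)) with hc2
  have hc10 : 0 ≤ c1 := by positivity
  have hc20 : 0 ≤ c2 := by positivity
  refine ⟨√c1 * √c2, by positivity, fun x y hx hy => ?_⟩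
  have hρx := hK.jointIntensity_nonneg x
  have hρy := hK.jointIntensity_nonneg y
  have hA := hK.lintegral_defect_le (y := y) (hK.posDef x hx)
  have hB := hK.lintegral_defect_le (y := x) (hK.posDef y hy)
  -- Moving `x` by `R` has the same effect as moving `y` by `-R`, and Lebesgue measure is symmetric
  -- under reflection.
  have hswap : ∫⁻ R, ‖(gram K y).det * (gram K x).det -
        (gram K (Sum.elim y fun j => x j + R)).det‖ₑ =
      ∫⁻ R, ‖(gram K x).det * (gram K y).det - (gram K (Sum.elim x fun j => y j + R)).det‖ₑ := by
    rw [← lintegral_neg_eq_self]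
    refine lintegral_congr fun R => ?_
    rw [mul_comm (gram K y).det]
    congr 2
    have h1 : gram K (Sum.elim x fun j => y j + R) =
        (gram K fun i => Sum.elim y (fun j => x j + -R) i + R).submatrix
          (Equiv.sumComm _ _) (Equiv.sumComm _ _) := by
      ext i j
      rcases i with i | i <;> rcases j with j | j <;> simp [gram]
    rw [h1, Matrix.det_submatrix_equiv_self, hK.gram_add]
  rw [hswap] at hB
  have hmin := le_min hA hB
  rw [← ENNReal.ofReal_min] at hmin
  refine hmin.trans (ENNReal.ofReal_le_ofReal ?_)
  have hp : 0 ≤ c1 * jointIntensity K x := mul_nonneg hc10 hρx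
  have hq : 0 ≤ c2 * jointIntensity K y := mul_nonneg hc20 hρy
  have key : min (c1 * jointIntensity K x) (c2 * jointIntensity K y) ≤
      √((c1 * jointIntensity K x) * (c2 * jointIntensity K y)) := by
    refine Real.le_sqrt_of_sq_le ?_
    rw [sq]
    exact mul_le_mul (min_le_left _ _) (min_le_right _ _) (le_min hp hq) hp
  refine key.trans_eq ?_
  rw [Real.sqrt_mul hp, Real.sqrt_mul hc10, Real.sqrt_mul hc20]
  ring

/-- Integrate first over the relative displacement of the two groups, where the defect contributes
`c √ρ(x) √ρ(y)`. These roots make `f` and `g` bounded, and the remaining variables are the shapes of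
the two groups and one pinned point, all in sets of finite volume. -/
lemma integrable_overlap_of_eq (hd : 1 ≤ d) (hs : 1 ≤ s) (ht : 1 ≤ t)
    (hK : IsContractionKernel K) (hf : IsLocalStat K r f) (hg : IsLocalStat K r g)
    (hab : ab ∈ overlaps s t l) (hl : l = s + t) :
    Integrable fun u : Fin (l - 1) → Sp d => overlapFun K f g ab (anchored u) := by
  obtain ⟨e, he1, he2⟩ := exists_equiv_of_mem_overlaps hab hl
  obtain ⟨cf, hcf0, hcf⟩ := hf.bound
  obtain ⟨cg, hcg0, hcg⟩ := hg.bound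
  obtain ⟨c, hc0, hc⟩ := hK.lintegral_defect_le_sqrt s t
  set i0 : Fin s := ⟨0, hs⟩ with hi0
  have hmeas := measurable_overlapFun (ab := ab) hK hf.measurable hg.measurable
  refine integrable_comp_anchored (ab.1 i0) hmeas
    (transInv_overlapFun hK hf.transInv hg.transInv) (ne_of_lt ?_)
  have hmp := measurePreserving_sumElim_comp (d := d) e
  have hind : Measurable fun z : Fin l → Sp d =>
      (Metric.ball (0 : Sp d) 1).indicator (1 : Sp d → ℝ≥0∞) (z (ab.1 i0)) :=
    (measurable_one.indicator Metric.isOpen_ball.measurableSet).comp (measurable_pi_apply _)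
  set Δ : (Fin s → Sp d) → (Fin t → Sp d) → ℝ := fun x y =>
    (gram K x).det * (gram K y).det - (gram K (Sum.elim x y)).det with hΔ
  have hΔm : Measurable fun q : (Fin s → Sp d) × (Fin t → Sp d) => Δ q.1 q.2 := by
    have h1 : ∀ {ι : Type} [Fintype ι] [DecidableEq ι]
        {F : (Fin s → Sp d) × (Fin t → Sp d) → ι → Sp d},
        Continuous F → Continuous fun q => (gram K (F q)).det := by
      intro ι _ _ F hF
      refine Continuous.matrix_det (continuous_matrix fun i j => ?_)
      exact hK.continuous.comp (((continuous_apply i).comp hF).prodMk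
        ((continuous_apply j).comp hF))
    refine (((h1 continuous_fst).mul (h1 continuous_snd)).sub (h1 ?_)).measurable
    refine continuous_pi fun i => ?_
    rcases i with i | i
    · exact (continuous_apply i).comp continuous_fst
    · exact (continuous_apply i).comp continuous_snd
  have hcomp : ∀ (x : Fin s → Sp d) (y : Fin t → Sp d),
      ‖overlapFun K f g ab (Sum.elim x y ∘ e.symm)‖ₑ = ‖f x‖ₑ * (‖g y‖ₑ * ‖Δ x y‖ₑ) := by
    intro x y
    have hx : (Sum.elim x y ∘ e.symm) ∘ ab.1 = x := by
      funext i; simp [← he1]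
    have hy : (Sum.elim x y ∘ e.symm) ∘ ab.2 = y := by
      funext i; simp [← he2]
    have hdet : jointIntensity K (Sum.elim x y ∘ e.symm) = (gram K (Sum.elim x y)).det := by
      rw [← Matrix.det_submatrix_equiv_self e.symm (gram K (Sum.elim x y))]
      rfl
    rw [overlapFun, hx, hy, if_pos hl, hdet, enorm_mul, enorm_mul, mul_assoc]
    congr 2
    rw [hΔ, ← enorm_neg]
    congr 1
    simp only [jointIntensity, kernelMatrix, gram]
    ring
  set V := volume {u : Fin (t - 1) → Sp d | anchored u ∈ nearTuples d t r} with hV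
  have hVtop : V < ∞ := volume_anchored_nearTuples_lt_top ht r
  have hinner : ∀ x : Fin s → Sp d, Function.Injective x →
      ∫⁻ y, ‖g y‖ₑ * ‖Δ x y‖ₑ ≤ ENNReal.ofReal (c * cg * √(jointIntensity K x)) * V := by
    intro x hx
    have hΔx : Measurable (Δ x) := hΔm.comp measurable_prodMk_left
    have hm : Measurable fun y => ‖g y‖ₑ * ‖Δ x y‖ₑ := hg.measurable.enorm.mul hΔx.enorm
    rw [lintegral_eq_anchored ht hm, lintegral_lintegral_swap]
    swap
    · exact (hm.comp (measurePreserving_anchored_add ht).measurable).aemeasurable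
    calc _ ≤ ∫⁻ u : Fin (t - 1) → Sp d,
          {u : Fin (t - 1) → Sp d | anchored u ∈ nearTuples d t r}.indicator
            (fun _ => ENNReal.ofReal (c * cg * √(jointIntensity K x))) u := by
          refine lintegral_mono_ae ?_
          filter_upwards [ae_of_ae_of_transInv ht measurableSet_injective transInv_injective
            (ae_injective hd t)] with u hu
          have hgu : ∀ R, g (fun i => anchored u i + R) = g (anchored u) := fun R =>
            hg.transInv R _
          simp only [hgu]
          rw [lintegral_const_mul' _ _ enorm_ne_top]
          by_cases hn : anchored u ∈ nearTuples d t r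
          swap
          · simp [hg.eq_zero _ hn]
          rw [Set.indicator_of_mem (by exact hn)]
          calc _ ≤ ‖g (anchored u)‖ₑ * ENNReal.ofReal (c * (√(jointIntensity K x) *
                √(jointIntensity K (anchored (l := t) u)))) := by
                gcongr
                simpa only [hΔ, hK.gram_add] using hc x (anchored u) hx hu
            _ ≤ _ := by
                rw [← ofReal_norm, ← ENNReal.ofReal_mul (norm_nonneg _), Real.norm_eq_abs]
                refine ENNReal.ofReal_le_ofReal ?_
                calc |g (anchored u)| * (c * (√(jointIntensity K x) *
                      √(jointIntensity K (anchored (l := t) u))))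
                    = c * √(jointIntensity K x) * (|g (anchored u)| *
                      √(jointIntensity K (anchored (l := t) u))) := by ring
                  _ ≤ c * √(jointIntensity K x) * cg := by
                      gcongr
                      exact hcg _ hu
                  _ = _ := by ring
      _ ≤ _ := lintegral_indicator_const_le _ _
  have hGm : Measurable fun z : Fin l → Sp d =>
      (Metric.ball (0 : Sp d) 1).indicator (1 : Sp d → ℝ≥0∞) (z (ab.1 i0)) *
        ‖overlapFun K f g ab z‖ₑ := hind.mul hmeas.enorm
  rw [← hmp.lintegral_comp hGm, Measure.volume_eq_prod, lintegral_prod]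
  swap
  · exact (hGm.comp hmp.measurable).aemeasurable
  set S : Set (Fin s → Sp d) := {z | z i0 ∈ Metric.ball 0 1 ∧ ∀ j, ‖z i0 - z j‖ ≤ 2 * r} with hS
  calc _ ≤ ∫⁻ x : Fin s → Sp d, S.indicator (fun _ => ENNReal.ofReal (c * cg * cf) * V) x := by
        refine lintegral_mono_ae ?_
        filter_upwards [ae_injective hd s] with x hx
        have hidx : ∀ y : Fin t → Sp d, (Sum.elim x y ∘ e.symm) (ab.1 i0) = x i0 := by
          intro y; simp [← he1]
        simp only [hidx, hcomp]
        by_cases hxk : x i0 ∈ Metric.ball (0 : Sp d) 1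
        swap
        · simp [Set.indicator_of_notMem hxk]
        by_cases h1 : x ∈ nearTuples d s r
        swap
        · simp [hf.eq_zero _ h1]
        have hmem : x ∈ S := ⟨hxk, fun j => norm_sub_le_of_mem_nearTuples h1 i0 j⟩
        rw [Set.indicator_of_mem hmem, Set.indicator_of_mem hxk]
        simp only [Pi.one_apply, one_mul]
        rw [lintegral_const_mul' _ _ enorm_ne_top]
        calc _ ≤ ‖f x‖ₑ * (ENNReal.ofReal (c * cg * √(jointIntensity K x)) * V) := by
              gcongr
              exact hinner x hx
          _ ≤ _ := by
              rw [← mul_assoc, ← ofReal_norm, ← ENNReal.ofReal_mul (norm_nonneg _),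
                Real.norm_eq_abs]
              refine mul_le_mul' (ENNReal.ofReal_le_ofReal ?_) le_rfl
              calc |f x| * (c * cg * √(jointIntensity K x))
                  = c * cg * (|f x| * √(jointIntensity K x)) := by ring
                _ ≤ c * cg * cf := by
                    gcongr
                    exact hcf x hx
    _ ≤ ENNReal.ofReal (c * cg * cf) * V * volume S := lintegral_indicator_const_le _ _
    _ < ∞ := ENNReal.mul_lt_top (ENNReal.mul_lt_top ENNReal.ofReal_lt_top hVtop)
        (volume_closeTuples_lt_top i0 _)

theorem integrable_overlap (hd : 1 ≤ d) (hs : 1 ≤ s) (ht : 1 ≤ t)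
    (hK : IsContractionKernel K) (hf : IsLocalStat K r f) (hg : IsLocalStat K r g)
    (hab : ab ∈ overlaps s t l) (hl : l ≤ s + t) :
    Integrable fun u : Fin (l - 1) → Sp d => overlapFun K f g ab (anchored u) := by
  rcases hl.lt_or_eq with h | h
  · exact integrable_overlap_of_lt hd hK hf hg hab h
  · exact integrable_overlap_of_eq hd hs ht hK hf hg hab h

end Overlap

/-! ### Covariances of sums of local statistics -/

section Covariance
variable {d s t : ℕ} {K : Sp d → Sp d → ℝ} {r : ℝ} {f : (Fin s → Sp d) → ℝ}
  {g : (Fin t → Sp d) → ℝ}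

open Classical in
/-- The limit of the normalized covariances. -/
def limitCov (K : Sp d → Sp d → ℝ) (f : (Fin s → Sp d) → ℝ) (g : (Fin t → Sp d) → ℝ) : ℝ :=
  ∑ l ∈ Finset.Icc (max s t) (s + t), ((l.factorial : ℝ))⁻¹ *
    ∑ ab ∈ Finset.univ.filter (fun ab => ab ∈ overlaps s t l),
      ∫ u : Fin (l - 1) → Sp d, overlapIntegrand K f g ab u

lemma hasLimitCov_limitCov (hd : 1 ≤ d) (hs : 1 ≤ s) (ht : 1 ≤ t)
    (hK : IsContractionKernel K) (hf : IsLocalStat K r f) (hg : IsLocalStat K r g) :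
    HasLimitCov K f g (limitCov K f g) :=
  ⟨fun l hl ab hab => integrable_overlap hd hs ht hK hf hg hab (Finset.mem_Icc.1 hl).2, by
    rw [limitCov]⟩

lemma integrableOn_of_ae_bounded {l : ℕ} {B : Set (Sp d)} (hBb : Bornology.IsBounded B)
    {F : (Fin l → Sp d) → ℝ} (hF : Measurable F) {c : ℝ} (hd : 1 ≤ d)
    (hc : ∀ z, Function.Injective z → |F z| ≤ c) :
    IntegrableOn F (Set.univ.pi fun _ => B) := by
  have hfin : volume (Set.univ.pi fun _ : Fin l => B) ≠ ∞ :=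
    (Bornology.IsBounded.pi fun _ => hBb).measure_lt_top.ne
  refine IntegrableOn.of_bound hfin.lt_top hF.aestronglyMeasurable c ?_
  filter_upwards [ae_restrict_of_ae (ae_injective hd l)] with z hz
  exact hc z hz

lemma IsLocalStat.integrableOn_mul (hd : 1 ≤ d) (hK : IsContractionKernel K)
    (hf : IsLocalStat K r f) {B : Set (Sp d)} (hBb : Bornology.IsBounded B) :
    IntegrableOn (fun x => f x * jointIntensity K x) (Set.univ.pi fun _ => B) := by
  obtain ⟨c, hc0, hc⟩ := hf.bound
  obtain ⟨m, hm⟩ := hK.jointIntensity_bounded (l := s)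
  refine integrableOn_of_ae_bounded hBb (hf.measurable.mul hK.measurable_jointIntensity)
    (c := c * √m) hd fun x hx => ?_
  have hρ := hK.jointIntensity_nonneg x
  calc |f x * jointIntensity K x|
      = (|f x| * √(jointIntensity K x)) * √(jointIntensity K x) := by
        rw [abs_mul, abs_of_nonneg hρ, mul_assoc, Real.mul_self_sqrt hρ]
    _ ≤ c * √m := by
        gcongr
        · exact hc x hx
        · exact (le_abs_self _).trans (hm x)

lemma IsLocalStat.integrableOn_comp_mul (hd : 1 ≤ d) (hK : IsContractionKernel K)
    (hf : IsLocalStat K r f) (hg : IsLocalStat K r g) {B : Set (Sp d)}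
    (hBb : Bornology.IsBounded B) {l : ℕ} (ab : (Fin s ↪ Fin l) × (Fin t ↪ Fin l)) :
    IntegrableOn (fun z => f (z ∘ ab.1) * g (z ∘ ab.2) * jointIntensity K z)
      (Set.univ.pi fun _ => B) := by
  obtain ⟨c, -, hc⟩ := hf.abs_mul_jointIntensity_le hK hg ab
  exact integrableOn_of_ae_bounded hBb (((hf.measurable.comp (measurable_comp_index _)).mul
    (hg.measurable.comp (measurable_comp_index _))).mul hK.measurable_jointIntensity) hd hc

/-- Disjoint covering tuples merely relabel the coordinates, so the integral factors. The product of
the two means can thus be rewritten as an integral over `l = s + t` points. -/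
lemma setIntegral_comp_mul_comp {l : ℕ} {B : Set (Sp d)} (hB : MeasurableSet B)
    {ab : (Fin s ↪ Fin l) × (Fin t ↪ Fin l)} (hab : ab ∈ overlaps s t l) (hl : l = s + t)
    {F : (Fin s → Sp d) → ℝ} {G : (Fin t → Sp d) → ℝ} (hF : Measurable F) (hG : Measurable G)
    (hFi : IntegrableOn F (Set.univ.pi fun _ => B))
    (hGi : IntegrableOn G (Set.univ.pi fun _ => B)) :
    IntegrableOn (fun z => F (z ∘ ab.1) * G (z ∘ ab.2)) (Set.univ.pi fun _ => B) ∧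
    ∫ z in Set.univ.pi (fun _ => B), F (z ∘ ab.1) * G (z ∘ ab.2) =
      (∫ x in Set.univ.pi (fun _ => B), F x) * ∫ y in Set.univ.pi (fun _ => B), G y := by
  obtain ⟨e, he1, he2⟩ := exists_equiv_of_mem_overlaps hab hl
  have hmp := measurePreserving_sumElim_comp (d := d) e
  have hBm : ∀ m : ℕ, MeasurableSet (Set.univ.pi fun _ : Fin m => B) := fun m =>
    MeasurableSet.univ_pi fun _ => hB
  set H : (Fin l → Sp d) → ℝ := (Set.univ.pi fun _ => B).indicator
    fun z => F (z ∘ ab.1) * G (z ∘ ab.2) with hH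
  have hHm : Measurable H := ((hF.comp (measurable_comp_index _)).mul
    (hG.comp (measurable_comp_index _))).indicator (hBm l)
  have hcomp : ∀ q : (Fin s → Sp d) × (Fin t → Sp d), H (Sum.elim q.1 q.2 ∘ e.symm) =
      (Set.univ.pi fun _ => B).indicator F q.1 * (Set.univ.pi fun _ => B).indicator G q.2 := by
    intro q
    have hx : (Sum.elim q.1 q.2 ∘ e.symm) ∘ ab.1 = q.1 := by
      funext i; simp [← he1]
    have hy : (Sum.elim q.1 q.2 ∘ e.symm) ∘ ab.2 = q.2 := by
      funext i; simp [← he2]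
    have hmem : (Sum.elim q.1 q.2 ∘ e.symm) ∈ (Set.univ.pi fun _ : Fin l => B) ↔
        q.1 ∈ (Set.univ.pi fun _ : Fin s => B) ∧ q.2 ∈ (Set.univ.pi fun _ : Fin t => B) := by
      simp only [Set.mem_pi, Set.mem_univ, true_implies, Function.comp_apply]
      rw [e.symm.forall_congr_left]
      simp
    by_cases h : (Sum.elim q.1 q.2 ∘ e.symm) ∈ (Set.univ.pi fun _ : Fin l => B)
    · rw [hH, Set.indicator_of_mem h, Set.indicator_of_mem (hmem.1 h).1,
        Set.indicator_of_mem (hmem.1 h).2, hx, hy]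
    · rw [hH, Set.indicator_of_notMem h]
      by_cases h1 : q.1 ∈ (Set.univ.pi fun _ : Fin s => B)
      · rw [Set.indicator_of_notMem fun h2 => h (hmem.2 ⟨h1, h2⟩), mul_zero]
      · rw [Set.indicator_of_notMem h1, zero_mul]
  have hFi' := (integrable_indicator_iff (hBm s)).2 hFi
  have hGi' := (integrable_indicator_iff (hBm t)).2 hGi
  have hint : Integrable (fun q : (Fin s → Sp d) × (Fin t → Sp d) =>
      H (Sum.elim q.1 q.2 ∘ e.symm)) (volume.prod volume) := by
    simp only [hcomp]
    exact hFi'.mul_prod hGi'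
  constructor
  · refine (integrable_indicator_iff (hBm l)).1 ?_
    change Integrable H
    rw [← hmp.map_eq, integrable_map_measure hHm.aestronglyMeasurable hmp.aemeasurable]
    exact hint
  · rw [← integral_indicator (hBm l), ← integral_indicator (hBm s), ← integral_indicator (hBm t)]
    change ∫ z, H z = _
    rw [← hmp.map_eq, integral_map hmp.aemeasurable hHm.aestronglyMeasurable,
      Measure.volume_eq_prod]
    simp only [hcomp]
    exact integral_prod_mul _ _

open Classical in
lemma card_overlaps_add (s t : ℕ) :
    (Finset.univ.filter fun ab => ab ∈ overlaps s t (s + t)).card = (s + t).factorial := by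
  have h : Fintype.card (Fin s ⊕ Fin t ≃ Fin (s + t)) = (s + t).factorial := by
    rw [Fintype.card_equiv finSumFinEquiv]
    simp
  rw [← h, ← Finset.card_univ]
  symm
  refine Finset.card_bij (fun e _ => (Function.Embedding.inl.trans e.toEmbedding,
    Function.Embedding.inr.trans e.toEmbedding)) ?_ ?_ ?_
  · intro e _
    simp only [Finset.mem_filter, Finset.mem_univ, true_and]
    intro k
    obtain ⟨i | i, rfl⟩ := e.surjective k
    · exact Or.inl ⟨i, rfl⟩
    · exact Or.inr ⟨i, rfl⟩
  · intro e _ e' _ h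
    rw [Prod.mk.injEq] at h
    ext i : 1
    rcases i with i | i
    · exact DFunLike.congr_fun h.1 i
    · exact DFunLike.congr_fun h.2 i
  · rintro ab hab
    simp only [Finset.mem_filter, Finset.mem_univ, true_and] at hab
    obtain ⟨e, h1, h2⟩ := exists_equiv_of_mem_overlaps hab rfl
    refine ⟨e, Finset.mem_univ _, Prod.ext ?_ ?_⟩
    · ext i : 1; exact h1 i
    · ext i : 1; exact h2 i

variable {Ω : Type*} [MeasurableSpace Ω] {P : Measure Ω} {X : Ω → Set (Sp d)}

/-- The sum of a statistic over the tuples of distinct points of `X` in a window. -/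
def IsPointProcess.statSum (hX : IsPointProcess X) {B : Set (Sp d)} (hBb : Bornology.IsBounded B)
    (f : (Fin s → Sp d) → ℝ) (ω : Ω) : ℝ :=
  ∑ x ∈ tuples s (hX.pts hBb ω), f x

open Classical in
lemma IsDPP.integral_statSum_mul (hX : IsDPP P X K) (hd : 1 ≤ d) (hs : 1 ≤ s)
    (hK : IsContractionKernel K) (hf : IsLocalStat K r f) (hg : IsLocalStat K r g)
    {B : Set (Sp d)} (hB : MeasurableSet B) (hBb : Bornology.IsBounded B) :
    Integrable (fun ω => hX.isPointProcess.statSum hBb f ω * hX.isPointProcess.statSum hBb g ω) P ∧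
    ∫ ω, hX.isPointProcess.statSum hBb f ω * hX.isPointProcess.statSum hBb g ω ∂P =
      ∑ l ∈ Finset.Icc (max s t) (s + t), ((l.factorial : ℝ))⁻¹ *
        ∑ ab ∈ Finset.univ.filter (fun ab => ab ∈ overlaps s t l),
          ∫ z in Set.univ.pi (fun _ => B), f (z ∘ ab.1) * g (z ∘ ab.2) * jointIntensity K z := by
  have hl1 : ∀ l ∈ Finset.Icc (max s t) (s + t), 1 ≤ l := fun l hl =>
    hs.trans ((le_max_left _ _).trans (Finset.mem_Icc.1 hl).1)
  have hcamp := fun (l : ℕ) (hl : 1 ≤ l) (ab : (Fin s ↪ Fin l) × (Fin t ↪ Fin l)) =>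
    hX.integral_tuples hBb hB hl hK.measurable_jointIntensity (hK.jointIntensity_bounded l)
      (F := fun z => f (z ∘ ab.1) * g (z ∘ ab.2))
      ((hf.measurable.comp (measurable_comp_index ab.1)).mul
        (hg.measurable.comp (measurable_comp_index ab.2)))
      (hf.integrableOn_comp_mul hd hK hg hBb ab)
  simp only [IsPointProcess.statSum, sum_tuples_mul_sum_tuples]
  constructor
  · exact integrable_finsetSum _ fun l hl => (integrable_finsetSum _ fun ab _ =>
      (hcamp l (hl1 l hl) ab).1).const_mul _
  · rw [integral_finsetSum _ fun l hl => (integrable_finsetSum _ fun ab _ =>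
      (hcamp l (hl1 l hl) ab).1).const_mul _]
    refine Finset.sum_congr rfl fun l hl => ?_
    rw [integral_const_mul, integral_finsetSum _ fun ab _ => (hcamp l (hl1 l hl) ab).1]
    congr 1
    exact Finset.sum_congr rfl fun ab _ => (hcamp l (hl1 l hl) ab).2

lemma IsDPP.integral_statSum (hX : IsDPP P X K) (hd : 1 ≤ d) (hs : 1 ≤ s)
    (hK : IsContractionKernel K) (hf : IsLocalStat K r f)
    {B : Set (Sp d)} (hB : MeasurableSet B) (hBb : Bornology.IsBounded B) :
    Integrable (hX.isPointProcess.statSum hBb f) P ∧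
    ∫ ω, hX.isPointProcess.statSum hBb f ω ∂P =
      ∫ x in Set.univ.pi (fun _ => B), f x * jointIntensity K x :=
  hX.integral_tuples hBb hB hs hK.measurable_jointIntensity (hK.jointIntensity_bounded s)
    hf.measurable (hf.integrableOn_mul hd hK hBb)

lemma IsDPP.memLp_statSum (hX : IsDPP P X K) (hd : 1 ≤ d) (hs : 1 ≤ s)
    (hK : IsContractionKernel K) (hf : IsLocalStat K r f)
    {B : Set (Sp d)} (hB : MeasurableSet B) (hBb : Bornology.IsBounded B) :
    MemLp (hX.isPointProcess.statSum hBb f) 2 P := by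
  rw [memLp_two_iff_integrable_sq (hX.integral_statSum hd hs hK hf hB hBb).1.1]
  simpa only [sq] using (hX.integral_statSum_mul hd hs hK hf hf hB hBb).1

open Classical in
-- There are `(s + t)!` disjoint patterns, each weighted by `1 / (s + t)!`. Subtracting the product
-- of the means once is therefore the same as subtracting it from every disjoint pattern, which is
-- the truncation in `overlapFun`.
lemma IsDPP.cov_statSum [IsProbabilityMeasure P] (hX : IsDPP P X K) (hd : 1 ≤ d) (hs : 1 ≤ s)
    (ht : 1 ≤ t) (hK : IsContractionKernel K) (hf : IsLocalStat K r f) (hg : IsLocalStat K r g)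
    {B : Set (Sp d)} (hB : MeasurableSet B) (hBb : Bornology.IsBounded B) :
    cov[hX.isPointProcess.statSum hBb f, hX.isPointProcess.statSum hBb g; P] =
      ∑ l ∈ Finset.Icc (max s t) (s + t), ((l.factorial : ℝ))⁻¹ *
        ∑ ab ∈ Finset.univ.filter (fun ab => ab ∈ overlaps s t l),
          ∫ z in Set.univ.pi (fun _ => B), overlapFun K f g ab z := by
  rw [covariance_eq_sub (hX.memLp_statSum hd hs hK hf hB hBb)
    (hX.memLp_statSum hd ht hK hg hB hBb), (hX.integral_statSum hd hs hK hf hB hBb).2,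
    (hX.integral_statSum hd ht hK hg hB hBb).2]
  simp only [Pi.mul_apply]
  rw [(hX.integral_statSum_mul hd hs hK hf hg hB hBb).2]
  set Ef := ∫ x in Set.univ.pi (fun _ => B), f x * jointIntensity K x with hEf
  set Eg := ∫ x in Set.univ.pi (fun _ => B), g x * jointIntensity K x with hEg
  have hterm : ∀ l, ∀ ab ∈ Finset.univ.filter (fun ab => ab ∈ overlaps s t l),
      ∫ z in Set.univ.pi (fun _ => B), overlapFun K f g ab z =
      (∫ z in Set.univ.pi (fun _ => B), f (z ∘ ab.1) * g (z ∘ ab.2) * jointIntensity K z) -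
        if l = s + t then Ef * Eg else 0 := by
    intro l ab hab
    simp only [Finset.mem_filter, Finset.mem_univ, true_and] at hab
    split_ifs with hl
    · have h := setIntegral_comp_mul_comp hB hab hl
        (F := fun x => f x * jointIntensity K x) (G := fun y => g y * jointIntensity K y)
        (hf.measurable.mul hK.measurable_jointIntensity)
        (hg.measurable.mul hK.measurable_jointIntensity)
        (hf.integrableOn_mul hd hK hBb) (hg.integrableOn_mul hd hK hBb)
      rw [hEf, hEg, ← h.2, ← integral_sub (hf.integrableOn_comp_mul hd hK hg hBb ab) h.1]
      refine integral_congr_ae (Eventually.of_forall fun z => ?_)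
      simp only [overlapFun, if_pos hl]
      ring
    · simp only [overlapFun, if_neg hl, sub_zero]
  have hterm' : ∀ l, ∑ ab ∈ Finset.univ.filter (fun ab => ab ∈ overlaps s t l),
      ∫ z in Set.univ.pi (fun _ => B), overlapFun K f g ab z = _ :=
    fun l => Finset.sum_congr rfl (hterm l)
  simp only [hterm', Finset.sum_sub_distrib, mul_sub, Finset.sum_const]
  congr 1
  rw [Finset.sum_eq_single (s + t)]
  · rw [if_pos rfl, card_overlaps_add, nsmul_eq_mul, ← mul_assoc, inv_mul_cancel₀, one_mul]
    exact_mod_cast (s + t).factorial_ne_zero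
  · intro l _ hl
    simp [hl]
  · intro h
    exact absurd (Finset.mem_Icc.2 ⟨max_le (by omega) (by omega), le_rfl⟩) h

theorem IsDPP.tendsto_cov_statSum [IsProbabilityMeasure P] (hX : IsDPP P X K) (hd : 1 ≤ d)
    (hs : 1 ≤ s) (ht : 1 ≤ t) (hK : IsContractionKernel K) (hf : IsLocalStat K r f)
    (hg : IsLocalStat K r g) {D : ℕ → Set (Sp d)} (hD : IsWindowSequence D) :
    Tendsto (fun n => (volume (D n)).toReal⁻¹ *
      cov[hX.isPointProcess.statSum (hD.isBounded n) f,
        hX.isPointProcess.statSum (hD.isBounded n) g; P]) atTop (𝓝 (limitCov K f g)) := by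
  classical
  simp only [fun n => hX.cov_statSum hd hs ht hK hf hg (hD.measurableSet n) (hD.isBounded n),
    Finset.mul_sum, limitCov]
  refine tendsto_finsetSum _ fun l hl => tendsto_finsetSum _ fun ab hab => ?_
  simp only [Finset.mem_filter, Finset.mem_univ, true_and] at hab
  have hl1 : 1 ≤ l := hs.trans ((le_max_left _ _).trans (Finset.mem_Icc.1 hl).1)
  have h := (tendsto_setIntegral_div hd hl1 hD
    (measurable_overlapFun (ab := ab) hK hf.measurable hg.measurable)
    (transInv_overlapFun hK hf.transInv hg.transInv)
    (integrable_overlap hd hs ht hK hf hg hab (Finset.mem_Icc.1 hl).2)).const_mul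
      ((l.factorial : ℝ))⁻¹
  refine h.congr fun n => ?_
  ring

end Covariance

/-! ### Uniform second order expansions in the parameter -/

/-- The functions `g x` have first order expansions at `0` with a remainder which is quadratic
uniformly in `x`. -/
def UniformQuad {β : Type*} (δ : ℝ) (g : β → ℝ → ℝ) : Prop :=
  ∃ B, 0 ≤ B ∧ ∀ x, |g x 0| ≤ B ∧ ∃ g₁, |g₁| ≤ B ∧
    ∀ t, |t| ≤ δ → |g x t - g x 0 - g₁ * t| ≤ B * t ^ 2

namespace UniformQuad
variable {β : Type*} {δ : ℝ} {g h : β → ℝ → ℝ}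

lemma comp {γ : Type*} (hg : UniformQuad δ g) (φ : γ → β) : UniformQuad δ fun x => g (φ x) := by
  obtain ⟨B, hB, H⟩ := hg
  exact ⟨B, hB, fun x => H (φ x)⟩

lemma const (c : ℝ) : UniformQuad δ fun (_ : β) (_ : ℝ) => c :=
  ⟨|c|, abs_nonneg c, fun _ => ⟨le_rfl, 0, by simp, fun t _ => by simp; positivity⟩⟩

lemma add (hg : UniformQuad δ g) (hh : UniformQuad δ h) :
    UniformQuad δ fun x t => g x t + h x t := by
  obtain ⟨B, hB, H⟩ := hg
  obtain ⟨B', hB', H'⟩ := hh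
  refine ⟨B + B', by positivity, fun x => ?_⟩
  obtain ⟨h0, g₁, h1, h2⟩ := H x
  obtain ⟨h0', g₁', h1', h2'⟩ := H' x
  refine ⟨(abs_add_le _ _).trans (add_le_add h0 h0'), g₁ + g₁',
    (abs_add_le _ _).trans (add_le_add h1 h1'), fun t ht => ?_⟩
  calc _ = |(g x t - g x 0 - g₁ * t) + (h x t - h x 0 - g₁' * t)| := by congr 1; ring
    _ ≤ _ := abs_add_le _ _
    _ ≤ B * t ^ 2 + B' * t ^ 2 := add_le_add (h2 t ht) (h2' t ht)
    _ = _ := by ring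

lemma mul (hδ : δ ≤ 1) (hg : UniformQuad δ g) (hh : UniformQuad δ h) :
    UniformQuad δ fun x t => g x t * h x t := by
  obtain ⟨B, hB, H⟩ := hg
  obtain ⟨B', hB', H'⟩ := hh
  -- The remainder of the product consists of four terms bounded by `1`, `2`, `2` and `1` times `B *
  -- B' * t ^ 2`; `|t| ≤ 1` is used to lower the higher powers.
  refine ⟨6 * (B * B'), by positivity, fun x => ?_⟩
  obtain ⟨h0, g₁, h1, h2⟩ := H x
  obtain ⟨h0', g₁', h1', h2'⟩ := H' x
  have hBB : 0 ≤ B * B' := by positivity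
  refine ⟨?_, g x 0 * g₁' + g₁ * h x 0, ?_, fun t ht => ?_⟩
  · rw [abs_mul]
    have := mul_le_mul h0 h0' (abs_nonneg _) hB
    linarith
  · refine (abs_add_le _ _).trans ?_
    rw [abs_mul, abs_mul]
    have e1 := mul_le_mul h0 h1' (abs_nonneg _) hB
    have e2 := mul_le_mul h1 h0' (abs_nonneg _) hB
    linarith
  · have ht1 : |t| ≤ 1 := ht.trans hδ
    have ht2 : t ^ 2 ≤ 1 := by
      rw [← sq_abs]; exact pow_le_one₀ (abs_nonneg _) ht1
    set e := g x t - g x 0 - g₁ * t with he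
    set e' := h x t - h x 0 - g₁' * t with he'
    have a1 : |g₁ * g₁' * t ^ 2| ≤ B * B' * t ^ 2 := by
      rw [abs_mul, abs_mul, abs_of_nonneg (sq_nonneg t)]
      gcongr
    have lin : ∀ (u v b : ℝ), 0 ≤ b → |u| ≤ b → |v| ≤ b → |u + v * t| ≤ 2 * b := by
      intro u v b hb hu hv
      refine (abs_add_le _ _).trans ?_
      rw [abs_mul]
      have := mul_le_mul hv ht1 (abs_nonneg _) hb
      linarith
    have a2 : |e * (h x 0 + g₁' * t)| ≤ B * t ^ 2 * (2 * B') := by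
      rw [abs_mul]
      exact mul_le_mul (h2 t ht) (lin _ _ _ hB' h0' h1') (abs_nonneg _) (by positivity)
    have a3 : |(g x 0 + g₁ * t) * e'| ≤ 2 * B * (B' * t ^ 2) := by
      rw [abs_mul]
      exact mul_le_mul (lin _ _ _ hB h0 h1) (h2' t ht) (abs_nonneg _) (by positivity)
    have a4 : |e * e'| ≤ B * B' * t ^ 2 := by
      rw [abs_mul]
      calc _ ≤ (B * t ^ 2) * (B' * t ^ 2) :=
            mul_le_mul (h2 t ht) (h2' t ht) (abs_nonneg _) (by positivity)
        _ ≤ (B * t ^ 2) * (B' * 1) := by gcongr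
        _ = _ := by ring
    calc _ = |g₁ * g₁' * t ^ 2 + e * (h x 0 + g₁' * t) + (g x 0 + g₁ * t) * e' + e * e'| := by
          congr 1; rw [he, he']; ring
      _ ≤ |g₁ * g₁' * t ^ 2| + |e * (h x 0 + g₁' * t)| + |(g x 0 + g₁ * t) * e'| + |e * e'| :=
          (abs_add_le _ _).trans (by gcongr; exact abs_add_three _ _ _)
      _ ≤ _ := by linarith

lemma sum {ι : Type*} (s : Finset ι) {G : ι → β → ℝ → ℝ} (hG : ∀ i, UniformQuad δ (G i)) :
    UniformQuad δ fun x t => ∑ i ∈ s, G i x t := by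
  classical
  induction s using Finset.induction_on with
  | empty => simpa using const 0
  | insert a s ha ih =>
    simp only [Finset.sum_insert ha]
    exact (hG a).add ih

lemma prod {ι : Type*} (hδ : δ ≤ 1) (s : Finset ι) {G : ι → β → ℝ → ℝ}
    (hG : ∀ i, UniformQuad δ (G i)) : UniformQuad δ fun x t => ∏ i ∈ s, G i x t := by
  classical
  induction s using Finset.induction_on with
  | empty => simpa using const 1
  | insert a s ha ih =>
    simp only [Finset.prod_insert ha]
    exact (hG a).mul hδ ih

end UniformQuad

lemma hasDerivAt_of_abs_sub_le {g : ℝ → ℝ} {g₁ B δ : ℝ} (hδ : 0 < δ)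
    (h : ∀ t, |t| ≤ δ → |g t - g 0 - g₁ * t| ≤ B * t ^ 2) : HasDerivAt g g₁ 0 := by
  rw [hasDerivAt_iff_isLittleO_nhds_zero]
  have h1 : (fun t : ℝ => g (0 + t) - g 0 - t • g₁) =O[𝓝 0] fun t : ℝ => t ^ 2 := by
    refine IsBigO.of_bound B ?_
    filter_upwards [Metric.closedBall_mem_nhds (0 : ℝ) hδ] with t ht
    rw [mem_closedBall_zero_iff, Real.norm_eq_abs] at ht
    have := h t ht
    rw [zero_add, Real.norm_eq_abs, smul_eq_mul, mul_comm t, Real.norm_of_nonneg (sq_nonneg t)]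
    exact this
  refine h1.trans_isLittleO ?_
  simpa using isLittleO_pow_id (𝕜 := ℝ) (n := 2) (by norm_num)

lemma UniformQuad.exists_deriv {β : Type*} {δ : ℝ} {g : β → ℝ → ℝ} (hδ : 0 < δ)
    (hg : UniformQuad δ g) : ∃ B, 0 ≤ B ∧ ∀ x, |g x 0| ≤ B ∧ |deriv (g x) 0| ≤ B ∧
      HasDerivAt (g x) (deriv (g x) 0) 0 ∧
      ∀ t, |t| ≤ δ → |g x t - g x 0 - deriv (g x) 0 * t| ≤ B * t ^ 2 := by
  obtain ⟨B, hB, H⟩ := hg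
  refine ⟨B, hB, fun x => ?_⟩
  obtain ⟨h0, g₁, h1, h2⟩ := H x
  have hd := hasDerivAt_of_abs_sub_le hδ h2
  rw [hd.deriv]
  exact ⟨h0, h1, hd, h2⟩

/-- Landau's inequality. -/
lemma UniformQuad.abs_deriv_le_sqrt {β : Type*} {δ : ℝ} {g : β → ℝ → ℝ} (hδ : 0 < δ)
    (hg : UniformQuad δ g) : ∃ c, 0 ≤ c ∧ ∀ x, (∀ t, |t| ≤ δ → 0 ≤ g x t) →
      |deriv (g x) 0| ≤ c * √(g x 0) := by
  obtain ⟨B, hB, H⟩ := hg.exists_deriv hδ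
  -- Nonnegativity is tested at `t = -g₁ / M`. The term `B / δ` keeps `|t| ≤ δ`, the term `2 * B`
  -- makes the remainder at most half of the linear decrease `g₁ ^ 2 / M`, and the `1` keeps `M`
  -- positive.
  set M := 2 * B + B / δ + 1 with hM
  have hM0 : 0 < M := by positivity
  refine ⟨√(2 * M), by positivity, fun x hx => ?_⟩
  obtain ⟨h0, h1, -, h2⟩ := H x
  set g₁ := deriv (g x) 0 with hg₁
  have hle : |-g₁ / M| ≤ δ := by
    rw [abs_div, abs_neg, abs_of_pos hM0, div_le_iff₀ hM0]
    have : B = δ * (B / δ) := by field_simp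
    calc |g₁| ≤ B := h1
      _ = δ * (B / δ) := this
      _ ≤ δ * M := by
        gcongr
        rw [hM]; linarith
  have e1 := hx _ hle
  have e2 := (abs_le.1 (h2 _ hle)).2
  have e3 : B * (-g₁ / M) ^ 2 ≤ g₁ ^ 2 / (2 * M) := by
    rw [div_pow, neg_sq, ← mul_div_assoc, div_le_div_iff₀ (by positivity) (by positivity)]
    have : 2 * B ≤ M := by
      have : 0 ≤ B / δ := by positivity
      rw [hM]; linarith
    calc B * g₁ ^ 2 * (2 * M) = g₁ ^ 2 * M * (2 * B) := by ring
      _ ≤ g₁ ^ 2 * M * M := by gcongr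
      _ = _ := by ring
  have e4 : g₁ * (-g₁ / M) = -(2 * (g₁ ^ 2 / (2 * M))) := by field_simp
  have e5 : g₁ ^ 2 / (2 * M) ≤ g x 0 := by
    linarith
  rw [div_le_iff₀ (by positivity)] at e5
  rw [← Real.sqrt_mul (by positivity), ← Real.sqrt_sq_eq_abs]
  exact Real.sqrt_le_sqrt (by linarith)

/-! ### Taylor expansion of the model in the parameter -/

section Model
variable {d q : ℕ} {C : EuclideanSpace ℝ (Fin q) → Sp d → ℝ} {Θl : Set ℝ}
  {Θa : Set (EuclideanSpace ℝ (Fin q))}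

/-- The parameter `θ` moved by `t` in the direction of `α_i`. -/
def shiftAlpha {q : ℕ} (i : Fin q) (θ : Param q) (t : ℝ) : Param q :=
  (θ.1, θ.2 + t • EuclideanSpace.single i (1 : ℝ))

lemma shiftAlpha_zero {q : ℕ} (i : Fin q) (θ : Param q) : shiftAlpha i θ 0 = θ := by
  simp [shiftAlpha]

lemma shiftAlpha_sub {q : ℕ} (i : Fin q) (θ : Param q) (t : ℝ) :
    shiftAlpha i θ t - θ = t • ((0, EuclideanSpace.single i (1 : ℝ)) : Param q) := by
  ext <;> simp [shiftAlpha]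

lemma norm_single_param {q : ℕ} (i : Fin q) :
    ‖((0, EuclideanSpace.single i (1 : ℝ)) : Param q)‖ = 1 := by
  simp [Prod.norm_def]

lemma exists_shiftAlpha_mem {i : Fin q} {θ : Param q} (hθ : θ ∈ interior (Θl ×ˢ Θa)) :
    ∃ δ, 0 < δ ∧ δ ≤ 1 ∧ ∀ t, |t| ≤ δ → shiftAlpha i θ t ∈ Θl ×ˢ Θa := by
  obtain ⟨ε, hε, hball⟩ := Metric.mem_nhds_iff.1 (mem_interior_iff_mem_nhds.1 hθ)
  refine ⟨min (ε / 2) 1, by positivity, min_le_right _ _, fun t ht => hball ?_⟩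
  rw [mem_ball_iff_norm, shiftAlpha_sub, norm_smul, norm_single_param, mul_one, Real.norm_eq_abs]
  exact (ht.trans (min_le_left _ _)).trans_lt (by linarith)

/-- The first two derivatives are bounded uniformly in the points, and the parameter set is convex,
so Taylor's formula has a remainder with a constant independent of `x` and `y`. -/
lemma uniformQuad_kernel (hreg : RegularityAssumption C Θl Θa) {i : Fin q} {θ : Param q}
    (hθ : θ ∈ interior (Θl ×ˢ Θa)) {δ : ℝ} (hδ : ∀ t, |t| ≤ δ → shiftAlpha i θ t ∈ Θl ×ˢ Θa) :
    UniformQuad δ fun (z : Sp d × Sp d) t => stationaryKernel C (shiftAlpha i θ t) z.1 z.2 := by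
  obtain ⟨M, hM⟩ := hreg.bounded_deriv
  set S := Θl ×ˢ Θa with hS
  have hθS : θ ∈ S := interior_subset hθ
  have huniq : UniqueDiffOn ℝ S := uniqueDiffOn_convex hreg.convex ⟨θ, hθ⟩
  have hM0 : 0 ≤ M := (norm_nonneg _).trans (hM 0 (by norm_num) θ hθS 0 0)
  refine ⟨M, hM0, fun z => ?_⟩
  set F : Param q → ℝ := fun η => stationaryKernel C η z.1 z.2 with hF
  have hsm : ContDiffOn ℝ 4 F S := hreg.contDiffOn z.1 z.2
  have hF0 : |F θ| ≤ M := by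
    have := hM 0 (by norm_num) θ hθS z.1 z.2
    rwa [norm_iteratedFDerivWithin_zero] at this
  have hF1 : ‖fderivWithin ℝ F S θ‖ ≤ M := by
    have := hM 1 (by norm_num) θ hθS z.1 z.2
    rwa [norm_iteratedFDerivWithin_one _ (huniq θ hθS)] at this
  have hF2 : ∀ η ∈ S, ‖fderivWithin ℝ (fderivWithin ℝ F S) S η‖ ≤ M := by
    intro η hη
    have := hM 2 (by norm_num) η hη z.1 z.2
    rwa [← norm_iteratedFDerivWithin_fderivWithin huniq hη,
      norm_iteratedFDerivWithin_one _ (huniq η hη)] at this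
  have hdiff : DifferentiableOn ℝ F S := hsm.differentiableOn (by norm_num)
  have hdiff2 : DifferentiableOn ℝ (fderivWithin ℝ F S) S :=
    (hsm.fderivWithin huniq (m := 1) (by norm_num)).differentiableOn (by norm_num)
  have hlip : ∀ η ∈ S, ‖fderivWithin ℝ F S η - fderivWithin ℝ F S θ‖ ≤ M * ‖η - θ‖ :=
    fun η hη => hreg.convex.norm_image_sub_le_of_norm_fderivWithin_le hdiff2 hF2 hθS hη
  have htaylor : ∀ η ∈ S, ‖F η - F θ - fderivWithin ℝ F S θ (η - θ)‖ ≤ M * ‖η - θ‖ ^ 2 := by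
    -- On the part of `S` within `‖η - θ‖` of `θ` the derivative varies by at most `M * ‖η - θ‖`.
    -- The mean value inequality there costs one more factor `‖η - θ‖`.
    intro η hη
    set s := S ∩ Metric.closedBall θ ‖η - θ‖ with hs
    have hconv : Convex ℝ s := hreg.convex.inter (convex_closedBall _ _)
    have := hconv.norm_image_sub_le_of_norm_hasFDerivWithin_le' (f := F)
      (f' := fderivWithin ℝ F S) (φ := fderivWithin ℝ F S θ) (C := M * ‖η - θ‖)
      (fun x hx => ((hdiff x hx.1).hasFDerivWithinAt).mono Set.inter_subset_left)
      (fun x hx => (hlip x hx.1).trans (by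
        gcongr
        simpa [dist_eq_norm] using hx.2))
      (x := θ) (y := η) ⟨hθS, by simp⟩ ⟨hη, by simp [dist_eq_norm]⟩
    rwa [mul_assoc, ← sq] at this
  set v : Param q := (0, EuclideanSpace.single i (1 : ℝ)) with hv
  refine ⟨?_, fderivWithin ℝ F S θ v, ?_, fun t ht => ?_⟩
  · beta_reduce; rw [shiftAlpha_zero]; exact hF0
  · rw [← Real.norm_eq_abs]
    refine ((fderivWithin ℝ F S θ).le_opNorm v).trans ?_
    rw [norm_single_param, mul_one]
    exact hF1
  · have h := htaylor _ (hδ t ht)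
    rw [shiftAlpha_sub, norm_smul, norm_single_param, mul_one, Real.norm_eq_abs, Real.norm_eq_abs,
      map_smul, smul_eq_mul, sq_abs, mul_comm t] at h
    beta_reduce
    rw [shiftAlpha_zero]
    exact h

/-- The Leibniz expansion is a polynomial in the kernel entries, and `UniformQuad` is stable under
sums and products. -/
lemma uniformQuad_jointIntensity (hreg : RegularityAssumption C Θl Θa) {i : Fin q} {θ : Param q}
    (hθ : θ ∈ interior (Θl ×ˢ Θa)) {δ : ℝ} (hδ1 : δ ≤ 1)
    (hδ : ∀ t, |t| ≤ δ → shiftAlpha i θ t ∈ Θl ×ˢ Θa) (l : ℕ) :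
    UniformQuad δ fun (x : Fin l → Sp d) t =>
      jointIntensity (stationaryKernel C (shiftAlpha i θ t)) x := by
  simp only [jointIntensity, Matrix.det_apply', kernelMatrix, Matrix.of_apply]
  refine UniformQuad.sum _ fun σ => (UniformQuad.const _).mul hδ1
    (UniformQuad.prod hδ1 _ fun k => ?_)
  exact (uniformQuad_kernel hreg hθ hδ).comp fun x : Fin l → Sp d => (x (σ k), x k)

end Model

/-! ### The score as a sum of local statistics -/

section Score
variable {d q l : ℕ} {C : EuclideanSpace ℝ (Fin q) → Sp d → ℝ} {Θl : Set ℝ}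
  {Θa : Set (EuclideanSpace ℝ (Fin q))} {θ : Param q} {r : ℝ} {w : (Fin l → Sp d) → ℝ}

/-- The derivative `∂_{α_i} ρ_θ` of the joint intensity. -/
def intensityDeriv (C : EuclideanSpace ℝ (Fin q) → Sp d → ℝ) (θ : Param q) (i : Fin q)
    (x : Fin l → Sp d) : ℝ :=
  partialAlpha i (fun η => jointIntensity (stationaryKernel C η) x) θ

/-- An interior parameter can be moved both ways inside the model, where all intensities are
nonnegative. Landau's inequality then gives the bound of `∂ρ` by `√ρ`, uniformly in the points and
in particular near coincidences. -/
lemma exists_intensityDeriv_bounds (hexist : ExistenceAssumption C Θl Θa)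
    (hreg : RegularityAssumption C Θl Θa) (hθ : θ ∈ interior (Θl ×ˢ Θa)) (i : Fin q) (l : ℕ) :
    ∃ δ B c, 0 < δ ∧ 0 ≤ B ∧ 0 ≤ c ∧ (∀ t, |t| ≤ δ → shiftAlpha i θ t ∈ Θl ×ˢ Θa) ∧
      ∀ x : Fin l → Sp d,
        HasDerivAt (fun t => jointIntensity (stationaryKernel C (shiftAlpha i θ t)) x)
          (intensityDeriv C θ i x) 0 ∧
        (∀ t, |t| ≤ δ → |jointIntensity (stationaryKernel C (shiftAlpha i θ t)) x -
          jointIntensity (stationaryKernel C θ) x - intensityDeriv C θ i x * t| ≤ B * t ^ 2) ∧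
        |intensityDeriv C θ i x| ≤ c * √(jointIntensity (stationaryKernel C θ) x) := by
  obtain ⟨δ, hδ, hδ1, hmem⟩ := exists_shiftAlpha_mem (i := i) hθ
  have hQ := uniformQuad_jointIntensity hreg hθ hδ1 hmem l
  obtain ⟨B, hB, H⟩ := hQ.exists_deriv hδ
  obtain ⟨c, hc, H'⟩ := hQ.abs_deriv_le_sqrt hδ
  refine ⟨δ, B, c, hδ, hB, hc, hmem, fun x => ⟨(H x).2.2.1, fun t ht => ?_, ?_⟩⟩
  · have := (H x).2.2.2 t ht
    rwa [shiftAlpha_zero] at this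
  · have := H' x fun t ht =>
      (isContractionKernel_stationaryKernel hexist hreg (hmem t ht)).jointIntensity_nonneg x
    rwa [shiftAlpha_zero] at this

/-- The derivative is a pointwise limit of difference quotients, taken along steps that stay in the
parameter set, where the intensities are continuous in the points. -/
lemma measurable_intensityDeriv (hexist : ExistenceAssumption C Θl Θa)
    (hreg : RegularityAssumption C Θl Θa) (hθ : θ ∈ interior (Θl ×ˢ Θa)) (i : Fin q) :
    Measurable fun x : Fin l → Sp d => intensityDeriv C θ i x := by
  obtain ⟨δ, B, c, hδ, -, -, hmem, H⟩ := exists_intensityDeriv_bounds hexist hreg hθ i l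
  have ht0 : ∀ n : ℕ, 0 < δ / (n + 1) := fun n => by positivity
  have htδ : ∀ n : ℕ, |δ / ((n : ℝ) + 1)| ≤ δ := fun n => by
    rw [abs_of_pos (ht0 n)]
    exact div_le_self hδ.le (by linarith [n.cast_nonneg (α := ℝ)])
  have hlim : Tendsto (fun n : ℕ => δ / ((n : ℝ) + 1)) atTop (𝓝[≠] 0) := by
    refine tendsto_nhdsWithin_iff.2 ⟨?_, Eventually.of_forall fun n => (ht0 n).ne'⟩
    simpa [div_eq_mul_inv] using (tendsto_one_div_add_atTop_nhds_zero_nat (𝕜 := ℝ)).const_mul δ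
  refine measurable_of_tendsto_metrizable (f := fun (n : ℕ) (x : Fin l → Sp d) =>
    (δ / ((n : ℝ) + 1))⁻¹ • (jointIntensity (stationaryKernel C
      (shiftAlpha i θ (0 + δ / ((n : ℝ) + 1)))) x -
      jointIntensity (stationaryKernel C (shiftAlpha i θ 0)) x)) (fun n => ?_)
      (tendsto_pi_nhds.2 fun x => (H x).1.tendsto_slope_zero.comp hlim)
  have h1 := isContractionKernel_stationaryKernel hexist hreg (hmem _ (htδ n))
  have h0 := isContractionKernel_stationaryKernel hexist hreg
    (hmem 0 (by rw [abs_zero]; exact hδ.le))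
  rw [zero_add]
  exact (h1.measurable_jointIntensity.sub h0.measurable_jointIntensity).const_smul
    (δ / ((n : ℝ) + 1))⁻¹

lemma transInv_intensityDeriv (C : EuclideanSpace ℝ (Fin q) → Sp d → ℝ) (θ : Param q)
    (i : Fin q) : TransInv fun x : Fin l → Sp d => intensityDeriv C θ i x := by
  intro c x
  have : ∀ η : Param q, kernelMatrix (stationaryKernel C η) (fun k => x k + c) =
      kernelMatrix (stationaryKernel C η) x := by
    intro η
    ext a b
    simp [kernelMatrix, stationaryKernel]
  simp only [intensityDeriv, jointIntensity, this]

lemma IsWeight.eq_zero (hw : IsWeight r w) {x : Fin l → Sp d} (hx : x ∉ nearTuples d l r) :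
    w x = 0 :=
  image_eq_zero_of_notMem_tsupport (by rwa [hw.support])

lemma IsWeight.isLocalStat_mul (hw : IsWeight r w) {K : Sp d → Sp d → ℝ}
    {h : (Fin l → Sp d) → ℝ} (hm : Measurable h) (hinv : TransInv h)
    (hb : ∃ c, 0 ≤ c ∧ ∀ x, Function.Injective x → |h x| * √(jointIntensity K x) ≤ c) :
    IsLocalStat K r fun x => h x * w x := by
  obtain ⟨M, hM⟩ := hw.bounded
  obtain ⟨c, hc, hb⟩ := hb
  refine ⟨hm.mul hw.measurable, fun c x => ?_, fun x hx => by simp [hw.eq_zero hx],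
    c * M, mul_nonneg hc ((hw.nonneg 0).trans (hM 0)), fun x hx => ?_⟩
  · rw [hinv, hw.translation]
  · rw [abs_mul, abs_of_nonneg (hw.nonneg x), mul_right_comm]
    exact mul_le_mul (hb x hx) (hM x) (hw.nonneg x) hc

/-- The relative derivative `∂_{α_i} ρ_θ / ρ_θ` minus a constant is a local statistic. -/
lemma isLocalStat_logDeriv_sub (hexist : ExistenceAssumption C Θl Θa)
    (hreg : RegularityAssumption C Θl Θa) (hθ : θ ∈ interior (Θl ×ˢ Θa)) (hw : IsWeight r w)
    (i : Fin q) (κ : ℝ) :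
    IsLocalStat (stationaryKernel C θ) r fun x =>
      (intensityDeriv C θ i x / jointIntensity (stationaryKernel C θ) x - κ) * w x := by
  have hK := isContractionKernel_stationaryKernel hexist hreg (interior_subset hθ)
  obtain ⟨_, _, c, -, -, hc, -, H⟩ := exists_intensityDeriv_bounds hexist hreg hθ i l
  obtain ⟨m, hm⟩ := hK.jointIntensity_bounded l
  refine hw.isLocalStat_mul (((measurable_intensityDeriv hexist hreg hθ i).div
    hK.measurable_jointIntensity).sub_const κ) (fun a x => ?_)
    ⟨c + |κ| * √m, by positivity, fun x hx => ?_⟩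
  · have h1 := transInv_intensityDeriv C θ i a x
    have h2 := hK.transInv_jointIntensity a x
    simp only at h1 h2
    simp only [h1, h2]
  · have hpos := hK.jointIntensity_pos hx
    set ρ := jointIntensity (stationaryKernel C θ) x with hρ
    have hs : 0 < √ρ := Real.sqrt_pos.2 hpos
    have h1 : |intensityDeriv C θ i x / ρ| * √ρ ≤ c := by
      rw [abs_div, abs_of_pos hpos, div_mul_eq_mul_div, div_le_iff₀ hpos]
      calc |intensityDeriv C θ i x| * √ρ ≤ (c * √ρ) * √ρ := by
            gcongr; exact (H x).2.2
        _ = c * ρ := by rw [mul_assoc, Real.mul_self_sqrt hpos.le]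
    calc _ ≤ (|intensityDeriv C θ i x / ρ| + |κ|) * √ρ := by gcongr; exact abs_sub _ _
      _ = |intensityDeriv C θ i x / ρ| * √ρ + |κ| * √ρ := by ring
      _ ≤ c + |κ| * √m := by
        gcongr
        exact (le_abs_self _).trans (hm x)

lemma IsWeight.isLocalStat (hw : IsWeight r w) {K : Sp d → Sp d → ℝ}
    (hK : IsContractionKernel K) : IsLocalStat K r w := by
  obtain ⟨m, hm⟩ := hK.jointIntensity_bounded l
  have := hw.isLocalStat_mul (K := K) (h := fun _ => 1) measurable_const (fun _ _ => rfl)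
    ⟨√m, by positivity, fun x _ => by
      rw [abs_one, one_mul]
      exact Real.sqrt_le_sqrt ((le_abs_self _).trans (hm x))⟩
  simpa only [one_mul] using this

lemma isLocalStat_const {K : Sp d → Sp d → ℝ} (hK : IsContractionKernel K) (hr : 0 ≤ r) (c : ℝ) :
    IsLocalStat K r fun _ : Fin 1 → Sp d => c := by
  obtain ⟨m, hm⟩ := hK.jointIntensity_bounded 1
  refine ⟨measurable_const, fun _ _ => rfl, fun x hx => absurd ?_ hx, |c| * √m, by positivity,
    fun x _ => ?_⟩
  · intro i j _
    rw [Subsingleton.elim i j]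
    simpa using hr
  · gcongr
    exact (le_abs_self _).trans (hm x)

/-! ### The derivative of the modified `K`-function -/

/-- The derivative of the modified `K`-function. -/
def modifiedKDeriv (C : EuclideanSpace ℝ (Fin q) → Sp d → ℝ) (w : (Fin l → Sp d) → ℝ)
    (θ : Param q) (i : Fin q) (B : Set (Sp d)) : ℝ :=
  ∫ x in Set.univ.pi (fun _ : Fin l => B), intensityDeriv C θ i x * w x

lemma IsWeight.integrableOn_mul (hw : IsWeight r w) (hd : 1 ≤ d) {h : (Fin l → Sp d) → ℝ}
    (hm : Measurable h) (hb : ∃ c, ∀ x, |h x| ≤ c) {B : Set (Sp d)}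
    (hB : Bornology.IsBounded B) :
    IntegrableOn (fun x => h x * w x) (Set.univ.pi fun _ => B) := by
  obtain ⟨M, hM⟩ := hw.bounded
  obtain ⟨c, hc⟩ := hb
  refine integrableOn_of_ae_bounded hB (hm.mul hw.measurable) (c := c * M) hd fun x _ => ?_
  rw [abs_mul, abs_of_nonneg (hw.nonneg x)]
  exact mul_le_mul (hc x) (hM x) (hw.nonneg x) ((abs_nonneg _).trans (hc x))

lemma exists_abs_intensityDeriv_le (hexist : ExistenceAssumption C Θl Θa)
    (hreg : RegularityAssumption C Θl Θa) (hθ : θ ∈ interior (Θl ×ˢ Θa)) (i : Fin q) (l : ℕ) :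
    ∃ c, ∀ x : Fin l → Sp d, |intensityDeriv C θ i x| ≤ c := by
  obtain ⟨_, _, c, -, -, hc, -, H⟩ := exists_intensityDeriv_bounds hexist hreg hθ i l
  obtain ⟨m, hm⟩ := (isContractionKernel_stationaryKernel hexist hreg
    (interior_subset hθ)).jointIntensity_bounded l
  refine ⟨c * √m, fun x => (H x).2.2.trans ?_⟩
  gcongr
  exact (le_abs_self _).trans (hm x)

/-- The quadratic remainder is uniform in `x`, so it can be integrated directly over the window,
which has finite volume. -/
lemma hasDerivAt_modifiedK (hexist : ExistenceAssumption C Θl Θa)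
    (hreg : RegularityAssumption C Θl Θa) (hθ : θ ∈ interior (Θl ×ˢ Θa)) (hd : 1 ≤ d)
    (hw : IsWeight r w) (i : Fin q) {B : Set (Sp d)} (hB : Bornology.IsBounded B) :
    HasDerivAt (fun t => modifiedK (stationaryKernel C (shiftAlpha i θ t)) w B)
      (modifiedKDeriv C w θ i B) 0 := by
  obtain ⟨δ, b, c, hδ, hb, hc, hmem, H⟩ := exists_intensityDeriv_bounds hexist hreg hθ i l
  obtain ⟨M, hM⟩ := hw.bounded
  have hfin : volume (Set.univ.pi fun _ : Fin l => B) < ∞ :=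
    (Bornology.IsBounded.pi fun _ => hB).measure_lt_top
  refine hasDerivAt_of_abs_sub_le
    (B := b * M * volume.real (Set.univ.pi fun _ : Fin l => B)) hδ fun t ht => ?_
  have hint : ∀ t, |t| ≤ δ → IntegrableOn (fun x =>
      jointIntensity (stationaryKernel C (shiftAlpha i θ t)) x * w x)
      (Set.univ.pi fun _ => B) := fun t ht =>
    have hK := isContractionKernel_stationaryKernel hexist hreg (hmem t ht)
    hw.integrableOn_mul hd hK.measurable_jointIntensity (hK.jointIntensity_bounded l) hB
  have h0 := hint 0 (by rw [abs_zero]; exact hδ.le)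
  have h1 := hw.integrableOn_mul hd (measurable_intensityDeriv hexist hreg hθ i)
    (exists_abs_intensityDeriv_le hexist hreg hθ i l) hB
  have heq : modifiedK (stationaryKernel C (shiftAlpha i θ t)) w B -
      modifiedK (stationaryKernel C (shiftAlpha i θ 0)) w B - modifiedKDeriv C w θ i B * t =
      ∫ x in Set.univ.pi (fun _ : Fin l => B),
        ((jointIntensity (stationaryKernel C (shiftAlpha i θ t)) x * w x -
          jointIntensity (stationaryKernel C (shiftAlpha i θ 0)) x * w x) -
          intensityDeriv C θ i x * w x * t) := by
    have e1 := integral_sub (hint t ht) h0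
    have e2 := integral_sub ((hint t ht).sub h0) (h1.mul_const t)
    simp only [Pi.sub_apply] at e2
    rw [e2, e1, integral_mul_const]
    rfl
  rw [heq, ← Real.norm_eq_abs]
  refine (norm_setIntegral_le_of_norm_le_const (C := b * t ^ 2 * M) hfin fun x _ => ?_).trans
    (le_of_eq (by ring))
  rw [shiftAlpha_zero, show ∀ u v z s : ℝ, u * s - v * s - z * s * t = (u - v - z * t) * s by
    intros; ring, Real.norm_eq_abs, abs_mul, abs_of_nonneg (hw.nonneg x)]
  exact mul_le_mul ((H x).2.1 t ht) (hM x) (hw.nonneg x) (by positivity)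

lemma hasDerivAt_log_modifiedK (hexist : ExistenceAssumption C Θl Θa)
    (hreg : RegularityAssumption C Θl Θa) (hθ : θ ∈ interior (Θl ×ˢ Θa)) (hd : 1 ≤ d)
    (hw : IsWeight r w) (i : Fin q) {B : Set (Sp d)} (hB : Bornology.IsBounded B) :
    HasDerivAt (fun t => Real.log (modifiedK (stationaryKernel C (shiftAlpha i θ t)) w B))
      (modifiedKDeriv C w θ i B / modifiedK (stationaryKernel C θ) w B) 0 := by
  have hder := hasDerivAt_modifiedK hexist hreg hθ hd hw i hB
  by_cases h0 : modifiedK (stationaryKernel C θ) w B = 0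
  -- If the `K`-function vanishes, then `w` vanishes almost everywhere on the window because `ρ > 0`
  -- at distinct points. The `K`-function is then zero for all parameters, and with `log 0 = 0` and
  -- division by zero equal to zero both sides are zero.
  · have hK := isContractionKernel_stationaryKernel hexist hreg (interior_subset hθ)
    have hint := hw.integrableOn_mul hd hK.measurable_jointIntensity
      (hK.jointIntensity_bounded l) hB
    have hz := (setIntegral_eq_zero_iff_of_nonneg_ae (Eventually.of_forall fun x =>
      mul_nonneg (hK.jointIntensity_nonneg x) (hw.nonneg x)) hint).1 h0
    have hw0 : ∀ᵐ x ∂(volume.restrict (Set.univ.pi fun _ : Fin l => B)), w x = 0 := by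
      filter_upwards [hz, ae_restrict_of_ae (ae_injective hd l)] with x hx hinj
      exact (mul_eq_zero.1 hx).resolve_left (hK.jointIntensity_pos hinj).ne'
    have hall : ∀ t, modifiedK (stationaryKernel C (shiftAlpha i θ t)) w B = 0 := by
      intro t
      refine integral_eq_zero_of_ae ?_
      filter_upwards [hw0] with x hx
      simp [hx]
    simp only [hall, h0, div_zero]
    exact hasDerivAt_const _ _
  · have := hder.log (by rwa [shiftAlpha_zero])
    rwa [shiftAlpha_zero] at this

lemma tendsto_modifiedKDeriv_div (hexist : ExistenceAssumption C Θl Θa)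
    (hreg : RegularityAssumption C Θl Θa) (hθ : θ ∈ interior (Θl ×ˢ Θa)) (hd : 1 ≤ d)
    (hl : 1 ≤ l) (hw : IsWeight r w) (i : Fin q) {D : ℕ → Set (Sp d)} (hD : IsWindowSequence D) :
    Tendsto (fun n => modifiedKDeriv C w θ i (D n) / modifiedK (stationaryKernel C θ) w (D n))
      atTop (𝓝 ((∫ u : Fin (l - 1) → Sp d, intensityDeriv C θ i (anchored u) * w (anchored u)) /
        ∫ u : Fin (l - 1) → Sp d,
          jointIntensity (stationaryKernel C θ) (anchored u) * w (anchored u))) := by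
  have hK := isContractionKernel_stationaryKernel hexist hreg (interior_subset hθ)
  obtain ⟨M, hM⟩ := hw.bounded
  have hint : ∀ h : (Fin l → Sp d) → ℝ, Measurable h → (∃ c, ∀ x, |h x| ≤ c) →
      Integrable fun u : Fin (l - 1) → Sp d => h (anchored u) * w (anchored u) := by
    rintro h hm ⟨c, hc⟩
    have hmeas : Measurable fun u : Fin (l - 1) → Sp d => h (anchored u) * w (anchored u) :=
      (hm.mul hw.measurable).comp measurable_anchored
    refine (integrableOn_iff_integrable_of_support_subset
      (s := {u : Fin (l - 1) → Sp d | anchored u ∈ nearTuples d l r}) ?_).1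
      (IntegrableOn.of_bound (volume_anchored_nearTuples_lt_top hl r)
        hmeas.aestronglyMeasurable (c * M) (Eventually.of_forall fun u => ?_))
    · intro u hu
      by_contra hn
      exact hu (by simp [hw.eq_zero hn])
    · rw [Real.norm_eq_abs, abs_mul, abs_of_nonneg (hw.nonneg _)]
      exact mul_le_mul (hc _) (hM _) (hw.nonneg _) ((abs_nonneg _).trans (hc 0))
  have hinv : ∀ h : (Fin l → Sp d) → ℝ, TransInv h → TransInv fun x => h x * w x := by
    intro h hh c x
    change h _ * w _ = h _ * w _
    rw [hh, hw.translation]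
  have hint1 := hint _ hK.measurable_jointIntensity (hK.jointIntensity_bounded l)
  have hinv1 := hinv _ hK.transInv_jointIntensity
  have hm1 : Measurable fun x => jointIntensity (stationaryKernel C θ) x * w x :=
    hK.measurable_jointIntensity.mul hw.measurable
  have hm2 : Measurable fun x => intensityDeriv C θ i x * w x :=
    (measurable_intensityDeriv hexist hreg hθ i).mul hw.measurable
  have h1 := tendsto_setIntegral_div hd hl hD hm1 hinv1 hint1
  have h2 := tendsto_setIntegral_div hd hl hD hm2
    (hinv _ (transInv_intensityDeriv C θ i))
    (hint _ (measurable_intensityDeriv hexist hreg hθ i)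
      (exists_abs_intensityDeriv_le hexist hreg hθ i l))
  by_cases h0 : ∫ u : Fin (l - 1) → Sp d,
      jointIntensity (stationaryKernel C θ) (anchored u) * w (anchored u) = 0
  -- A vanishing limit denominator forces a null integrand, hence a vanishing `K`-function on every
  -- window. Both quotients are then zero by convention.
  · have hz := (integral_eq_zero_iff_of_nonneg (fun u : Fin (l - 1) → Sp d =>
      mul_nonneg (hK.jointIntensity_nonneg _) (hw.nonneg _)) hint1).1 h0
    have hK0 : ∀ n, modifiedK (stationaryKernel C θ) w (D n) = 0 := by
      intro n
      rw [modifiedK, (setIntegral_eq_anchored hl (hD.measurableSet n)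
        (hD.isBounded n).measure_lt_top.ne hm1 hinv1 hint1).2]
      refine integral_eq_zero_of_ae ?_
      filter_upwards [hz] with u hu
      simp only [Pi.zero_apply] at hu
      simp [hu]
    simp only [hK0, h0, div_zero]
    exact tendsto_const_nhds
  · refine (h2.div h1 h0).congr' ?_
    filter_upwards [hD.eventually_volume_pos] with n hn
    exact mul_div_mul_left _ _ (inv_pos.2 hn).ne'

/-! ### The components of the score -/

lemma card_tuples_one (T : Finset (Sp d)) : (tuples 1 T).card = T.card := by
  refine Finset.card_bij (fun x _ => x 0) ?_ ?_ ?_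
  · intro x hx
    exact (mem_tuples.1 hx).1 0
  · intro x _ y _ h
    funext k
    rw [Subsingleton.elim k 0, h]
  · intro a ha
    exact ⟨fun _ => a, mem_tuples.2 ⟨fun _ => ha, Function.injective_of_subsingleton _⟩, rfl⟩

lemma score_zero {D S : Set (Sp d)} (hfin : (S ∩ D).Finite) (hD : MeasurableSet D)
    (hθ : θ.1 ≠ 0) :
    score C w D S θ 0 = (∑ _x ∈ tuples 1 hfin.toFinset, 1 / θ.1) - (volume D).toReal := by
  have h : (fun lam => intensityLogLik D S lam) =
      fun lam => (hfin.toFinset.card : ℝ) * Real.log lam - (volume D).toReal * lam := by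
    funext lam
    rw [intensityLogLik, countMeasure_restrict hfin hD, integral_sum_dirac, Finset.sum_const,
      nsmul_eq_mul, setIntegral_const, smul_eq_mul, Measure.real]
  have hder : HasDerivAt (fun lam => (hfin.toFinset.card : ℝ) * Real.log lam -
      (volume D).toReal * lam) ((hfin.toFinset.card : ℝ) * θ.1⁻¹ - (volume D).toReal * 1) θ.1 :=
    ((Real.hasDerivAt_log hθ).const_mul _).sub ((hasDerivAt_id _).const_mul _)
  rw [score, Fin.cons_zero, h, hder.deriv, Finset.sum_const, card_tuples_one, nsmul_eq_mul]
  simp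

/-- Only finitely many tuples lie in the window and their points are distinct, so every `ρ` is
positive and the logarithms can be differentiated term by term. -/
lemma score_succ (hexist : ExistenceAssumption C Θl Θa)
    (hreg : RegularityAssumption C Θl Θa) (hθ : θ ∈ interior (Θl ×ˢ Θa)) (hd : 1 ≤ d)
    (hw : IsWeight r w) (i : Fin q) {D S : Set (Sp d)} (hfin : (S ∩ D).Finite)
    (hD : MeasurableSet D) (hDb : Bornology.IsBounded D) :
    score C w D S θ i.succ = ∑ x ∈ tuples l hfin.toFinset,
      (intensityDeriv C θ i x / jointIntensity (stationaryKernel C θ) x -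
        modifiedKDeriv C w θ i D / modifiedK (stationaryKernel C θ) w D) * w x := by
  have hK := isContractionKernel_stationaryKernel hexist hreg (interior_subset hθ)
  obtain ⟨_, _, _, -, -, -, -, H⟩ := exists_intensityDeriv_bounds hexist hreg hθ i l
  have hlog := hasDerivAt_log_modifiedK hexist hreg hθ hd hw i hDb
  have hder : HasDerivAt (fun t => compositeLogLik (stationaryKernel C (shiftAlpha i θ t)) w D S)
      (∑ x ∈ tuples l hfin.toFinset,
      (intensityDeriv C θ i x / jointIntensity (stationaryKernel C θ) x -
        modifiedKDeriv C w θ i D / modifiedK (stationaryKernel C θ) w D) * w x) 0 := by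
    simp only [compositeLogLik, setIntegral_factorialMeasure hfin hD]
    refine HasDerivAt.fun_sum fun x hx => ?_
    have hpos := hK.jointIntensity_pos (mem_tuples.1 hx).2
    have h1 := (H x).1.log (by rw [shiftAlpha_zero]; exact hpos.ne')
    rw [shiftAlpha_zero] at h1
    exact (h1.sub hlog).mul_const _
  rw [score, Fin.cons_succ]
  exact hder.deriv

end Score

/-! ### Convergence of the covariance of the normalized score -/

section Limit
variable {d s t : ℕ} {K : Sp d → Sp d → ℝ} {r : ℝ} {f f' : (Fin s → Sp d) → ℝ}
  {g g' : (Fin t → Sp d) → ℝ} {Ω : Type*} [MeasurableSpace Ω] {P : Measure Ω}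
  {X : Ω → Set (Sp d)}

lemma cov_const_mul_sub_sub [IsProbabilityMeasure P] {Z W Z' W' : Ω → ℝ} (hZ : MemLp Z 2 P)
    (hW : MemLp W 2 P) (hZ' : MemLp Z' 2 P) (hW' : MemLp W' 2 P) (c ε ε' b b' : ℝ) :
    cov[fun ω => c * (Z ω - ε * W ω - b), fun ω => c * (Z' ω - ε' * W' ω - b'); P] =
      c ^ 2 * cov[Z, Z'; P] - ε' * (c ^ 2 * cov[Z, W'; P]) - ε * (c ^ 2 * cov[W, Z'; P]) +
        ε * ε' * (c ^ 2 * cov[W, W'; P]) := by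
  have h1 : MemLp (fun ω => Z ω - ε * W ω) 2 P := hZ.sub (hW.const_mul ε)
  have h2 : MemLp (fun ω => Z' ω - ε' * W' ω) 2 P := hZ'.sub (hW'.const_mul ε')
  rw [covariance_const_mul_left, covariance_const_mul_right,
    covariance_sub_const_left (h1.integrable (by norm_num)),
    covariance_sub_const_right (h2.integrable (by norm_num)),
    covariance_fun_sub_fun_sub hZ (hW.const_mul ε) hZ' (hW'.const_mul ε'),
    covariance_const_mul_left, covariance_const_mul_right, covariance_const_mul_left,
    covariance_const_mul_right]
  ring

/-- Expanded bilinearly, the perturbation produces normalized covariances that converge, multiplied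
by coefficients that vanish. The constants `b` and `b'` drop out of the covariance. -/
lemma IsDPP.tendsto_cov_perturbed [IsProbabilityMeasure P] (hX : IsDPP P X K) (hd : 1 ≤ d)
    (hs : 1 ≤ s) (ht : 1 ≤ t) (hK : IsContractionKernel K) (hf : IsLocalStat K r f)
    (hf' : IsLocalStat K r f') (hg : IsLocalStat K r g) (hg' : IsLocalStat K r g')
    {D : ℕ → Set (Sp d)} (hD : IsWindowSequence D) {ε ε' : ℕ → ℝ} (hε : Tendsto ε atTop (𝓝 0))
    (hε' : Tendsto ε' atTop (𝓝 0)) (b b' : ℕ → ℝ) :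
    Tendsto (fun n => cov[
      fun ω => (√(volume (D n)).toReal)⁻¹ * (hX.isPointProcess.statSum (hD.isBounded n) f ω -
        ε n * hX.isPointProcess.statSum (hD.isBounded n) f' ω - b n),
      fun ω => (√(volume (D n)).toReal)⁻¹ * (hX.isPointProcess.statSum (hD.isBounded n) g ω -
        ε' n * hX.isPointProcess.statSum (hD.isBounded n) g' ω - b' n); P])
      atTop (𝓝 (limitCov K f g)) := by
  have hm := fun n => hX.memLp_statSum hd hs hK hf (hD.measurableSet n) (hD.isBounded n)
  have hm' := fun n => hX.memLp_statSum hd hs hK hf' (hD.measurableSet n) (hD.isBounded n)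
  have hn := fun n => hX.memLp_statSum hd ht hK hg (hD.measurableSet n) (hD.isBounded n)
  have hn' := fun n => hX.memLp_statSum hd ht hK hg' (hD.measurableSet n) (hD.isBounded n)
  have hsq : ∀ n, ((√(volume (D n)).toReal)⁻¹) ^ 2 = (volume (D n)).toReal⁻¹ := fun n => by
    rw [inv_pow, Real.sq_sqrt ENNReal.toReal_nonneg]
  simp only [fun n => cov_const_mul_sub_sub (hm n) (hm' n) (hn n) (hn' n), hsq]
  have h := (((hX.tendsto_cov_statSum hd hs ht hK hf hg hD).sub
    (hε'.mul (hX.tendsto_cov_statSum hd hs ht hK hf hg' hD))).sub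
    (hε.mul (hX.tendsto_cov_statSum hd hs ht hK hf' hg hD))).add
    ((hε.mul hε').mul (hX.tendsto_cov_statSum hd hs ht hK hf' hg' hD))
  simpa only [zero_mul, sub_zero, add_zero] using h

end Limit

section Model
variable {d q p : ℕ} {C : EuclideanSpace ℝ (Fin q) → Sp d → ℝ} {Θl : Set ℝ}
  {Θa : Set (EuclideanSpace ℝ (Fin q))} {θ : Param q} {r : ℝ} {w : (Fin p → Sp d) → ℝ}

lemma isLocalStat_limitScoreDensity (hexist : ExistenceAssumption C Θl Θa)
    (hreg : RegularityAssumption C Θl Θa) (hθ : θ ∈ interior (Θl ×ˢ Θa)) (hw : IsWeight r w)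
    (i : Fin q) : IsLocalStat (stationaryKernel C θ) r (limitScoreDensity C w θ i) :=
  isLocalStat_logDeriv_sub hexist hreg hθ hw i _

/-- The limit variance of the first component of the score. -/
lemma limitCov_const (hK : IsContractionKernel (stationaryKernel C θ)) (hlam : 0 < θ.1)
    (hC : C θ.2 0 = 1) :
    limitCov (stationaryKernel C θ) (fun _ : Fin 1 → Sp d => 1 / θ.1)
      (fun _ : Fin 1 → Sp d => 1 / θ.1) = 1 / θ.1 - ∫ u, C θ.2 u ^ 2 := by
  classical
  have heven : ∀ u, C θ.2 (-u) = C θ.2 u := by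
    intro u
    have := hK.symm 0 u
    simpa [stationaryKernel, hlam.ne'] using this
  have hone : ∀ x : Fin 1 → Sp d, jointIntensity (stationaryKernel C θ) x = θ.1 := by
    intro x
    simp [jointIntensity, kernelMatrix, stationaryKernel, hC]
  have htwo : ∀ u : Fin 1 → Sp d, jointIntensity (stationaryKernel C θ) (anchored u : Fin 2 → Sp d)
      = θ.1 ^ 2 - θ.1 ^ 2 * C θ.2 (u 0) ^ 2 := by
    intro u
    simp [jointIntensity, kernelMatrix, stationaryKernel, Matrix.det_fin_two, anchored, hC, heven]
    ring
  have h1 : ∀ ab : (Fin 1 ↪ Fin 1) × (Fin 1 ↪ Fin 1),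
      ∫ u : Fin (1 - 1) → Sp d, overlapIntegrand (stationaryKernel C θ)
        (fun _ : Fin 1 → Sp d => 1 / θ.1) (fun _ : Fin 1 → Sp d => 1 / θ.1) ab u = 1 / θ.1 := by
    intro ab
    -- For `l = 1` there are no displacements, and Lebesgue measure on the one-point space has mass
    -- one; the term is `(1 / lam) ^ 2 * lam`.
    have hvol : (volume : Measure (Fin (1 - 1) → Sp d)).real Set.univ = 1 := by
      rw [Measure.real, volume_pi, Measure.pi_univ]
      rfl
    simp only [overlapIntegrand, hone]
    simp [hvol]
    field_simp
  have h2 : ∀ ab : (Fin 1 ↪ Fin 2) × (Fin 1 ↪ Fin 2),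
      ∫ u : Fin (2 - 1) → Sp d, overlapIntegrand (stationaryKernel C θ)
        (fun _ : Fin 1 → Sp d => 1 / θ.1) (fun _ : Fin 1 → Sp d => 1 / θ.1) ab u =
        -∫ u, C θ.2 u ^ 2 := by
    intro ab
    have : ∀ u : Fin (2 - 1) → Sp d, overlapIntegrand (stationaryKernel C θ)
        (fun _ : Fin 1 → Sp d => 1 / θ.1) (fun _ : Fin 1 → Sp d => 1 / θ.1) ab u =
        -(C θ.2 (u 0) ^ 2) := by
      intro u
      simp only [overlapIntegrand, hone, if_pos, htwo u]
      field_simp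
      ring
    simp only [this]
    rw [integral_neg]
    congr 1
    exact (volume_preserving_funUnique (Fin 1) (Sp d)).integral_comp
      (MeasurableEquiv.measurableEmbedding _) fun u => C θ.2 u ^ 2
  have hcard1 : (Finset.univ.filter fun ab => ab ∈ overlaps 1 1 1).card = 1 := by
    rw [Finset.card_eq_one]
    refine ⟨(Function.Embedding.refl _, Function.Embedding.refl _), ?_⟩
    ext ab
    simp only [Finset.mem_filter, Finset.mem_univ, true_and, Finset.mem_singleton]
    refine ⟨fun _ => Prod.ext (by ext; simp) (by ext; simp),
      fun _ k => Or.inl ⟨0, Subsingleton.elim _ _⟩⟩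
  have hIcc : Finset.Icc (max 1 1) (1 + 1) = {1, 2} := rfl
  -- The two orders of a pair of points cancel the factor `1 / 2!`, leaving `-∫ C ^ 2` once.
  have hcard2 : (Finset.univ.filter fun ab => ab ∈ overlaps 1 1 2).card = 2 := card_overlaps_add 1 1
  rw [limitCov, hIcc, Finset.sum_pair (by norm_num)]
  simp only [h1, h2, Finset.sum_const, hcard1, hcard2, nsmul_eq_mul]
  norm_num [Nat.factorial]
  ring

end Model
end DPPScore

end

/-! ### The limit of the score covariance -/

theorem mainTheorem5 {d q p : ℕ} (hd : 1 ≤ d) (hp : 2 ≤ p)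
    (C : EuclideanSpace ℝ (Fin q) → DPPScore.Sp d → ℝ)
    (Θl : Set ℝ) (Θa : Set (EuclideanSpace ℝ (Fin q)))
    (hexist : DPPScore.ExistenceAssumption C Θl Θa)
    (hreg : DPPScore.RegularityAssumption C Θl Θa)
    (θ₀ : DPPScore.Param q) (hθ₀ : θ₀ ∈ interior (Θl ×ˢ Θa))
    {r : ℝ} (hr : 0 < r) (w : (Fin p → DPPScore.Sp d) → ℝ) (hw : DPPScore.IsWeight r w)
    (D : ℕ → Set (DPPScore.Sp d)) (hD : DPPScore.IsWindowSequence D)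
    {Ω : Type*} [MeasurableSpace Ω] (P : Measure Ω) [IsProbabilityMeasure P]
    (X : Ω → Set (DPPScore.Sp d))
    (hX : DPPScore.IsDPP P X (DPPScore.stationaryKernel C θ₀)) :
    (∀ n i, MemLp (fun ω => DPPScore.normalizedScore C w (D n) (X ω) θ₀ i) 2 P) ∧
    ∃ Sig : Matrix (Fin (q + 1)) (Fin (q + 1)) ℝ,
      Tendsto
        (fun n : ℕ => Matrix.of fun i j : Fin (q + 1) =>
          cov[fun ω => DPPScore.normalizedScore C w (D n) (X ω) θ₀ i,
            fun ω => DPPScore.normalizedScore C w (D n) (X ω) θ₀ j; P])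
        atTop (𝓝 Sig) ∧
      Sig 0 0 = 1 / θ₀.1 - ∫ u, C θ₀.2 u ^ 2 ∧
      (∀ i : Fin q,
        DPPScore.HasLimitCov (DPPScore.stationaryKernel C θ₀)
          (fun _ : Fin 1 → DPPScore.Sp d => 1 / θ₀.1)
          (DPPScore.limitScoreDensity C w θ₀ i) (Sig 0 i.succ) ∧
        Sig i.succ 0 = Sig 0 i.succ) ∧
      ∀ i j : Fin q,
        DPPScore.HasLimitCov (DPPScore.stationaryKernel C θ₀)
          (DPPScore.limitScoreDensity C w θ₀ i) (DPPScore.limitScoreDensity C w θ₀ j)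
          (Sig i.succ j.succ) := by
  have hK := DPPScore.isContractionKernel_stationaryKernel hexist hreg (interior_subset hθ₀)
  have hp1 : 1 ≤ p := by omega
  have hlam : 0 < θ₀.1 := hexist.lam_pos _ (interior_subset hθ₀).1
  have hcst := DPPScore.isLocalStat_const hK hr.le (1 / θ₀.1)
  have hf := DPPScore.isLocalStat_limitScoreDensity hexist hreg hθ₀ hw
  have hwl := hw.isLocalStat hK
  set N := hX.isPointProcess
  set κ : Fin q → ℕ → ℝ := fun i n => DPPScore.modifiedKDeriv C w θ₀ i (D n) /
    DPPScore.modifiedK (DPPScore.stationaryKernel C θ₀) w (D n)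
  set κ' : Fin q → ℝ := fun i =>
    (∫ u : Fin (p - 1) → DPPScore.Sp d,
      DPPScore.intensityDeriv C θ₀ i (DPPScore.anchored u) * w (DPPScore.anchored u)) /
    ∫ u : Fin (p - 1) → DPPScore.Sp d,
      DPPScore.jointIntensity (DPPScore.stationaryKernel C θ₀) (DPPScore.anchored u) *
        w (DPPScore.anchored u)
  have hε : ∀ i, Tendsto (fun n => κ i n - κ' i) atTop (𝓝 0) := fun i => by
    have h : Tendsto (κ i) atTop (𝓝 (κ' i)) :=
      DPPScore.tendsto_modifiedKDeriv_div hexist hreg hθ₀ hd hp1 hw i hD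
    simpa only [sub_self] using h.sub_const (κ' i)
  -- The zero multiple brings the first component into the form required by `tendsto_cov_perturbed`;
  -- its compensator `|D|` is the constant `b`.
  have h0 : ∀ n, (fun ω => DPPScore.normalizedScore C w (D n) (X ω) θ₀ 0) = fun ω =>
      (√(volume (D n)).toReal)⁻¹ * (N.statSum (hD.isBounded n) (fun _ : Fin 1 → _ => 1 / θ₀.1) ω -
        0 * N.statSum (hD.isBounded n) (fun _ : Fin 1 → _ => 1 / θ₀.1) ω -
        (volume (D n)).toReal) := fun n => by
    funext ω
    rw [DPPScore.normalizedScore, DPPScore.score_zero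
      (N.finite_inter ω _ (hD.isBounded n)) (hD.measurableSet n) hlam.ne', zero_mul, sub_zero]
    rfl
  -- The window centering `κ i n` is split into its limit, which belongs to the limit density, and
  -- an error multiplying the local sum of `w`.
  have h1 : ∀ i n, (fun ω => DPPScore.normalizedScore C w (D n) (X ω) θ₀ i.succ) = fun ω =>
      (√(volume (D n)).toReal)⁻¹ *
        (N.statSum (hD.isBounded n) (DPPScore.limitScoreDensity C w θ₀ i) ω -
        (κ i n - κ' i) * N.statSum (hD.isBounded n) w ω - 0) := fun i n => by
    funext ω
    rw [DPPScore.normalizedScore, DPPScore.score_succ hexist hreg hθ₀ hd hw i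
      (N.finite_inter ω _ (hD.isBounded n)) (hD.measurableSet n) (hD.isBounded n), sub_zero,
      DPPScore.IsPointProcess.statSum, DPPScore.IsPointProcess.statSum]
    congr 1
    rw [Finset.mul_sum, ← Finset.sum_sub_distrib]
    refine Finset.sum_congr rfl fun x _ => ?_
    change (_ - κ i n) * w x =
      (DPPScore.intensityDeriv C θ₀ i x / _ - κ' i) * w x - (κ i n - κ' i) * w x
    ring
  have hmc := fun n => hX.memLp_statSum hd le_rfl hK hcst (hD.measurableSet n) (hD.isBounded n)
  have hmf := fun i n => hX.memLp_statSum hd hp1 hK (hf i) (hD.measurableSet n) (hD.isBounded n)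
  have hmw := fun n => hX.memLp_statSum hd hp1 hK hwl (hD.measurableSet n) (hD.isBounded n)
  refine ⟨fun n => Fin.cases ?_ fun i => ?_, Matrix.of (Fin.cons
    (Fin.cons
      (DPPScore.limitCov (DPPScore.stationaryKernel C θ₀)
        (fun _ : Fin 1 → DPPScore.Sp d => 1 / θ₀.1)
        (fun _ : Fin 1 → DPPScore.Sp d => 1 / θ₀.1))
      fun j => DPPScore.limitCov (DPPScore.stationaryKernel C θ₀)
        (fun _ : Fin 1 → DPPScore.Sp d => 1 / θ₀.1) (DPPScore.limitScoreDensity C w θ₀ j))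
    fun i => Fin.cons
      (DPPScore.limitCov (DPPScore.stationaryKernel C θ₀)
        (fun _ : Fin 1 → DPPScore.Sp d => 1 / θ₀.1) (DPPScore.limitScoreDensity C w θ₀ i))
      fun j => DPPScore.limitCov (DPPScore.stationaryKernel C θ₀)
        (DPPScore.limitScoreDensity C w θ₀ i) (DPPScore.limitScoreDensity C w θ₀ j)), ?_, ?_,
    fun i => ⟨?_, ?_⟩, fun i j => ?_⟩
  · rw [h0]
    exact (((hmc n).sub ((hmc n).const_mul 0)).sub (memLp_const _)).const_mul _
  · rw [h1]
    exact (((hmf i n).sub ((hmw n).const_mul _)).sub (memLp_const _)).const_mul _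
  · have h01 : ∀ j, Tendsto (fun n => cov[fun ω => DPPScore.normalizedScore C w (D n) (X ω) θ₀ 0,
        fun ω => DPPScore.normalizedScore C w (D n) (X ω) θ₀ j.succ; P]) atTop
        (𝓝 (DPPScore.limitCov (DPPScore.stationaryKernel C θ₀)
        (fun _ : Fin 1 → DPPScore.Sp d => 1 / θ₀.1) (DPPScore.limitScoreDensity C w θ₀ j))) := by
      intro j
      simp only [h0, h1]
      exact hX.tendsto_cov_perturbed hd le_rfl hp1 hK hcst hcst (hf j) hwl hD
        tendsto_const_nhds (hε j) _ _
    refine tendsto_pi_nhds.2 fun i => tendsto_pi_nhds.2 fun j => ?_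
    refine Fin.cases (Fin.cases ?_ (fun j => ?_) j) (fun i => Fin.cases ?_ (fun j => ?_) j) i
    · simp only [Matrix.of_apply, Fin.cons_zero, h0]
      exact hX.tendsto_cov_perturbed hd le_rfl le_rfl hK hcst hcst hcst hcst hD
        tendsto_const_nhds tendsto_const_nhds _ _
    · exact h01 j
    · refine (h01 i).congr fun n => ?_
      exact covariance_comm _ _
    · simp only [Matrix.of_apply, Fin.cons_succ, h1]
      exact hX.tendsto_cov_perturbed hd hp1 hp1 hK (hf i) hwl (hf j) hwl hD (hε i) (hε j) _ _
  · exact DPPScore.limitCov_const hK hlam (hexist.normalized _ (interior_subset hθ₀).2)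
  · exact DPPScore.hasLimitCov_limitCov hd le_rfl hp1 hK hcst (hf i)
  · rfl
  · exact DPPScore.hasLimitCov_limitCov hd hp1 hp1 hK (hf i) (hf j)
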